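/- Let $N\ge 1$ and let $\omega:[0,\infty)\to[0,\infty)$ be a non-quasianalytic weight function, i.e. a continuous increasing function such that $(\alpha)$ there is $K\ge 1$ with $\omega(2t)\le K(1+\omega(t))$ for all $t\ge 0$; $(\beta)$ $\int_1^\infty \frac{\omega(t)}{1+t^2}\,dt<\infty$; $(\gamma)$ there are $a\in\mathbb R$, $b>0$ with $\omega(t)\ge a+b\log(1+t)$ for all $t\ge 0$; $(\delta)$ $\varphi_\omega(t):=\omega(e^t)$ is convex. Put $\omega(x):=\omega(|x|)$ for $x\in\mathbb R^N$, and $\varphi_\omega^*(s):=\sup_{t\ge 0}(st-\varphi_\omega(t))\in(-\infty,\infty]$ for $s\ge 0$, with $\exp(-\infty)=0$. Let $\mathcal S_\omega(\mathbb R^N)$ be the space of all $f\in L^1(\mathbb R^N)$ such that $f,\hat f\in C^\infty(\mathbb R^N)$ and $\|\exp(\lambda\omega)\partial^\alpha f\|_\infty<\infty$, $\|\exp(\lambda\omega)\partial^\alpha \hat f\|_\infty<\infty$ for all $\lambda>0$ and $\alpha\in\mathbb N_0^N$, where $\hat f(\xi)=\int_{\mathbb R^N} f(x)e^{-ix\xi}\,dx$.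 It carries the locally convex topology generated by the norms $\|\exp(n\omega)\partial^\alpha f\|_\infty+\|\exp(n\omega)\partial^\alpha\hat f\|_\infty$ ($n\in\mathbb N$, $\alpha\in\mathbb N_0^N$). Let $\mathcal O_{M,\omega}(\mathbb R^N)$ be the space of all $f\in C^\infty(\mathbb R^N)$ such that for every $m\in\mathbb N$, $m\ge 1$, there are $n\in\mathbb N$ and $C>0$ with $$|\partial^\alpha f(x)|\exp\Big(-n\omega(x)-m\varphi_\omega^*\big(\tfrac{|\alpha|}{m}\big)\Big)\le C\qquad\text{for all }\alpha\in\mathbb N_0^N,\ x\in\mathbb R^N.$$ Let $\tau$ be the locally convex topology on $\mathcal O_{M,\omega}(\mathbb R^N)$ generated by the seminorms $$q_{m,g}(f):=\sup_{\alpha\in\mathbb N_0^N}\sup_{x\in\mathbb R^N}|g(x)||\partial^\alpha f(x)|\exp\Big(-m\varphi_\omega^*\big(\tfrac{|\alpha|}{m}\big)\Big),\qquad m\in\mathbb N,\ m\ge 1,\ g\in\mathcal S_\omega(\mathbb R^N).$$ Then $\mathcal O_{M,\omega}(\mathbb R^N)$ is the space of multipliers of $\mathcal S_\omega(\mathbb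 R^N)$: a function $f$ belongs to it if and only if $f\in C^\infty(\mathbb R^N)$ and $fg\in\mathcal S_\omega(\mathbb R^N)$ for every $g\in\mathcal S_\omega(\mathbb R^N)$; moreover, for $f\in\mathcal O_{M,\omega}(\mathbb R^N)$ the operator $M_f(g):=fg$ on $\mathcal S_\omega(\mathbb R^N)$ is continuous, and $f\mapsto M_f$ is a linear injection of $\mathcal O_{M,\omega}(\mathbb R^N)$ into the space $\mathcal L(\mathcal S_\omega(\mathbb R^N))$ of continuous linear operators on $\mathcal S_\omega(\mathbb R^N)$. Let $\tau_b$ and $\tau_s$ be the topologies on $\mathcal O_{M,\omega}(\mathbb R^N)$ induced through $f\mapsto M_f$ by $\mathcal L_b(\mathcal S_\omega(\mathbb R^N))$ (uniform convergence on bounded sets) and by $\mathcal L_s(\mathcal S_\omega(\mathbb R^N))$ (strong operator topology, i.e. pointwise convergence). Then $\tau\supseteq\tau_b\supseteq\tau_s$, i.e. the identity maps $$(\mathcal O_{M,\omega}(\mathbb R^N),\tau)\to(\mathcal O_{M,\omega}(\mathbb R^N),\tau_b)\to(\mathcal O_{M,\omega}(\mathbb R^N),\tau_s)$$ are continuous,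 and the three topologies have the same bounded sets. -/

import Mathlib

open MeasureTheory Set
open scoped Topology

/-- A non-quasianalytic weight function `ω : [0, ∞) → [0, ∞)`; the values of `toFun` on negative
numbers play no role. -/
structure NQWeight where
  toFun : ℝ → ℝ
  continuousOn' : ContinuousOn toFun (Ici 0)
  monotoneOn' : MonotoneOn toFun (Ici 0)
  nonneg' : ∀ t, 0 ≤ t → 0 ≤ toFun t
  /-- condition (α) -/
  doubling' : ∃ K : ℝ, 1 ≤ K ∧ ∀ t, 0 ≤ t → toFun (2 * t) ≤ K * (1 + toFun t)
  /-- condition (β) -/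
  integrable' : IntegrableOn (fun t => toFun t / (1 + t ^ 2)) (Ioi 1)
  /-- condition (γ) -/
  log_le' : ∃ a b : ℝ, 0 < b ∧ ∀ t, 0 ≤ t → a + b * Real.log (1 + t) ≤ toFun t
  /-- condition (δ) -/
  convex' : ConvexOn ℝ univ (fun t => toFun (Real.exp t))

instance : CoeFun NQWeight (fun _ => ℝ → ℝ) := ⟨NQWeight.toFun⟩

/-- The Young conjugate `φ*(s) = sup_{t ≥ 0} (s t - φ(t))` of `φ(t) = ω(e^t)`. The value `+∞` does
occur, for instance for `ω(t) = log (1 + t)` and `s > 1`. -/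
noncomputable def youngConj (ω : NQWeight) (s : ℝ) : EReal :=
  ⨆ t : Ici (0 : ℝ), ((s * t - ω (Real.exp t) : ℝ) : EReal)

/-- The number `exp (- m φ*(k / m))`, where `exp (-∞) = 0`. The conjugate is never `-∞`, so
that `toReal` is not applied to `∞` here. -/
noncomputable def youngWeight (ω : NQWeight) (m : ℕ+) (k : ℕ) : ℝ :=
  (EReal.exp (-(((m : ℝ) : EReal) * youngConj ω ((k : ℝ) / (m : ℝ))))).toReal

/-- The partial derivative of `f` in the direction of the `i`-th coordinate. -/
noncomputable def partialD {N : ℕ} (i : Fin N) (f : EuclideanSpace ℝ (Fin N) → ℂ) :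
    EuclideanSpace ℝ (Fin N) → ℂ :=
  fun x => fderiv ℝ f x (EuclideanSpace.single i 1)

/-- The partial derivative `∂^α f` for a multi-index `α`. -/
noncomputable def multiD {N : ℕ} (α : Fin N → ℕ) (f : EuclideanSpace ℝ (Fin N) → ℂ) :
    EuclideanSpace ℝ (Fin N) → ℂ :=
  (List.finRange N).foldr (fun i h => (partialD i)^[α i] h) f

/-- The Fourier transform `f̂(ξ) = ∫ f(x) e^{-i x ξ} dx`. -/
noncomputable def hatF {N : ℕ} (f : EuclideanSpace ℝ (Fin N) → ℂ) :
    EuclideanSpace ℝ (Fin N) → ℂ :=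
  fun ξ => ∫ x, f x * Complex.exp (-Complex.I * ((inner ℝ x ξ : ℝ) : ℂ))

section Helpers

variable {N : ℕ}

theorem contDiff_partialD (i : Fin N) {f : EuclideanSpace ℝ (Fin N) → ℂ}
    (hf : ContDiff ℝ (⊤ : ℕ∞) f) : ContDiff ℝ (⊤ : ℕ∞) (partialD i f) :=
  (hf.fderiv_right (m := ((⊤ : ℕ∞) : WithTop ℕ∞)) (by simp)).clm_apply contDiff_const

theorem contDiff_partialD_iterate (i : Fin N) (k : ℕ) {f : EuclideanSpace ℝ (Fin N) → ℂ}
    (hf : ContDiff ℝ (⊤ : ℕ∞) f) : ContDiff ℝ (⊤ : ℕ∞) ((partialD i)^[k] f) := by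
  induction k with
  | zero => exact hf
  | succ k ih => rw [Function.iterate_succ_apply']; exact contDiff_partialD i ih

theorem partialD_add (i : Fin N) {f g : EuclideanSpace ℝ (Fin N) → ℂ}
    (hf : ContDiff ℝ (⊤ : ℕ∞) f) (hg : ContDiff ℝ (⊤ : ℕ∞) g) :
    partialD i (f + g) = partialD i f + partialD i g := by
  funext x
  have h1 : DifferentiableAt ℝ f x := hf.differentiable (by simp) x
  have h2 : DifferentiableAt ℝ g x := hg.differentiable (by simp) x
  simp [partialD, fderiv_add h1 h2]

theorem partialD_smul (i : Fin N) (c : ℂ) {f : EuclideanSpace ℝ (Fin N) → ℂ}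
    (hf : ContDiff ℝ (⊤ : ℕ∞) f) : partialD i (c • f) = c • partialD i f := by
  funext x
  have h1 : DifferentiableAt ℝ f x := hf.differentiable (by simp) x
  simp [partialD, fderiv_const_smul h1 c]

theorem partialD_iterate_add (i : Fin N) (k : ℕ) {f g : EuclideanSpace ℝ (Fin N) → ℂ}
    (hf : ContDiff ℝ (⊤ : ℕ∞) f) (hg : ContDiff ℝ (⊤ : ℕ∞) g) :
    (partialD i)^[k] (f + g) = (partialD i)^[k] f + (partialD i)^[k] g := by
  induction k with
  | zero => rfl
  | succ k ih =>
    simp only [Function.iterate_succ_apply']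
    rw [ih, partialD_add i (contDiff_partialD_iterate i k hf) (contDiff_partialD_iterate i k hg)]

theorem partialD_iterate_smul (i : Fin N) (k : ℕ) (c : ℂ) {f : EuclideanSpace ℝ (Fin N) → ℂ}
    (hf : ContDiff ℝ (⊤ : ℕ∞) f) : (partialD i)^[k] (c • f) = c • (partialD i)^[k] f := by
  induction k with
  | zero => rfl
  | succ k ih =>
    simp only [Function.iterate_succ_apply']
    rw [ih, partialD_smul i c (contDiff_partialD_iterate i k hf)]

theorem multiD_add (α : Fin N → ℕ) {f g : EuclideanSpace ℝ (Fin N) → ℂ}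
    (hf : ContDiff ℝ (⊤ : ℕ∞) f) (hg : ContDiff ℝ (⊤ : ℕ∞) g) :
    multiD α (f + g) = multiD α f + multiD α g := by
  unfold multiD
  suffices h : ∀ l : List (Fin N),
      ContDiff ℝ (⊤ : ℕ∞) (l.foldr (fun i h => (partialD i)^[α i] h) f) ∧
      ContDiff ℝ (⊤ : ℕ∞) (l.foldr (fun i h => (partialD i)^[α i] h) g) ∧
      l.foldr (fun i h => (partialD i)^[α i] h) (f + g) =
        l.foldr (fun i h => (partialD i)^[α i] h) f +
        l.foldr (fun i h => (partialD i)^[α i] h) g from (h _).2.2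
  intro l
  induction l with
  | nil => exact ⟨hf, hg, rfl⟩
  | cons i l ih =>
    obtain ⟨h1, h2, h3⟩ := ih
    simp only [List.foldr_cons]
    refine ⟨contDiff_partialD_iterate i _ h1, contDiff_partialD_iterate i _ h2, ?_⟩
    rw [h3, partialD_iterate_add i _ h1 h2]

theorem multiD_smul (α : Fin N → ℕ) (c : ℂ) {f : EuclideanSpace ℝ (Fin N) → ℂ}
    (hf : ContDiff ℝ (⊤ : ℕ∞) f) : multiD α (c • f) = c • multiD α f := by
  unfold multiD
  suffices h : ∀ l : List (Fin N),
      ContDiff ℝ (⊤ : ℕ∞) (l.foldr (fun i h => (partialD i)^[α i] h) f) ∧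
      l.foldr (fun i h => (partialD i)^[α i] h) (c • f) =
        c • l.foldr (fun i h => (partialD i)^[α i] h) f from (h _).2
  intro l
  induction l with
  | nil => exact ⟨hf, rfl⟩
  | cons i l ih =>
    obtain ⟨h1, h3⟩ := ih
    simp only [List.foldr_cons]
    refine ⟨contDiff_partialD_iterate i _ h1, ?_⟩
    rw [h3, partialD_iterate_smul i _ c h1]

theorem multiD_zero_index (f : EuclideanSpace ℝ (Fin N) → ℂ) :
    multiD (0 : Fin N → ℕ) f = f := by
  unfold multiD
  induction List.finRange N with
  | nil => rfl
  | cons i l ih => simp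

theorem integrable_hatF_integrand {f : EuclideanSpace ℝ (Fin N) → ℂ} (hf : Integrable f)
    (ξ : EuclideanSpace ℝ (Fin N)) :
    Integrable (fun x => f x * Complex.exp (-Complex.I * ((inner ℝ x ξ : ℝ) : ℂ))) := by
  refine hf.mul_bdd (c := 1) ?_ (Filter.Eventually.of_forall fun x => ?_)
  · exact (by fun_prop : Continuous fun x : EuclideanSpace ℝ (Fin N) =>
      Complex.exp (-Complex.I * ((inner ℝ x ξ : ℝ) : ℂ))).aestronglyMeasurable
  · rw [Complex.norm_exp]
    simp

theorem hatF_add {f g : EuclideanSpace ℝ (Fin N) → ℂ} (hf : Integrable f) (hg : Integrable g) :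
    hatF (f + g) = hatF f + hatF g := by
  funext ξ
  simp only [hatF, Pi.add_apply, add_mul]
  exact integral_add (integrable_hatF_integrand hf ξ) (integrable_hatF_integrand hg ξ)

theorem hatF_smul (c : ℂ) (f : EuclideanSpace ℝ (Fin N) → ℂ) : hatF (c • f) = c • hatF f := by
  funext ξ
  simp only [hatF, Pi.smul_apply, smul_eq_mul, mul_assoc]
  exact integral_const_mul c _

/-- The seminorm `v ↦ sup_i c_i |ℓ_i(v)|` for linear functionals `ℓ_i`, provided that all these
suprema are finite. -/
noncomputable def supSeminorm {V ι : Type*} [AddCommGroup V] [Module ℂ V] (c : ι → ℝ)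
    (l : ι → V → ℂ) (hc : ∀ i, 0 ≤ c i) (hadd : ∀ i u v, l i (u + v) = l i u + l i v)
    (hsmul : ∀ i (a : ℂ) v, l i (a • v) = a * l i v)
    (hb : ∀ v, BddAbove (range fun i => c i * ‖l i v‖)) : Seminorm ℂ V :=
  Seminorm.of (fun v => ⨆ i, c i * ‖l i v‖)
    (by
      intro u v
      have h0 : ∀ w, 0 ≤ ⨆ i, c i * ‖l i w‖ := fun w =>
        Real.iSup_nonneg fun i => mul_nonneg (hc i) (norm_nonneg _)
      refine Real.iSup_le (fun i => ?_) (add_nonneg (h0 u) (h0 v))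
      calc c i * ‖l i (u + v)‖ ≤ c i * (‖l i u‖ + ‖l i v‖) := by
            rw [hadd]
            exact mul_le_mul_of_nonneg_left (norm_add_le _ _) (hc i)
        _ = c i * ‖l i u‖ + c i * ‖l i v‖ := mul_add _ _ _
        _ ≤ _ := add_le_add (le_ciSup (hb u) i) (le_ciSup (hb v) i))
    (by
      intro a v
      rw [Real.mul_iSup_of_nonneg (norm_nonneg a)]
      congr 1
      funext i
      rw [hsmul, norm_mul]
      ring)

end Helpers

/-- The functions in `S_ω(ℝ^N)`: `f` is integrable, `f` and `f̂` are smooth, and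
`exp(λ ω) ∂^α f` and `exp(λ ω) ∂^α f̂` are bounded for all `λ > 0` and all `α`. -/
def SOmegaSubmodule (ω : NQWeight) (N : ℕ) : Submodule ℂ (EuclideanSpace ℝ (Fin N) → ℂ) where
  carrier := {f | Integrable f ∧ ContDiff ℝ (⊤ : ℕ∞) f ∧ ContDiff ℝ (⊤ : ℕ∞) (hatF f) ∧
    ∀ lam : ℝ, 0 < lam → ∀ α : Fin N → ℕ,
      (∃ C : ℝ, ∀ x, Real.exp (lam * ω ‖x‖) * ‖multiD α f x‖ ≤ C) ∧
      (∃ C : ℝ, ∀ ξ, Real.exp (lam * ω ‖ξ‖) * ‖multiD α (hatF f) ξ‖ ≤ C)}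
  add_mem' := by
    rintro f g ⟨hf1, hf2, hf3, hf4⟩ ⟨hg1, hg2, hg3, hg4⟩
    refine ⟨hf1.add hg1, hf2.add hg2, ?_, fun lam hl α => ⟨?_, ?_⟩⟩
    · rw [hatF_add hf1 hg1]; exact hf3.add hg3
    · obtain ⟨C, hC⟩ := (hf4 lam hl α).1
      obtain ⟨D, hD⟩ := (hg4 lam hl α).1
      refine ⟨C + D, fun x => ?_⟩
      rw [multiD_add α hf2 hg2]
      calc _ ≤ Real.exp (lam * ω ‖x‖) * (‖multiD α f x‖ + ‖multiD α g x‖) :=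
            mul_le_mul_of_nonneg_left (norm_add_le _ _) (Real.exp_nonneg _)
        _ ≤ C + D := by rw [mul_add]; exact add_le_add (hC x) (hD x)
    · obtain ⟨C, hC⟩ := (hf4 lam hl α).2
      obtain ⟨D, hD⟩ := (hg4 lam hl α).2
      refine ⟨C + D, fun x => ?_⟩
      rw [hatF_add hf1 hg1, multiD_add α hf3 hg3]
      calc _ ≤ Real.exp (lam * ω ‖x‖) * (‖multiD α (hatF f) x‖ + ‖multiD α (hatF g) x‖) :=
            mul_le_mul_of_nonneg_left (norm_add_le _ _) (Real.exp_nonneg _)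
        _ ≤ C + D := by rw [mul_add]; exact add_le_add (hC x) (hD x)
  zero_mem' := by
    have hz : hatF (0 : EuclideanSpace ℝ (Fin N) → ℂ) = 0 := by
      simpa using hatF_smul 0 (0 : EuclideanSpace ℝ (Fin N) → ℂ)
    have h0 : ContDiff ℝ (⊤ : ℕ∞) (0 : EuclideanSpace ℝ (Fin N) → ℂ) := contDiff_const
    have hm : ∀ α : Fin N → ℕ, multiD α (0 : EuclideanSpace ℝ (Fin N) → ℂ) = 0 := fun α => by
      simpa using multiD_smul α 0 h0
    refine ⟨integrable_zero _ _ _, h0, ?_, fun lam hl α => ⟨⟨0, ?_⟩, ⟨0, ?_⟩⟩⟩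
    · rw [hz]; exact h0
    · simp [hm]
    · simp [hz, hm]
  smul_mem' := by
    rintro c f ⟨hf1, hf2, hf3, hf4⟩
    refine ⟨hf1.smul c, contDiff_const.smul hf2, ?_, fun lam hl α => ⟨?_, ?_⟩⟩
    · rw [hatF_smul]; exact contDiff_const.smul hf3
    · obtain ⟨C, hC⟩ := (hf4 lam hl α).1
      refine ⟨‖c‖ * C, fun x => ?_⟩
      rw [multiD_smul α c hf2, Pi.smul_apply, norm_smul, mul_left_comm]
      exact mul_le_mul_of_nonneg_left (hC x) (norm_nonneg c)
    · obtain ⟨C, hC⟩ := (hf4 lam hl α).2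
      refine ⟨‖c‖ * C, fun x => ?_⟩
      rw [hatF_smul, multiD_smul α c hf3, Pi.smul_apply, norm_smul, mul_left_comm]
      exact mul_le_mul_of_nonneg_left (hC x) (norm_nonneg c)

/-- The space `S_ω(ℝ^N)`, as a type of its own (so that it does not carry the topology of
pointwise convergence of functions). -/
def SOmega (ω : NQWeight) (N : ℕ) : Type := SOmegaSubmodule ω N

/-- The functions in `O_{M,ω}(ℝ^N)`: smooth functions `f` such that for every `m ≥ 1` there is `n`
with `sup_α sup_x |∂^α f(x)| exp(-n ω(x) - m φ*(|α| / m)) < ∞`. -/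
def OMOmegaSubmodule (ω : NQWeight) (N : ℕ) : Submodule ℂ (EuclideanSpace ℝ (Fin N) → ℂ) where
  carrier := {f | ContDiff ℝ (⊤ : ℕ∞) f ∧ ∀ m : ℕ+, ∃ n : ℕ, ∃ C : ℝ, ∀ (α : Fin N → ℕ) (x),
    ‖multiD α f x‖ * Real.exp (-(n * ω ‖x‖)) * youngWeight ω m (∑ i, α i) ≤ C}
  add_mem' := by
    rintro f g ⟨hf1, hf2⟩ ⟨hg1, hg2⟩
    refine ⟨hf1.add hg1, fun m => ?_⟩
    obtain ⟨n, C, hC⟩ := hf2 m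
    obtain ⟨k, D, hD⟩ := hg2 m
    refine ⟨n + k, C + D, fun α x => ?_⟩
    have hw : 0 ≤ youngWeight ω m (∑ i, α i) := ENNReal.toReal_nonneg
    have ho := ω.nonneg' ‖x‖ (norm_nonneg x)
    have e1 : Real.exp (-(((n + k : ℕ) : ℝ) * ω ‖x‖)) ≤ Real.exp (-(n * ω ‖x‖)) := by
      apply Real.exp_le_exp.2
      have := mul_nonneg (Nat.cast_nonneg (α := ℝ) k) ho
      push_cast
      linarith
    have e2 : Real.exp (-(((n + k : ℕ) : ℝ) * ω ‖x‖)) ≤ Real.exp (-(k * ω ‖x‖)) := by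
      apply Real.exp_le_exp.2
      have := mul_nonneg (Nat.cast_nonneg (α := ℝ) n) ho
      push_cast
      linarith
    rw [multiD_add α hf1 hg1]
    calc ‖multiD α f x + multiD α g x‖ * Real.exp (-(((n + k : ℕ) : ℝ) * ω ‖x‖)) *
          youngWeight ω m (∑ i, α i)
        ≤ (‖multiD α f x‖ + ‖multiD α g x‖) * Real.exp (-(((n + k : ℕ) : ℝ) * ω ‖x‖)) *
          youngWeight ω m (∑ i, α i) := by
          gcongr
          exact norm_add_le _ _
      _ = ‖multiD α f x‖ * Real.exp (-(((n + k : ℕ) : ℝ) * ω ‖x‖)) * youngWeight ω m (∑ i, α i) +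
          ‖multiD α g x‖ * Real.exp (-(((n + k : ℕ) : ℝ) * ω ‖x‖)) * youngWeight ω m (∑ i, α i) := by
          ring
      _ ≤ ‖multiD α f x‖ * Real.exp (-(n * ω ‖x‖)) * youngWeight ω m (∑ i, α i) +
          ‖multiD α g x‖ * Real.exp (-(k * ω ‖x‖)) * youngWeight ω m (∑ i, α i) := by
          gcongr
      _ ≤ C + D := add_le_add (hC α x) (hD α x)
  zero_mem' := by
    have h0 : ContDiff ℝ (⊤ : ℕ∞) (0 : EuclideanSpace ℝ (Fin N) → ℂ) := contDiff_const
    refine ⟨h0, fun m => ⟨0, 0, fun α x => ?_⟩⟩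
    have hm : multiD α (0 : EuclideanSpace ℝ (Fin N) → ℂ) = 0 := by
      simpa using multiD_smul α 0 h0
    simp [hm]
  smul_mem' := by
    rintro c f ⟨hf1, hf2⟩
    refine ⟨contDiff_const.smul hf1, fun m => ?_⟩
    obtain ⟨n, C, hC⟩ := hf2 m
    refine ⟨n, ‖c‖ * C, fun α x => ?_⟩
    rw [multiD_smul α c hf1, Pi.smul_apply, norm_smul, mul_assoc ‖c‖, mul_assoc ‖c‖]
    exact mul_le_mul_of_nonneg_left (hC α x) (norm_nonneg c)

/-- The space `O_{M,ω}(ℝ^N)`, as a type of its own without a topology. -/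
def OMOmega (ω : NQWeight) (N : ℕ) : Type := OMOmegaSubmodule ω N

section Spaces

variable {ω : NQWeight} {N : ℕ}

instance : AddCommGroup (SOmega ω N) := inferInstanceAs (AddCommGroup (SOmegaSubmodule ω N))

instance : Module ℂ (SOmega ω N) := inferInstanceAs (Module ℂ (SOmegaSubmodule ω N))

instance : CoeFun (SOmega ω N) (fun _ => EuclideanSpace ℝ (Fin N) → ℂ) := ⟨Subtype.val⟩

instance : AddCommGroup (OMOmega ω N) := inferInstanceAs (AddCommGroup (OMOmegaSubmodule ω N))

instance : Module ℂ (OMOmega ω N) := inferInstanceAs (Module ℂ (OMOmegaSubmodule ω N))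

instance : CoeFun (OMOmega ω N) (fun _ => EuclideanSpace ℝ (Fin N) → ℂ) := ⟨Subtype.val⟩

theorem exp_nat_mul_le (ω : NQWeight) (n : ℕ) (x : EuclideanSpace ℝ (Fin N)) :
    Real.exp (n * ω ‖x‖) ≤ Real.exp (((n : ℝ) + 1) * ω ‖x‖) := by
  apply Real.exp_le_exp.2
  have := ω.nonneg' ‖x‖ (norm_nonneg x)
  linarith

theorem SOmega.exists_bound (f : SOmega ω N) (n : ℕ) (α : Fin N → ℕ) :
    ∃ C : ℝ, ∀ x, Real.exp (n * ω ‖x‖) * ‖multiD α (f : EuclideanSpace ℝ (Fin N) → ℂ) x‖ ≤ C := by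
  obtain ⟨C, hC⟩ := (f.2.2.2.2 ((n : ℝ) + 1) (by positivity) α).1
  exact ⟨C, fun x => (mul_le_mul_of_nonneg_right (exp_nat_mul_le ω n x)
    (norm_nonneg _)).trans (hC x)⟩

theorem SOmega.exists_bound_hat (f : SOmega ω N) (n : ℕ) (α : Fin N → ℕ) :
    ∃ C : ℝ, ∀ ξ, Real.exp (n * ω ‖ξ‖) * ‖multiD α (hatF f) ξ‖ ≤ C := by
  obtain ⟨C, hC⟩ := (f.2.2.2.2 ((n : ℝ) + 1) (by positivity) α).2
  exact ⟨C, fun x => (mul_le_mul_of_nonneg_right (exp_nat_mul_le ω n x)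
    (norm_nonneg _)).trans (hC x)⟩

theorem bddAbove_range_of_exists {ι : Type*} {u : ι → ℝ} (h : ∃ C, ∀ i, u i ≤ C) :
    BddAbove (range u) := by
  obtain ⟨C, hC⟩ := h
  exact ⟨C, by rintro _ ⟨i, rfl⟩; exact hC i⟩

/-- The norms `‖exp(n ω) ∂^α f‖_∞ + ‖exp(n ω) ∂^α f̂‖_∞` on `S_ω(ℝ^N)`. -/
noncomputable def sOmegaSeminorm (ω : NQWeight) (N : ℕ) :
    SeminormFamily ℂ (SOmega ω N) (ℕ × (Fin N → ℕ)) := fun p =>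
  supSeminorm (ι := EuclideanSpace ℝ (Fin N)) (fun x => Real.exp (p.1 * ω ‖x‖))
    (fun x (f : SOmega ω N) => multiD p.2 (f : EuclideanSpace ℝ (Fin N) → ℂ) x) (fun _ => Real.exp_nonneg _)
    (fun x f g => congrFun (multiD_add p.2 f.2.2.1 g.2.2.1) x)
    (fun x a f => congrFun (multiD_smul p.2 a f.2.2.1) x)
    (fun f => bddAbove_range_of_exists (f.exists_bound p.1 p.2)) +
  supSeminorm (ι := EuclideanSpace ℝ (Fin N)) (fun ξ => Real.exp (p.1 * ω ‖ξ‖))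
    (fun ξ (f : SOmega ω N) => multiD p.2 (hatF f) ξ) (fun _ => Real.exp_nonneg _)
    (fun ξ f g => by
      have h : hatF ((f + g : SOmega ω N) : EuclideanSpace ℝ (Fin N) → ℂ) = hatF f + hatF g :=
        hatF_add f.2.1 g.2.1
      rw [h, multiD_add p.2 f.2.2.2.1 g.2.2.2.1]
      rfl)
    (fun ξ a f => by
      have h : hatF ((a • f : SOmega ω N) : EuclideanSpace ℝ (Fin N) → ℂ) = a • hatF f :=
        hatF_smul a f
      rw [h, multiD_smul p.2 a f.2.2.2.1]
      rfl)
    (fun f => bddAbove_range_of_exists (f.exists_bound_hat p.1 p.2))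

/-- The locally convex topology of `S_ω(ℝ^N)`. -/
noncomputable instance : TopologicalSpace (SOmega ω N) :=
  (sOmegaSeminorm ω N).moduleFilterBasis.topology

theorem sOmega_withSeminorms (ω : NQWeight) (N : ℕ) : WithSeminorms (sOmegaSeminorm ω N) := ⟨rfl⟩

instance : IsTopologicalAddGroup (SOmega ω N) := (sOmega_withSeminorms ω N).topologicalAddGroup

instance : ContinuousSMul ℂ (SOmega ω N) := (sOmega_withSeminorms ω N).continuousSMul

theorem OMOmega.bound (f : OMOmega ω N) (m : ℕ+) (g : SOmega ω N) :
    ∃ C : ℝ, ∀ p : (Fin N → ℕ) × EuclideanSpace ℝ (Fin N),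
      ‖g p.2‖ * youngWeight ω m (∑ i, p.1 i) *
        ‖multiD p.1 (f : EuclideanSpace ℝ (Fin N) → ℂ) p.2‖ ≤ C := by
  obtain ⟨n, C, hC⟩ := f.2.2 m
  obtain ⟨D, hD⟩ := g.exists_bound n 0
  rw [multiD_zero_index] at hD
  refine ⟨D * C, fun p => ?_⟩
  have hw : 0 ≤ youngWeight ω m (∑ i, p.1 i) := ENNReal.toReal_nonneg
  have h1 := hC p.1 p.2
  have h2 := hD p.2
  have he : Real.exp (n * ω ‖p.2‖) * Real.exp (-(n * ω ‖p.2‖)) = 1 := by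
    rw [← Real.exp_add, add_neg_cancel, Real.exp_zero]
  calc ‖g p.2‖ * youngWeight ω m (∑ i, p.1 i) *
        ‖multiD p.1 (f : EuclideanSpace ℝ (Fin N) → ℂ) p.2‖
      = (Real.exp (n * ω ‖p.2‖) * ‖g p.2‖) *
        (‖multiD p.1 (f : EuclideanSpace ℝ (Fin N) → ℂ) p.2‖ * Real.exp (-(n * ω ‖p.2‖)) *
          youngWeight ω m (∑ i, p.1 i)) := by
        linear_combination (-(‖g p.2‖ * youngWeight ω m (∑ i, p.1 i) *
          ‖multiD p.1 (f : EuclideanSpace ℝ (Fin N) → ℂ) p.2‖)) * he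
    _ ≤ D * C := mul_le_mul h2 h1 (by positivity)
        (le_trans (by positivity) h2)

/-- The seminorms `q_{m,g}(f) = sup_α sup_x |g(x)| |∂^α f(x)| exp(-m φ*(|α| / m))` on
`O_{M,ω}(ℝ^N)`, for `m ≥ 1` and `g ∈ S_ω(ℝ^N)`. -/
noncomputable def omSeminorm (ω : NQWeight) (N : ℕ) :
    SeminormFamily ℂ (OMOmega ω N) (ℕ+ × SOmega ω N) := fun q =>
  supSeminorm (ι := (Fin N → ℕ) × EuclideanSpace ℝ (Fin N))
    (fun p => ‖q.2 p.2‖ * youngWeight ω q.1 (∑ i, p.1 i))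
    (fun p (f : OMOmega ω N) => multiD p.1 (f : EuclideanSpace ℝ (Fin N) → ℂ) p.2)
    (fun _ => mul_nonneg (norm_nonneg _) ENNReal.toReal_nonneg)
    (fun p f g => congrFun (multiD_add p.1 f.2.1 g.2.1) p.2)
    (fun p a f => congrFun (multiD_smul p.1 a f.2.1) p.2)
    (fun f => bddAbove_range_of_exists (f.bound q.1 q.2))

end Spaces

/-- The topology `τ` on `O_{M,ω}(ℝ^N)`, generated by the seminorms `q_{m,g}`. -/
noncomputable abbrev tauTop (ω : NQWeight) (N : ℕ) : TopologicalSpace (OMOmega ω N) :=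
  (omSeminorm ω N).moduleFilterBasis.topology

/-- The topology `τ_b` on `O_{M,ω}(ℝ^N)`, induced through `M` by `L_b(S_ω)`: the continuous linear
operators with the topology of uniform convergence on (von Neumann) bounded sets. -/
noncomputable abbrev tauBTop {ω : NQWeight} {N : ℕ}
    (M : OMOmega ω N →ₗ[ℂ] (SOmega ω N →L[ℂ] SOmega ω N)) : TopologicalSpace (OMOmega ω N) :=
  TopologicalSpace.induced M ContinuousLinearMap.topologicalSpace

/-- The topology `τ_s` on `O_{M,ω}(ℝ^N)`, induced through `M` by `L_s(S_ω)`: the continuous linear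
operators with the strong operator topology, i.e. the topology of pointwise convergence. -/
noncomputable abbrev tauSTop {ω : NQWeight} {N : ℕ}
    (M : OMOmega ω N →ₗ[ℂ] (SOmega ω N →L[ℂ] SOmega ω N)) : TopologicalSpace (OMOmega ω N) :=
  TopologicalSpace.induced
    (fun f => (ContinuousLinearMap.toUniformConvergenceCLM (RingHom.id ℂ) (SOmega ω N)
      {s : Set (SOmega ω N) | Finite s} (M f) : SOmega ω N →Lₚₜ[ℂ] SOmega ω N)) inferInstance

/-! Everything rests on describing $\mathcal S_\omega$ by uniform derivative estimates. The number
`youngWeight ω m n` is the reciprocal of $\sup_{r\ge1} r^n e^{-m\omega(r)}$. As a sequence in $n$ it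
is submultiplicative and, after enlarging $m$, absorbs geometric factors $c^n$. So weighted bounds
on all derivatives survive Leibniz' rule, the passage between partial and total derivatives, and
multiplication by Gaussians.

Decay of $f$ and $\hat f$ alone controls all derivatives with weights
(`exists_youngWeight_mul_iteratedFDeriv_le`). Cut out $f$ near $x$ by a Gaussian: the transform of
the piece decays in both $x$ and $\xi$, Fourier inversion bounds its derivatives at the centre, and
the Gaussian is divided out again. Conversely, weighted derivative bounds give decay of $\hat f$
through the biconjugate estimate `exists_le_of_pow_mul_youngWeight_le` (`exists_norm_fourier_le`).
Hence membership in $\mathcal S_\omega$, and its topology, are described by either kind of estimate,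
and functions in $\mathcal O_{M,\omega}$ are seen to be multipliers by Leibniz' rule.

For $\tau\supseteq\tau_b$, the weighted derivatives of all members of a bounded set of $\mathcal
S_\omega$ lie below one rapidly decaying envelope. Smoothing this envelope by a Gaussian produces a
single $g_0\in\mathcal S_\omega$ above it (`exists_sOmega_dominating`), so one seminorm $q_{m,g_0}$
controls $fg$ uniformly over the bounded set.

For the bounded sets, and for the fact that every smooth multiplier lies in $\mathcal O_{M,\omega}$,
the tool is `exists_growth_of_pointwise_bounded`. If the growth estimate fails along points $x_n$,
test against the series $\sum_n b_n 2^{-n}e^{-n\omega(x_n)}e^{-\pi|y-x_n|^2}$, which lies in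
$\mathcal S_\omega$ for every bounded sequence $b$. Banach–Steinhaus on $\ell^\infty$ gives a bound
uniform in $\|b\|\le1$, and the unit sequences turn it into a contradiction. Applied to a
$\tau_s$-bounded set this gives $\tau$-boundedness; applied to a single multiplier it gives
membership. -/

/-! ### Growth properties of the weight function -/

namespace NQWeight

theorem mono (ω : NQWeight) {s t : ℝ} (hs : 0 ≤ s) (h : s ≤ t) : ω s ≤ ω t :=
  ω.monotoneOn' hs (hs.trans h) h

theorem nonneg (ω : NQWeight) {t : ℝ} (ht : 0 ≤ t) : 0 ≤ ω t := ω.nonneg' t ht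

/-- Iterates (α) until $2^p$ exceeds $|c|$. It serves to absorb geometric factors into the Young
weights and to pass between the two normalisations of the Fourier transform. -/
theorem exists_dilation_le (ω : NQWeight) (c : ℝ) :
    ∃ K : ℝ, 1 ≤ K ∧ ∀ r, 0 ≤ r → ω (|c| * r) ≤ K * (1 + ω r) := by
  obtain ⟨K, hK, h⟩ := ω.doubling'
  have key : ∀ p : ℕ, ∃ L : ℝ, 1 ≤ L ∧ ∀ r, 0 ≤ r → ω (2 ^ p * r) ≤ L * (1 + ω r) := by
    intro p
    induction p with
    | zero =>
      refine ⟨1, le_rfl, fun r hr => ?_⟩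
      simp
    | succ p ih =>
      obtain ⟨L, hL, ih⟩ := ih
      refine ⟨K * (1 + L), by nlinarith, fun r hr => ?_⟩
      have h1 := h (2 ^ p * r) (by positivity)
      have h2 := ih r hr
      have h3 := ω.nonneg hr
      rw [pow_succ', mul_assoc]
      calc _ ≤ K * (1 + ω (2 ^ p * r)) := h1
        _ ≤ K * (1 + L * (1 + ω r)) := by gcongr
        _ ≤ K * (1 + L) * (1 + ω r) := by nlinarith [mul_nonneg (by linarith : 0 ≤ K) h3]
  obtain ⟨p, hp⟩ := pow_unbounded_of_one_lt |c| (one_lt_two)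
  obtain ⟨L, hL, hp'⟩ := key p
  refine ⟨L, hL, fun r hr => (ω.mono (by positivity) ?_).trans (hp' r hr)⟩
  gcongr

/-- A substitute for subadditivity: $s+t\le 2\max(s,t)$, and then (α). -/
theorem exists_add_le (ω : NQWeight) :
    ∃ K : ℝ, 1 ≤ K ∧ ∀ s t, 0 ≤ s → 0 ≤ t → ω (s + t) ≤ K * (1 + ω s + ω t) := by
  obtain ⟨K, hK, h⟩ := ω.doubling'
  refine ⟨K, hK, fun s t hs ht => ?_⟩
  have hs' := ω.nonneg hs
  have ht' := ω.nonneg ht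
  rcases le_total s t with hst | hst
  · refine (ω.mono (by positivity) (by linarith : s + t ≤ 2 * t)).trans ((h t ht).trans ?_)
    exact mul_le_mul_of_nonneg_left (by linarith) (by linarith)
  · refine (ω.mono (by positivity) (by linarith : s + t ≤ 2 * s)).trans ((h s hs).trans ?_)
    exact mul_le_mul_of_nonneg_left (by linarith) (by linarith)

/-- Condition (β) forces $\omega(t)=o(t)$. The integrals over $[t,2t]$ tend to zero, while by
monotonicity and $1+s^2\le5t^2$ there they are at least $\omega(t)/(5t)$. -/
theorem exists_le_linear (ω : NQWeight) {ε : ℝ} (hε : 0 < ε) :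
    ∃ C : ℝ, 0 ≤ C ∧ ∀ t, 0 ≤ t → ω t ≤ ε * t + C := by
  have hI := intervalIntegral_tendsto_integral_Ioi (1 : ℝ) ω.integrable' Filter.tendsto_id
  have hI2 := hI.comp (Filter.tendsto_id.const_mul_atTop (two_pos : (0:ℝ) < 2))
  have hd := hI2.sub hI
  rw [sub_self] at hd
  have hev := (hd.eventually (gt_mem_nhds (show (0:ℝ) < ε / 5 by positivity))).and
    (Filter.eventually_ge_atTop 1)
  obtain ⟨T, hT⟩ := Filter.eventually_atTop.1 hev
  refine ⟨ω (max T 1), ω.nonneg (by positivity), fun t ht => ?_⟩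
  have hT0 : 0 ≤ max T 1 := by positivity
  rcases le_total t (max T 1) with h | h
  · have := ω.mono ht h
    nlinarith
  · obtain ⟨h1, h2⟩ := hT t ((le_max_left _ _).trans h)
    simp only [Function.comp_apply, id_eq] at h1
    have hint : ∀ s, 1 ≤ s → IntervalIntegrable (fun t => ω t / (1 + t ^ 2)) volume 1 s := by
      intro s hs
      rw [intervalIntegrable_iff_integrableOn_Ioc_of_le hs]
      exact ω.integrable'.mono_set Ioc_subset_Ioi_self
    rw [intervalIntegral.integral_interval_sub_left (hint _ (by linarith)) (hint _ h2)] at h1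
    have hlow : ∫ s in t..(2 * t), ω t / (5 * t ^ 2) ≤ ∫ s in t..(2 * t), ω s / (1 + s ^ 2) := by
      refine intervalIntegral.integral_mono_on (by linarith) (by simp)
        ((hint _ h2).symm.trans (hint _ (by linarith))) fun s hs => ?_
      have hs1 := ω.mono ht hs.1
      have h0 := ω.nonneg ht
      have : 0 < t := by linarith
      apply div_le_div₀ (h0.trans hs1) hs1 (by positivity)
      nlinarith [hs.1, hs.2]
    rw [intervalIntegral.integral_const, smul_eq_mul] at hlow
    have htp : 0 < t := by linarith
    have h3 : (2 * t - t) * (ω t / (5 * t ^ 2)) = ω t / (5 * t) := by field_simp; ring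
    rw [h3] at hlow
    have h4 : ω t / (5 * t) < ε / 5 := hlow.trans_lt h1
    rw [div_lt_div_iff₀ (by positivity) (by norm_num)] at h4
    have := ω.nonneg hT0
    nlinarith

/-- Powers are dominated by exponentials of the weight. -/
theorem exists_pow_le (ω : NQWeight) (p : ℕ) :
    ∃ k : ℕ, ∃ C : ℝ, 0 < C ∧ ∀ t, 0 ≤ t → (1 + t) ^ p ≤ C * Real.exp (k * ω t) := by
  obtain ⟨a, b, hb, h⟩ := ω.log_le'
  obtain ⟨k, hk⟩ := exists_nat_ge (p / b)
  refine ⟨k, Real.exp (-(k * a)), Real.exp_pos _, fun t ht => ?_⟩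
  have h1 := h t ht
  have h2 : 0 ≤ Real.log (1 + t) := Real.log_nonneg (by linarith)
  rw [← Real.exp_add, ← Real.rpow_natCast, Real.rpow_def_of_pos (by linarith)]
  apply Real.exp_le_exp.2
  have h3 : (p : ℝ) ≤ k * b := by rwa [div_le_iff₀ hb] at hk
  have h4 := mul_le_mul_of_nonneg_right h3 h2
  have h5 := mul_le_mul_of_nonneg_left h1 (Nat.cast_nonneg (α := ℝ) k)
  nlinarith

end NQWeight

/-! ### The weights given by the Young conjugate -/

theorem youngWeight_nonneg (ω : NQWeight) (m : ℕ+) (n : ℕ) : 0 ≤ youngWeight ω m n :=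
  ENNReal.toReal_nonneg

theorem youngConj_ne_bot (ω : NQWeight) (s : ℝ) : youngConj ω s ≠ ⊥ := by
  intro h
  have := le_iSup (fun t : Ici (0 : ℝ) => ((s * t - ω (Real.exp t) : ℝ) : EReal)) ⟨0, by simp⟩
  unfold youngConj at h
  rw [h] at this
  exact EReal.coe_ne_bot _ (le_bot_iff.1 this)

/-- Young's inequality at $t=\log r$. With `one_le_mul_youngWeight` it identifies the weight as
$1/\sup_{r\ge1}r^ne^{-m\omega(r)}$, where $1/\infty=0$. Later arguments use only these two halves
and no extended reals. -/
theorem pow_mul_youngWeight_le_one (ω : NQWeight) (m : ℕ+) (n : ℕ) {r : ℝ} (hr : 1 ≤ r) :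
    r ^ n * Real.exp (-(m * ω r)) * youngWeight ω m n ≤ 1 := by
  have hm : (0 : ℝ) < m := by exact_mod_cast m.pos
  have hr0 : 0 < r := by linarith
  have h1 : (((n / m : ℝ) * Real.log r - ω r : ℝ) : EReal) ≤ youngConj ω ((n : ℝ) / (m : ℝ)) := by
    have := le_iSup (fun t : Ici (0 : ℝ) =>
      (((n / m : ℝ) * t - ω (Real.exp t) : ℝ) : EReal)) ⟨Real.log r, Real.log_nonneg hr⟩
    rw [Real.exp_log hr0] at this
    exact this
  have h2 : ((n * Real.log r - m * ω r : ℝ) : EReal) ≤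
      ((m : ℝ) : EReal) * youngConj ω ((n : ℝ) / (m : ℝ)) := by
    refine le_trans (le_of_eq ?_) (mul_le_mul_of_nonneg_left h1 (by exact_mod_cast hm.le))
    rw [← EReal.coe_mul]
    congr 1
    field_simp
  have h3 : youngWeight ω m n ≤ Real.exp (-(n * Real.log r - m * ω r)) := by
    refine ENNReal.toReal_le_of_le_ofReal (Real.exp_nonneg _) ?_
    rw [← EReal.exp_coe]
    apply EReal.exp_monotone
    rw [EReal.coe_neg]
    exact EReal.neg_le_neg_iff.2 h2
  have h4 : r ^ n * Real.exp (-(m * ω r)) = Real.exp (n * Real.log r - m * ω r) := by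
    rw [sub_eq_add_neg, Real.exp_add, mul_comm (n : ℝ), ← Real.rpow_def_of_pos hr0,
      Real.rpow_natCast]
  rw [h4]
  calc _ ≤ Real.exp (n * Real.log r - m * ω r) * Real.exp (-(n * Real.log r - m * ω r)) := by gcongr
    _ = 1 := by rw [← Real.exp_add]; simp

/-- Taking logarithms, the hypothesis is a bound $\log B/m$ for the supremum that defines the
conjugate; in particular the conjugate is then finite. -/
theorem one_le_mul_youngWeight (ω : NQWeight) (m : ℕ+) (n : ℕ) {B : ℝ}
    (hB : ∀ r, 1 ≤ r → r ^ n * Real.exp (-(m * ω r)) ≤ B) : 1 ≤ B * youngWeight ω m n := by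
  have hm : (0 : ℝ) < m := by exact_mod_cast m.pos
  have hB0 : 0 < B := lt_of_lt_of_le (by positivity) (hB 1 le_rfl)
  have h1 : youngConj ω ((n : ℝ) / (m : ℝ)) ≤ ((Real.log B / m : ℝ) : EReal) := by
    refine iSup_le fun t => ?_
    rw [EReal.coe_le_coe_iff, le_div_iff₀ hm]
    have h := hB (Real.exp t) (Real.one_le_exp t.2)
    rw [← Real.exp_nat_mul, ← Real.exp_add, ← Real.le_log_iff_exp_le hB0] at h
    refine le_trans (le_of_eq ?_) h
    field_simp
    ring
  have h2 : ((m : ℝ) : EReal) * youngConj ω ((n : ℝ) / (m : ℝ)) ≤ (Real.log B : ℝ) := by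
    refine le_trans (mul_le_mul_of_nonneg_left h1 (by exact_mod_cast hm.le)) (le_of_eq ?_)
    rw [← EReal.coe_mul]
    congr 1
    field_simp
  have h3 : Real.exp (-Real.log B) ≤ youngWeight ω m n := by
    refine (ENNReal.ofReal_le_iff_le_toReal ?_).1 ?_
    · rw [ne_eq, EReal.exp_eq_top_iff, EReal.neg_eq_top_iff]
      have hb := youngConj_ne_bot ω ((n : ℝ) / (m : ℝ))
      induction hY : youngConj ω ((n : ℝ) / (m : ℝ)) with
      | bot => exact absurd hY hb
      | coe y => rw [← EReal.coe_mul]; exact EReal.coe_ne_bot _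
      | top => rw [EReal.coe_mul_top_of_pos hm]; simp
    · rw [← EReal.exp_coe]
      apply EReal.exp_monotone
      rw [EReal.coe_neg]
      exact EReal.neg_le_neg_iff.2 h2
  rw [Real.exp_neg, Real.exp_log hB0] at h3
  calc (1 : ℝ) = B * B⁻¹ := by field_simp
    _ ≤ _ := by gcongr

theorem youngWeight_pos_of_bound (ω : NQWeight) (m : ℕ+) (n : ℕ) {B : ℝ}
    (hB : ∀ r, 1 ≤ r → r ^ n * Real.exp (-(m * ω r)) ≤ B) : 0 < youngWeight ω m n := by
  have h := one_le_mul_youngWeight ω m n hB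
  rcases (youngWeight_nonneg ω m n).eq_or_lt with h0 | h0
  · rw [← h0] at h; norm_num at h
  · exact h0

/-- For logarithmic weights the conjugate can be infinite and the weight zero, so that weighted
bounds say nothing about order $n$. By (γ) this does not happen once $m$ is large enough for the
given $n$. -/
theorem exists_youngWeight_pos (ω : NQWeight) (n : ℕ) : ∃ m : ℕ+, 0 < youngWeight ω m n := by
  obtain ⟨k, C, hC, h⟩ := ω.exists_pow_le n
  refine ⟨⟨k + 1, by omega⟩, youngWeight_pos_of_bound ω _ n (B := C) fun r hr => ?_⟩
  have h0 := ω.nonneg (by linarith : 0 ≤ r)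
  rw [Real.exp_neg, ← div_eq_mul_inv, div_le_iff₀ (Real.exp_pos _)]
  calc r ^ n ≤ (1 + r) ^ n := by gcongr; linarith
    _ ≤ C * Real.exp (k * ω r) := h r (by linarith)
    _ ≤ _ := by
      gcongr
      simp

theorem youngWeight_zero_pos (ω : NQWeight) (m : ℕ+) : 0 < youngWeight ω m 0 := by
  refine youngWeight_pos_of_bound ω m 0 (B := 1) fun r hr => ?_
  have h0 := ω.nonneg (by linarith : 0 ≤ r)
  simp only [pow_zero, one_mul]
  rw [Real.exp_le_one_iff]
  simp only [Left.neg_nonpos_iff]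
  positivity

/-- The factor $e^{m\omega(1)}$ accounts for $r<1$, which the supremum over $t\ge0$ does not see. -/
theorem pow_mul_youngWeight_le (ω : NQWeight) (m : ℕ+) (n : ℕ) {r : ℝ} (hr : 0 ≤ r) :
    r ^ n * youngWeight ω m n ≤ Real.exp (m * ω 1) * Real.exp (m * ω r) := by
  have key : ∀ r : ℝ, 1 ≤ r → r ^ n * youngWeight ω m n ≤ Real.exp (m * ω r) := by
    intro r hr
    have := pow_mul_youngWeight_le_one ω m n hr
    rw [Real.exp_neg, mul_right_comm, ← div_eq_mul_inv, div_le_one (Real.exp_pos _)] at this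
    exact this
  have h1 : 1 ≤ Real.exp (m * ω r) :=
    Real.one_le_exp (mul_nonneg (by positivity) (ω.nonneg hr))
  have h2 : 1 ≤ Real.exp (m * ω 1) :=
    Real.one_le_exp (mul_nonneg (by positivity) (ω.nonneg zero_le_one))
  have hW := youngWeight_nonneg ω m n
  rcases le_total 1 r with h | h
  · nlinarith [key r h]
  · have h4 := key 1 le_rfl
    rw [one_pow, one_mul] at h4
    calc r ^ n * youngWeight ω m n ≤ 1 * youngWeight ω m n := by gcongr; exact pow_le_one₀ hr h
      _ ≤ Real.exp (m * ω 1) * 1 := by linarith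
      _ ≤ _ := by gcongr

/-- For $r,t\ge1$ the product $r^ie^{-m\omega(r)}\,t^je^{-m\omega(t)}$ is at most the expression of
order $i+j$ at $\max(r,t)$, since the other exponential is at most one. Taking suprema over $r$ and
then over $t$ gives the claim. -/
theorem youngWeight_add_le (ω : NQWeight) (m : ℕ+) (i j : ℕ) :
    youngWeight ω m (i + j) ≤ youngWeight ω m i * youngWeight ω m j := by
  have hi := youngWeight_nonneg ω m i
  have hj := youngWeight_nonneg ω m j
  rcases (youngWeight_nonneg ω m (i + j)).eq_or_lt with h0 | h0
  · rw [← h0]; positivity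
  set w := youngWeight ω m (i + j)
  have hm : (0 : ℝ) ≤ m := by positivity
  have hmix : ∀ r t : ℝ, 1 ≤ r → 1 ≤ t →
      (r ^ i * Real.exp (-(m * ω r))) * (t ^ j * Real.exp (-(m * ω t))) ≤ 1 / w := by
    intro r t hr ht
    have h := pow_mul_youngWeight_le_one ω m (i + j) (le_max_of_le_left hr : 1 ≤ max r t)
    rw [le_div_iff₀ h0]
    refine le_trans ?_ h
    gcongr ?_ * _
    have e1 : Real.exp (-(m * ω r)) * Real.exp (-(m * ω t)) ≤ Real.exp (-(m * ω (max r t))) := by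
      rw [← Real.exp_add]
      apply Real.exp_le_exp.2
      have h1 := mul_nonneg hm (ω.nonneg (by linarith : 0 ≤ r))
      have h2 := mul_nonneg hm (ω.nonneg (by linarith : 0 ≤ t))
      rcases max_choice r t with h | h <;> rw [h] <;> linarith
    calc _ = (r ^ i * t ^ j) * (Real.exp (-(m * ω r)) * Real.exp (-(m * ω t))) := by ring
      _ ≤ (max r t ^ i * max r t ^ j) * Real.exp (-(m * ω (max r t))) := by
        gcongr
        · exact le_max_left _ _
        · exact le_max_right _ _
      _ = _ := by rw [pow_add]
  have h1 : ∀ t, 1 ≤ t → t ^ j * Real.exp (-(m * ω t)) ≤ youngWeight ω m i / w := by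
    intro t ht
    have hp : 0 < t ^ j * Real.exp (-(m * ω t)) := by positivity
    have := one_le_mul_youngWeight ω m i (B := 1 / w / (t ^ j * Real.exp (-(m * ω t))))
      fun r hr => by rw [le_div_iff₀ hp]; exact hmix r t hr ht
    rw [div_mul_eq_mul_div, le_div_iff₀ hp] at this
    calc _ = 1 * (t ^ j * Real.exp (-(m * ω t))) := (one_mul _).symm
      _ ≤ _ := this
      _ = _ := by ring
  have := one_le_mul_youngWeight ω m j h1
  rwa [div_mul_eq_mul_div, le_div_iff₀ h0, one_mul] at this

/-- Replacing $r$ by $br$ in the supremum brings out $b^n$, and $\omega(br)\le K(1+\omega(r))$ pays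
for it with any $m'\ge mK$. This absorbs the factors $2^n$, $N^n$ and $(2\pi)^n$ that come from
Leibniz' rule, partial derivatives and the Fourier transform. -/
theorem exists_pow_mul_youngWeight_le (ω : NQWeight) (c : ℝ) (m : ℕ+) :
    ∃ m' : ℕ+, ∃ D : ℝ, 0 < D ∧ ∀ n, |c| ^ n * youngWeight ω m n ≤ D * youngWeight ω m' n := by
  obtain ⟨K, hK, h⟩ := ω.exists_dilation_le (max |c| 1)
  rw [abs_of_nonneg (by positivity : (0:ℝ) ≤ max |c| 1)] at h
  set b := max |c| 1
  have hb : 1 ≤ b := le_max_right _ _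
  obtain ⟨p, hp⟩ := exists_nat_ge (m * K)
  refine ⟨⟨p + 1, by omega⟩, Real.exp (m * K), Real.exp_pos _, fun n => ?_⟩
  have hW := youngWeight_nonneg ω m n
  rcases hW.eq_or_lt with h0 | h0
  · rw [← h0]
    have := youngWeight_nonneg ω ⟨p + 1, by omega⟩ n
    simp only [mul_zero]
    positivity
  have hm : (0 : ℝ) ≤ m := by positivity
  have key := one_le_mul_youngWeight ω ⟨p + 1, by omega⟩ n
    (B := Real.exp (m * K) / (b ^ n * youngWeight ω m n)) fun r hr => by
      have h1 := pow_mul_youngWeight_le_one ω m n (r := b * r) (by nlinarith)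
      have h2 := h r (by linarith)
      have h3 := ω.nonneg (by linarith : 0 ≤ r)
      rw [le_div_iff₀ (by positivity)]
      have h4 : Real.exp (-(((⟨p + 1, by omega⟩ : ℕ+) : ℕ) * ω r)) ≤
          Real.exp (m * K) * Real.exp (-(m * ω (b * r))) := by
        rw [← Real.exp_add]
        apply Real.exp_le_exp.2
        have h5 := mul_le_mul_of_nonneg_left h2 hm
        have h6 := mul_le_mul_of_nonneg_right hp h3
        simp only [Nat.cast_add, Nat.cast_one]
        nlinarith
      calc _ ≤ r ^ n * (Real.exp (m * K) * Real.exp (-(m * ω (b * r)))) *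
            (b ^ n * youngWeight ω m n) := by gcongr ?_ * _; exact mul_le_mul_of_nonneg_left h4 (by positivity)
        _ = Real.exp (m * K) * ((b * r) ^ n * Real.exp (-(m * ω (b * r))) * youngWeight ω m n) := by
          rw [mul_pow]; ring
        _ ≤ Real.exp (m * K) * 1 := by gcongr
        _ = _ := mul_one _
  rw [div_mul_eq_mul_div, le_div_iff₀ (by positivity), one_mul] at key
  refine le_trans ?_ key
  gcongr
  exact le_max_left _ _

/-- Young's inequality is evaluated at $r=e\sqrt n$. Since $\omega(t)=o(t)$, $m\omega(e\sqrt n)\le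
n+mC$, and the factor $e^n$ in $r^n$ cancels this, leaving $n^{n/2}\ge\sqrt{n!}$. Growth $\sqrt{n!}$
is that of the derivatives of a Gaussian at its centre. -/
theorem exists_sqrt_factorial_mul_youngWeight_le (ω : NQWeight) (m : ℕ+) :
    ∃ C : ℝ, 0 < C ∧ ∀ n : ℕ, √(n.factorial) * youngWeight ω m n ≤ C := by
  obtain ⟨C, hC, h⟩ := ω.exists_le_linear (ε := 1 / (m * Real.exp 1)) (by positivity)
  have hm : (0 : ℝ) < m := by exact_mod_cast m.pos
  refine ⟨max (youngWeight ω m 0) (Real.exp (m * C)), by positivity, fun n => ?_⟩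
  rcases Nat.eq_zero_or_pos n with rfl | hn
  · simp
  refine le_max_of_le_right ?_
  have hn1 : (1 : ℝ) ≤ √n := by rw [Real.one_le_sqrt]; exact_mod_cast hn
  have he : 1 ≤ Real.exp 1 := Real.one_le_exp zero_le_one
  have h1 := pow_mul_youngWeight_le_one ω m n (r := Real.exp 1 * √n) (by nlinarith)
  have h2 := h (Real.exp 1 * √n) (by positivity)
  have h3 : m * ω (Real.exp 1 * √n) ≤ n + m * C := by
    calc m * ω (Real.exp 1 * √n) ≤ m * (1 / (m * Real.exp 1) * (Real.exp 1 * √n) + C) := by gcongr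
      _ = √n + m * C := by field_simp
      _ ≤ n + m * C := by
        gcongr
        nlinarith [Real.mul_self_sqrt (Nat.cast_nonneg (α := ℝ) n)]
  have h4 : √(n.factorial) ≤ √n ^ n := by
    rw [Real.sqrt_le_left (by positivity), ← pow_mul, mul_comm, pow_mul,
      Real.sq_sqrt (Nat.cast_nonneg _)]
    exact_mod_cast Nat.factorial_le_pow n
  have hW := youngWeight_nonneg ω m n
  have h5 : √n ^ n = Real.exp (m * C) *
      ((Real.exp 1 * √n) ^ n * Real.exp (-(n + m * C))) := by
    have e : Real.exp 1 ^ n = Real.exp n := by rw [← Real.exp_nat_mul, mul_one]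
    rw [mul_pow, e, Real.exp_neg, Real.exp_add]
    field_simp
  calc √(n.factorial) * youngWeight ω m n ≤ √n ^ n * youngWeight ω m n := by gcongr
    _ = Real.exp (m * C) *
      ((Real.exp 1 * √n) ^ n * Real.exp (-(n + m * C)) * youngWeight ω m n) := by rw [h5]; ring
    _ ≤ Real.exp (m * C) * ((Real.exp 1 * √n) ^ n * Real.exp (-(m * ω (Real.exp 1 * √n))) *
        youngWeight ω m n) := by gcongr
    _ ≤ Real.exp (m * C) * 1 := by gcongr
    _ = _ := mul_one _

/-- The biconjugate estimate: bounds of all moments give exponential decay. -/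
theorem exists_le_of_pow_mul_youngWeight_le (ω : NQWeight) (m : ℕ+) :
    ∃ C : ℝ, 0 < C ∧ ∀ A v r : ℝ, 0 ≤ v → 0 ≤ r →
      (∀ n, youngWeight ω m n * r ^ n * v ≤ A) → v ≤ C * A * (1 + r) * Real.exp (-(m * ω r)) := by
  have hm : (0 : ℝ) < m := by exact_mod_cast m.pos
  have hW0 := youngWeight_zero_pos ω m
  refine ⟨max (Real.exp (m * ω 1) / youngWeight ω m 0) (Real.exp m), by positivity,
    fun A v r hv hr hA => ?_⟩
  have hA0 : 0 ≤ A := le_trans (by have := youngWeight_nonneg ω m 0; positivity) (hA 0)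
  rcases le_total r 1 with h1 | h1
  · have h2 := hA 0
    rw [pow_zero, mul_one, mul_comm, ← le_div_iff₀ hW0] at h2
    have h3 : 1 ≤ Real.exp (m * ω 1) * Real.exp (-(m * ω r)) := by
      rw [← Real.exp_add]
      apply Real.one_le_exp
      have := mul_le_mul_of_nonneg_left (ω.mono hr h1) hm.le
      linarith
    calc v ≤ A / youngWeight ω m 0 := h2
      _ = A / youngWeight ω m 0 * 1 * 1 := by ring
      _ ≤ A / youngWeight ω m 0 * (1 + r) * (Real.exp (m * ω 1) * Real.exp (-(m * ω r))) := by
        gcongr; linarith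
      _ = Real.exp (m * ω 1) / youngWeight ω m 0 * A * (1 + r) * Real.exp (-(m * ω r)) := by ring
      _ ≤ _ := by gcongr; exact le_max_left _ _
  · have hr0 : 0 < r := by linarith
    have hcont : Continuous fun t => ω (Real.exp t) := by
      refine ω.continuousOn'.comp_continuous Real.continuous_exp fun t => (Real.exp_pos t).le
    -- By (δ) there is an affine minorant of $\varphi_\omega$ with the value $\varphi_\omega(\log
    -- r)-1$ at $\log r$. The lost $1$ is the source of the factor $e^m$.
    obtain ⟨s, c, hsc, hsu⟩ := ω.convex'.exists_affine_le_of_lt_real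
      (mem_univ (Real.log r)) (a := ω (Real.exp (Real.log r)) - 1) (by simp) isClosed_univ
      (hcont.lowerSemicontinuous.lowerSemicontinuousOn _)
    rw [Real.exp_log hr0] at hsu
    -- With a negative slope the minorant would exceed $\omega(1)$ far to the left, where
    -- $\varphi_\omega\le\omega(1)$ by monotonicity.
    have hs : 0 ≤ s := by
      by_contra! hs
      have h2 := hsc (min 0 ((ω 1 + 1 - c) / s)) (mem_univ _)
      have h3 : ω (Real.exp (min 0 ((ω 1 + 1 - c) / s))) ≤ ω 1 :=
        ω.mono (Real.exp_pos _).le (by rw [Real.exp_le_one_iff]; exact min_le_left _ _)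
      have h4 : s * ((ω 1 + 1 - c) / s) ≤ s * min 0 ((ω 1 + 1 - c) / s) :=
        mul_le_mul_of_nonpos_left (min_le_right _ _) hs.le
      rw [mul_div_cancel₀ _ hs.ne] at h4
      linarith
    -- The optimal exponent is $ms$, but only integer moments are available. Rounding down costs at
    -- most one power of $r$, whence the factor $1+r$.
    set j := ⌊m * s⌋₊
    have hj1 : (j : ℝ) ≤ m * s := Nat.floor_le (by positivity)
    have hj2 : m * s ≤ j + 1 := (Nat.lt_floor_add_one _).le
    have hlr : 0 ≤ Real.log r := Real.log_nonneg h1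
    have hB := one_le_mul_youngWeight ω m j (B := Real.exp m * r ^ (j + 1) * Real.exp (-(m * ω r)))
      fun t ht => by
        have ht0 : 0 < t := by linarith
        have hlt : 0 ≤ Real.log t := Real.log_nonneg ht
        have h2 := hsc (Real.log t) (mem_univ _)
        rw [Real.exp_log ht0] at h2
        rw [← Real.exp_log ht0, ← Real.exp_log hr0, ← Real.exp_nat_mul, ← Real.exp_nat_mul,
          ← Real.exp_add, ← Real.exp_add, ← Real.exp_add, Real.exp_log ht0, Real.exp_log hr0]
        apply Real.exp_le_exp.2
        have h3 := mul_le_mul_of_nonneg_right hj1 hlt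
        have h4 := mul_le_mul_of_nonneg_right hj2 hlr
        have h5 := mul_le_mul_of_nonneg_left h2 hm.le
        have h6 : (m : ℝ) * (s * Real.log r + c) = m * (ω r - 1) := by rw [hsu]
        push_cast
        nlinarith
    have h2 := hA j
    calc v = v * 1 := (mul_one v).symm
      _ ≤ v * (Real.exp m * r ^ (j + 1) * Real.exp (-(m * ω r)) * youngWeight ω m j) := by gcongr
      _ = Real.exp m * (youngWeight ω m j * r ^ j * v) * r * Real.exp (-(m * ω r)) := by ring
      _ ≤ Real.exp m * A * (1 + r) * Real.exp (-(m * ω r)) := by gcongr; linarith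
      _ ≤ _ := by gcongr; exact le_max_right _ _

/-! ### Weighted estimates of products -/

section Leibniz

variable {V : Type*} [NormedAddCommGroup V] [NormedSpace ℝ V]

/-- Submultiplicativity distributes the weight of order $n$ over the orders $i$ and $n-i$ in
Leibniz' rule. The binomial coefficients add up to $2^n$, which the passage from $m$ to $m'$
absorbs. The estimate is pointwise in $x$. -/
theorem exists_youngWeight_mul_iteratedFDeriv_mul_le (ω : NQWeight) (m : ℕ+) :
    ∃ m' : ℕ+, ∃ D : ℝ, 0 < D ∧ ∀ (f g : V → ℂ) (x : V) (A B : ℝ),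
      ContDiff ℝ (⊤ : ℕ∞) f → ContDiff ℝ (⊤ : ℕ∞) g →
      (∀ n, youngWeight ω m' n * ‖iteratedFDeriv ℝ n f x‖ ≤ A) →
      (∀ n, youngWeight ω m' n * ‖iteratedFDeriv ℝ n g x‖ ≤ B) →
      ∀ n, youngWeight ω m n * ‖iteratedFDeriv ℝ n (f * g) x‖ ≤ D * (A * B) := by
  obtain ⟨m', D, hD, h⟩ := exists_pow_mul_youngWeight_le ω 2 m
  refine ⟨m', D, hD, fun f g x A B hf hg hA hB n => ?_⟩
  have hW := youngWeight_nonneg ω m'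
  have hWm := youngWeight_nonneg ω m n
  have hA0 : 0 ≤ A := (mul_nonneg (hW 0) (norm_nonneg _)).trans (hA 0)
  have hL := norm_iteratedFDeriv_mul_le hf hg x (n := n) (by exact_mod_cast le_top)
  have hn := h n
  rw [abs_two] at hn
  have hterm : ∀ i ∈ Finset.range (n + 1), youngWeight ω m' n * ((n.choose i : ℝ) *
      ‖iteratedFDeriv ℝ i f x‖ * ‖iteratedFDeriv ℝ (n - i) g x‖) ≤ (n.choose i : ℝ) * (A * B) := by
    intro i hi
    have hi' : i + (n - i) = n := by have := Finset.mem_range.1 hi; omega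
    have hadd := youngWeight_add_le ω m' i (n - i)
    rw [hi'] at hadd
    calc _ ≤ (youngWeight ω m' i * youngWeight ω m' (n - i)) * ((n.choose i : ℝ) *
          ‖iteratedFDeriv ℝ i f x‖ * ‖iteratedFDeriv ℝ (n - i) g x‖) := by gcongr
      _ = (n.choose i : ℝ) * ((youngWeight ω m' i * ‖iteratedFDeriv ℝ i f x‖) *
          (youngWeight ω m' (n - i) * ‖iteratedFDeriv ℝ (n - i) g x‖)) := by ring
      _ ≤ _ := by
        gcongr ?_ * ?_
        exact mul_le_mul (hA i) (hB _) (mul_nonneg (hW _) (norm_nonneg _)) hA0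
  have hsum : youngWeight ω m' n * ‖iteratedFDeriv ℝ n (f * g) x‖ ≤ 2 ^ n * (A * B) := by
    calc _ ≤ youngWeight ω m' n * ∑ i ∈ Finset.range (n + 1), (n.choose i : ℝ) *
          ‖iteratedFDeriv ℝ i f x‖ * ‖iteratedFDeriv ℝ (n - i) g x‖ :=
          mul_le_mul_of_nonneg_left hL (hW n)
      _ ≤ ∑ i ∈ Finset.range (n + 1), (n.choose i : ℝ) * (A * B) := by
        rw [Finset.mul_sum]
        exact Finset.sum_le_sum hterm
      _ = _ := by
        rw [← Finset.sum_mul]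
        congr 1
        exact_mod_cast Nat.sum_range_choose n
  have h2 : (0 : ℝ) < 2 ^ n := by positivity
  refine le_of_mul_le_mul_left ?_ h2
  calc 2 ^ n * (youngWeight ω m n * ‖iteratedFDeriv ℝ n (f * g) x‖)
      = (2 ^ n * youngWeight ω m n) * ‖iteratedFDeriv ℝ n (f * g) x‖ := by ring
    _ ≤ (D * youngWeight ω m' n) * ‖iteratedFDeriv ℝ n (f * g) x‖ := by gcongr
    _ = D * (youngWeight ω m' n * ‖iteratedFDeriv ℝ n (f * g) x‖) := by ring
    _ ≤ D * (2 ^ n * (A * B)) := by gcongr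
    _ = _ := by ring

end Leibniz

/-! ### Gaussians and their derivatives at the centre -/

section Gauss

variable {V : Type*} [NormedAddCommGroup V]

/-- The function `exp (c |y|²)`. -/
noncomputable def expSq (c : ℝ) (y : V) : ℂ := Complex.exp ((c * ‖y‖ ^ 2 : ℝ) : ℂ)

theorem norm_expSq (c : ℝ) (y : V) : ‖expSq c y‖ = Real.exp (c * ‖y‖ ^ 2) := by
  rw [expSq, Complex.norm_exp, Complex.ofReal_re]

theorem expSq_mul_expSq_neg (c : ℝ) (y : V) : expSq c y * expSq (-c) y = 1 := by
  rw [expSq, expSq, ← Complex.exp_add]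
  simp

variable [InnerProductSpace ℝ V]

theorem contDiff_expSq (c : ℝ) {n : WithTop ℕ∞} : ContDiff ℝ n (expSq c : V → ℂ) :=
  (Complex.ofRealCLM.contDiff.comp (contDiff_const.mul (contDiff_norm_sq ℝ))).cexp

/-- The linear map `y ↦ 2 c ⟪y, ·⟫`. -/
noncomputable def expSqDeriv (c : ℝ) : V →L[ℝ] V →L[ℝ] ℂ :=
  (ContinuousLinearMap.compL ℝ V ℝ ℂ ((2 * c) • Complex.ofRealCLM)).comp (innerSL ℝ)

theorem fderiv_expSq (c : ℝ) :
    fderiv ℝ (expSq c : V → ℂ) = fun y => expSq c y • expSqDeriv c y := by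
  funext y
  have h1 : HasFDerivAt (fun y : V => c * ‖y‖ ^ 2) (c • (2 • innerSL ℝ y)) y :=
    ((hasStrictFDerivAt_norm_sq y).hasFDerivAt).const_mul c
  have h2 := (Complex.ofRealCLM.hasFDerivAt.comp y h1).cexp
  rw [show (expSq c : V → ℂ) = fun y => Complex.exp ((Complex.ofRealCLM ∘ fun y => c * ‖y‖ ^ 2) y)
    from rfl, h2.fderiv]
  ext v
  simp [expSqDeriv]
  ring

theorem norm_expSqDeriv_le (c : ℝ) : ‖(expSqDeriv c : V →L[ℝ] V →L[ℝ] ℂ)‖ ≤ 2 * |c| := by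
  refine ContinuousLinearMap.opNorm_le_bound _ (by positivity) fun y => ?_
  refine ContinuousLinearMap.opNorm_le_bound _ (by positivity) fun v => ?_
  have := abs_real_inner_le_norm y v
  calc ‖expSqDeriv c y v‖ = 2 * |c| * |inner ℝ y v| := by simp [expSqDeriv]
    _ ≤ 2 * |c| * (‖y‖ * ‖v‖) := by gcongr
    _ = _ := by ring

/-- The derivative of the Gaussian is the Gaussian times a linear map. At the origin the linear map
vanishes and its derivatives of order at least two vanish everywhere, so one term of Leibniz' rule
remains: order $n+2$ is at most $2|c|(n+1)$ times order $n$. This recursion yields $\sqrt{n!}$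
because $(n+1)^2n!\le(n+2)!$. -/
theorem norm_iteratedFDeriv_expSq_zero_le (c : ℝ) (n : ℕ) :
    ‖iteratedFDeriv ℝ n (expSq c : V → ℂ) 0‖ ≤ (1 + 2 * |c|) ^ n * √(n.factorial) := by
  induction n using Nat.strong_induction_on with
  | _ n ih =>
  rcases n with _ | n
  · simp [expSq]
  rw [← norm_iteratedFDeriv_fderiv, fderiv_expSq]
  have hL := norm_iteratedFDeriv_smul_le (contDiff_expSq c (V := V) (n := ⊤))
    (expSqDeriv c : V →L[ℝ] V →L[ℝ] ℂ).contDiff (0 : V) (n := n) (by simp)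
  refine hL.trans ?_
  rcases n with _ | n
  · simp
    positivity
  rw [Finset.sum_range_succ, Finset.sum_range_succ]
  have hz : ∑ i ∈ Finset.range n, ((n + 1).choose i : ℝ) *
      ‖iteratedFDeriv ℝ i (expSq c : V → ℂ) 0‖ *
        ‖iteratedFDeriv ℝ (n + 1 - i) (⇑(expSqDeriv c : V →L[ℝ] V →L[ℝ] ℂ)) 0‖ = 0 := by
    refine Finset.sum_eq_zero fun i hi => ?_
    obtain ⟨k, hk⟩ : ∃ k, n + 1 - i = k + 2 := ⟨n - 1 - i, by have := Finset.mem_range.1 hi; omega⟩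
    rw [hk, ← norm_iteratedFDeriv_fderiv]
    have : fderiv ℝ (⇑(expSqDeriv c : V →L[ℝ] V →L[ℝ] ℂ)) = fun _ => expSqDeriv c := by
      funext y; exact ContinuousLinearMap.fderiv _
    rw [this, iteratedFDeriv_const_of_ne (by omega)]
    simp
  have h1 : ‖iteratedFDeriv ℝ 1 (⇑(expSqDeriv c : V →L[ℝ] V →L[ℝ] ℂ)) 0‖ ≤ 2 * |c| := by
    rw [norm_iteratedFDeriv_one, ContinuousLinearMap.fderiv]
    exact norm_expSqDeriv_le c
  have h0 : ‖iteratedFDeriv ℝ 0 (⇑(expSqDeriv c : V →L[ℝ] V →L[ℝ] ℂ)) 0‖ = 0 := by simp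
  rw [hz, Nat.sub_self, h0, Nat.add_sub_cancel_left, mul_zero, add_zero, zero_add,
    Nat.choose_succ_self_right]
  have hi := ih n (by omega)
  have hb : 2 * |c| ≤ 1 + 2 * |c| := by linarith
  have hb1 : 1 ≤ 1 + 2 * |c| := by linarith [abs_nonneg c]
  have hsq : ((n + 1 : ℕ) : ℝ) * √(n.factorial) ≤ √((n + 2).factorial) := by
    apply Real.le_sqrt_of_sq_le
    rw [mul_pow, Real.sq_sqrt (Nat.cast_nonneg _)]
    have : (n + 1) ^ 2 * n.factorial ≤ (n + 2).factorial := by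
      rw [Nat.factorial_succ, Nat.factorial_succ]
      nlinarith [Nat.factorial_pos n]
    exact_mod_cast this
  calc _ ≤ ((n + 1 : ℕ) : ℝ) * ((1 + 2 * |c|) ^ n * √(n.factorial)) * (1 + 2 * |c|) := by
        gcongr
        exact h1.trans hb
    _ = (((n + 1 : ℕ) : ℝ) * √(n.factorial)) * (1 + 2 * |c|) ^ (n + 1) := by ring
    _ ≤ √((n + 2).factorial) * (1 + 2 * |c|) ^ (n + 2) := by
        gcongr
        · norm_num
    _ = _ := by ring

theorem exists_youngWeight_mul_iteratedFDeriv_expSq_le (ω : NQWeight) (c : ℝ) (m : ℕ+) :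
    ∃ C : ℝ, 0 < C ∧ ∀ n, youngWeight ω m n * ‖iteratedFDeriv ℝ n (expSq c : V → ℂ) 0‖ ≤ C := by
  obtain ⟨m', D, hD, h⟩ := exists_pow_mul_youngWeight_le ω (1 + 2 * |c|) m
  obtain ⟨C, hC, h'⟩ := exists_sqrt_factorial_mul_youngWeight_le ω m'
  refine ⟨D * C, by positivity, fun n => ?_⟩
  have hW := youngWeight_nonneg ω m n
  have h1 := h n
  rw [abs_of_nonneg (by positivity)] at h1
  calc _ ≤ youngWeight ω m n * ((1 + 2 * |c|) ^ n * √(n.factorial)) := by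
        gcongr; exact norm_iteratedFDeriv_expSq_zero_le c n
    _ = ((1 + 2 * |c|) ^ n * youngWeight ω m n) * √(n.factorial) := by ring
    _ ≤ (D * youngWeight ω m' n) * √(n.factorial) := by gcongr
    _ = D * (√(n.factorial) * youngWeight ω m' n) := by ring
    _ ≤ _ := by gcongr; exact h' n

/-- Derivatives at a point are controlled after multiplication by a Gaussian centred there. -/
theorem exists_iteratedFDeriv_le_of_mul_expSq (ω : NQWeight) (c : ℝ) (m : ℕ+) :
    ∃ m' : ℕ+, ∃ D : ℝ, 0 < D ∧ ∀ (f : V → ℂ) (x : V) (A : ℝ), ContDiff ℝ (⊤ : ℕ∞) f →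
      (∀ n, youngWeight ω m' n *
        ‖iteratedFDeriv ℝ n (fun y => f y * expSq c (y - x)) x‖ ≤ A) →
      ∀ n, youngWeight ω m n * ‖iteratedFDeriv ℝ n f x‖ ≤ D * A := by
  obtain ⟨m', D, hD, h⟩ := exists_youngWeight_mul_iteratedFDeriv_mul_le (V := V) ω m
  -- The Gaussian is undone by its reciprocal, which matters only through its derivatives at the
  -- centre; these do not depend on $x$.
  obtain ⟨C, hC, h'⟩ := exists_youngWeight_mul_iteratedFDeriv_expSq_le (V := V) ω (-c) m'
  refine ⟨m', D * C, by positivity, fun f x A hf hA n => ?_⟩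
  have hs : ∀ c : ℝ, ContDiff ℝ (⊤ : ℕ∞) fun y => expSq c (y - x) := fun c =>
    (contDiff_expSq c).comp (contDiff_id.sub contDiff_const)
  have key := h (fun y => f y * expSq c (y - x)) (fun y => expSq (-c) (y - x)) x A C
    (hf.mul (hs c)) (hs _) hA (fun n => by rw [iteratedFDeriv_comp_sub, sub_self]; exact h' n) n
  have he : (fun y => f y * expSq c (y - x)) * (fun y => expSq (-c) (y - x)) = f := by
    funext y
    simp only [Pi.mul_apply, mul_assoc, expSq_mul_expSq_neg, mul_one]
  rw [he] at key
  linarith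

end Gauss

/-! ### Partial derivatives versus total derivatives -/

section MultiD

variable {N : ℕ}

theorem norm_iteratedFDeriv_partialD_le (i : Fin N) {f : EuclideanSpace ℝ (Fin N) → ℂ}
    (hf : ContDiff ℝ (⊤ : ℕ∞) f) (k : ℕ) (x : EuclideanSpace ℝ (Fin N)) :
    ‖iteratedFDeriv ℝ k (partialD i f) x‖ ≤ ‖iteratedFDeriv ℝ (k + 1) f x‖ := by
  have h1 : ContDiff ℝ (⊤ : ℕ∞) (fderiv ℝ f) :=
    hf.fderiv_right (m := ((⊤ : ℕ∞) : WithTop ℕ∞)) (by simp)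
  have h := norm_iteratedFDeriv_clm_apply_const (c := EuclideanSpace.single i (1 : ℝ)) (n := k)
    (x := x) h1.contDiffAt (by exact_mod_cast le_top)
  rw [norm_iteratedFDeriv_fderiv] at h
  simpa using! h

theorem norm_iteratedFDeriv_partialD_iterate_le (i : Fin N) (j : ℕ)
    {f : EuclideanSpace ℝ (Fin N) → ℂ} (hf : ContDiff ℝ (⊤ : ℕ∞) f) (k : ℕ)
    (x : EuclideanSpace ℝ (Fin N)) :
    ‖iteratedFDeriv ℝ k ((partialD i)^[j] f) x‖ ≤ ‖iteratedFDeriv ℝ (k + j) f x‖ := by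
  induction j generalizing k with
  | zero => rfl
  | succ j ih =>
    rw [Function.iterate_succ_apply']
    refine (norm_iteratedFDeriv_partialD_le i (contDiff_partialD_iterate i j hf) k x).trans ?_
    refine (ih (k + 1)).trans (le_of_eq ?_)
    rw [show k + 1 + j = k + (j + 1) by ring]

theorem contDiff_foldr_partialD (α : Fin N → ℕ) (l : List (Fin N))
    {f : EuclideanSpace ℝ (Fin N) → ℂ} (hf : ContDiff ℝ (⊤ : ℕ∞) f) :
    ContDiff ℝ (⊤ : ℕ∞) (l.foldr (fun i h => (partialD i)^[α i] h) f) := by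
  induction l with
  | nil => exact hf
  | cons i l ih => exact contDiff_partialD_iterate i _ ih

theorem norm_multiD_le (α : Fin N → ℕ) {f : EuclideanSpace ℝ (Fin N) → ℂ}
    (hf : ContDiff ℝ (⊤ : ℕ∞) f) (x : EuclideanSpace ℝ (Fin N)) :
    ‖multiD α f x‖ ≤ ‖iteratedFDeriv ℝ (∑ i, α i) f x‖ := by
  have key : ∀ (l : List (Fin N)) (k : ℕ),
      ‖iteratedFDeriv ℝ k (l.foldr (fun i h => (partialD i)^[α i] h) f) x‖ ≤
        ‖iteratedFDeriv ℝ (k + (l.map α).sum) f x‖ := by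
    intro l
    induction l with
    | nil => intro k; rfl
    | cons i l ih =>
      intro k
      refine (norm_iteratedFDeriv_partialD_iterate_le i (α i)
        (contDiff_foldr_partialD α l hf) k x).trans ((ih _).trans (le_of_eq ?_))
      rw [List.map_cons, List.sum_cons, add_assoc]
  have h := key (List.finRange N) 0
  rw [norm_iteratedFDeriv_zero, zero_add] at h
  rw [Fin.sum_univ_def]
  exact h

theorem partialD_comm (i j : Fin N) {f : EuclideanSpace ℝ (Fin N) → ℂ}
    (hf : ContDiff ℝ (⊤ : ℕ∞) f) : partialD i (partialD j f) = partialD j (partialD i f) := by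
  funext x
  have h1 : ContDiff ℝ (⊤ : ℕ∞) (fderiv ℝ f) :=
    hf.fderiv_right (m := ((⊤ : ℕ∞) : WithTop ℕ∞)) (by simp)
  have h2 : DifferentiableAt ℝ (fderiv ℝ f) x := h1.differentiable (by simp) x
  have h3 : IsSymmSndFDerivAt ℝ f x :=
    hf.contDiffAt.isSymmSndFDerivAt (by
      rw [minSmoothness_of_isRCLikeNormedField]; exact WithTop.coe_le_coe.2 (le_top : (2 : ℕ∞) ≤ ⊤))
  have h4 : ∀ i j : Fin N, partialD i (partialD j f) x =
      fderiv ℝ (fderiv ℝ f) x (EuclideanSpace.single i 1) (EuclideanSpace.single j 1) := by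
    intro i j
    unfold partialD
    rw [fderiv_clm_apply h2 (differentiableAt_const _)]
    simp
  rw [h4, h4]
  exact h3.eq _ _

theorem partialD_iterate_comm (i j : Fin N) (k : ℕ) {f : EuclideanSpace ℝ (Fin N) → ℂ}
    (hf : ContDiff ℝ (⊤ : ℕ∞) f) :
    partialD i ((partialD j)^[k] f) = (partialD j)^[k] (partialD i f) := by
  induction k with
  | zero => rfl
  | succ k ih =>
    rw [Function.iterate_succ_apply', Function.iterate_succ_apply',
      partialD_comm i j (contDiff_partialD_iterate j k hf), ih]

/-- By symmetry of second derivatives the new derivative moves through the ordered product to its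
own slot. This sorts arbitrary words of partial derivatives into multi-indices. -/
theorem partialD_multiD (i : Fin N) (α : Fin N → ℕ) {f : EuclideanSpace ℝ (Fin N) → ℂ}
    (hf : ContDiff ℝ (⊤ : ℕ∞) f) :
    partialD i (multiD α f) = multiD (α + Pi.single i 1) f := by
  have hout : ∀ l : List (Fin N), i ∉ l →
      l.foldr (fun j h => (partialD j)^[(α + Pi.single i 1 : Fin N → ℕ) j] h) f =
        l.foldr (fun j h => (partialD j)^[α j] h) f := by
    intro l
    induction l with
    | nil => intro _; rfl
    | cons j l ih =>
      intro hij
      rw [List.mem_cons, not_or] at hij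
      rw [List.foldr_cons, List.foldr_cons, ih hij.2]
      simp [Ne.symm hij.1]
  have hin : ∀ l : List (Fin N), l.Nodup → i ∈ l →
      partialD i (l.foldr (fun j h => (partialD j)^[α j] h) f) =
        l.foldr (fun j h => (partialD j)^[(α + Pi.single i 1 : Fin N → ℕ) j] h) f := by
    intro l
    induction l with
    | nil => intro _ h; simp at h
    | cons j l ih =>
      intro hnd hij
      rw [List.nodup_cons] at hnd
      rw [List.foldr_cons, List.foldr_cons]
      by_cases h : i = j
      · subst h
        rw [hout l hnd.1, ← Function.iterate_succ_apply' (partialD i)]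
        simp
      · rw [partialD_iterate_comm i j _ (contDiff_foldr_partialD α l hf),
          ih hnd.2 ((List.mem_cons.1 hij).resolve_left h)]
        simp [Pi.single_apply, Ne.symm h]
  exact hin _ (List.nodup_finRange N) (List.mem_finRange i)

theorem exists_foldr_partialD_eq_multiD (l : List (Fin N)) {f : EuclideanSpace ℝ (Fin N) → ℂ}
    (hf : ContDiff ℝ (⊤ : ℕ∞) f) :
    ∃ α : Fin N → ℕ, ∑ i, α i = l.length ∧ l.foldr partialD f = multiD α f := by
  induction l with
  | nil => exact ⟨0, by simp, (multiD_zero_index f).symm⟩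
  | cons i l ih =>
    obtain ⟨α, hα, h⟩ := ih
    refine ⟨α + Pi.single i 1, ?_, ?_⟩
    · simp [Finset.sum_add_distrib, hα]
    · rw [List.foldr_cons, h, partialD_multiD i α hf]

theorem fderiv_eq_sum_partialD (f : EuclideanSpace ℝ (Fin N) → ℂ) :
    fderiv ℝ f = fun x => ∑ i, (ContinuousLinearMap.smulRightL ℝ (EuclideanSpace ℝ (Fin N)) ℂ
      (EuclideanSpace.proj i)) (partialD i f x) := by
  funext x
  ext v
  have hv : v = ∑ i, v i • EuclideanSpace.single i (1 : ℝ) := by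
    simpa using! ((EuclideanSpace.basisFun (Fin N) ℝ).sum_repr v).symm
  conv_lhs => rw [hv, map_sum]
  simp [partialD]

/-- The total derivative is $\sum_i\partial_if\cdot dx_i$, and multiplication by the functional
$dx_i$ has norm at most one. -/
theorem norm_iteratedFDeriv_succ_le_sum {f : EuclideanSpace ℝ (Fin N) → ℂ}
    (hf : ContDiff ℝ (⊤ : ℕ∞) f) (n : ℕ) (x : EuclideanSpace ℝ (Fin N)) :
    ‖iteratedFDeriv ℝ (n + 1) f x‖ ≤ ∑ i, ‖iteratedFDeriv ℝ n (partialD i f) x‖ := by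
  have hc : ∀ i : Fin N, ContDiff ℝ n (partialD i f) := fun i =>
    (contDiff_partialD i hf).of_le (by exact_mod_cast le_top)
  have hs := iteratedFDeriv_fun_sum_apply (𝕜 := ℝ) (u := Finset.univ) (n := n) (x := x)
    (f := fun (i : Fin N) x => (ContinuousLinearMap.smulRightL ℝ (EuclideanSpace ℝ (Fin N)) ℂ
      (EuclideanSpace.proj i)) (partialD i f x))
    (fun i _ => ((ContinuousLinearMap.contDiff _).comp (hc i)).contDiffAt)
  rw [← norm_iteratedFDeriv_fderiv, fderiv_eq_sum_partialD, hs]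
  refine (norm_sum_le _ _).trans (Finset.sum_le_sum fun i _ => ?_)
  refine (ContinuousLinearMap.norm_iteratedFDeriv_comp_left _ (hc i).contDiffAt le_rfl).trans ?_
  refine mul_le_of_le_one_left (norm_nonneg _) ?_
  refine ContinuousLinearMap.opNorm_le_bound _ zero_le_one fun c => ?_
  refine ContinuousLinearMap.opNorm_le_bound _ (by positivity) fun v => ?_
  have h := PiLp.norm_apply_le v i
  calc _ = ‖v i‖ * ‖c‖ := by simp
    _ ≤ ‖v‖ * ‖c‖ := by gcongr
    _ = _ := by ring

theorem norm_iteratedFDeriv_le_of_multiD {f : EuclideanSpace ℝ (Fin N) → ℂ}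
    (hf : ContDiff ℝ (⊤ : ℕ∞) f) (n : ℕ) (x : EuclideanSpace ℝ (Fin N)) {A : ℝ}
    (hA : ∀ α : Fin N → ℕ, ∑ i, α i = n → ‖multiD α f x‖ ≤ A) :
    ‖iteratedFDeriv ℝ n f x‖ ≤ N ^ n * A := by
  have key : ∀ (n : ℕ) (f : EuclideanSpace ℝ (Fin N) → ℂ), ContDiff ℝ (⊤ : ℕ∞) f →
      (∀ l : List (Fin N), l.length = n → ‖l.foldr partialD f x‖ ≤ A) →
      ‖iteratedFDeriv ℝ n f x‖ ≤ N ^ n * A := by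
    intro n
    induction n with
    | zero =>
      intro f hf h
      simpa using h [] rfl
    | succ n ih =>
      intro f hf h
      refine (norm_iteratedFDeriv_succ_le_sum hf n x).trans ?_
      calc _ ≤ ∑ _i : Fin N, (N : ℝ) ^ n * A := by
            refine Finset.sum_le_sum fun i _ => ih _ (contDiff_partialD i hf) fun l hl => ?_
            -- The new letter goes to the end of the word, because `foldr` applies the last letter
            -- first.
            have := h (l ++ [i]) (by simp [hl])
            simpa using this
        _ = _ := by simp; ring
  refine key n f hf fun l hl => ?_
  obtain ⟨α, h1, h2⟩ := exists_foldr_partialD_eq_multiD l hf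
  rw [h2]
  exact hA α (h1.trans hl)

/-- Bounds of the partial derivatives with the weights give bounds of the total derivatives. -/
theorem exists_youngWeight_mul_iteratedFDeriv_le_of_multiD (ω : NQWeight) (N : ℕ) (m : ℕ+) :
    ∃ m' : ℕ+, ∃ D : ℝ, 0 < D ∧ ∀ (f : EuclideanSpace ℝ (Fin N) → ℂ)
      (x : EuclideanSpace ℝ (Fin N)) (A : ℝ), ContDiff ℝ (⊤ : ℕ∞) f →
      (∀ α : Fin N → ℕ, youngWeight ω m' (∑ i, α i) * ‖multiD α f x‖ ≤ A) →
      ∀ n, youngWeight ω m n * ‖iteratedFDeriv ℝ n f x‖ ≤ D * A := by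
  obtain ⟨m', D, hD, h⟩ := exists_pow_mul_youngWeight_le ω N m
  refine ⟨m', D, hD, fun f x A hf hA n => ?_⟩
  have hW' := youngWeight_nonneg ω m' n
  have hW := youngWeight_nonneg ω m n
  have hA0 : 0 ≤ A := (mul_nonneg (youngWeight_nonneg _ _ _) (norm_nonneg _)).trans (hA 0)
  have hn := h n
  rw [abs_of_nonneg (Nat.cast_nonneg N)] at hn
  -- If the weight for $m'$ vanishes at order $n$, the hypothesis is void there. But then $N^n$
  -- times the weight for $m$ vanishes as well, so any finite bound $S$ of the partial derivatives
  -- at $x$ will do.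
  rcases hW'.eq_or_lt with h0 | h0
  · have hb := norm_iteratedFDeriv_le_of_multiD hf n x
      (A := ∑ α ∈ Finset.piAntidiag Finset.univ n, ‖multiD α f x‖) fun α hα =>
        Finset.single_le_sum (f := fun α => ‖multiD α f x‖) (fun _ _ => norm_nonneg _)
          (by simp [hα])
    set S := ∑ α ∈ Finset.piAntidiag Finset.univ n, ‖multiD α f x‖
    have hS : 0 ≤ S := Finset.sum_nonneg fun _ _ => norm_nonneg _
    rw [← h0, mul_zero] at hn
    calc _ ≤ youngWeight ω m n * (N ^ n * S) := by gcongr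
      _ = (N ^ n * youngWeight ω m n) * S := by ring
      _ ≤ 0 * S := by gcongr
      _ ≤ D * A := by rw [zero_mul]; positivity
  · have hb := norm_iteratedFDeriv_le_of_multiD hf n x (A := A / youngWeight ω m' n) fun α hα => by
      rw [le_div_iff₀ h0, mul_comm, ← hα]
      exact hA α
    calc _ ≤ youngWeight ω m n * (N ^ n * (A / youngWeight ω m' n)) := by gcongr
      _ = (N ^ n * youngWeight ω m n) * (A / youngWeight ω m' n) := by ring
      _ ≤ (D * youngWeight ω m' n) * (A / youngWeight ω m' n) := by gcongr
      _ = D * A := by field_simp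

end MultiD

/-! ### Rapid decay, Gaussian averages and Fourier transforms -/

section Decay

open scoped FourierTransform

variable {N : ℕ}

/-- Decay faster than all exponentials `exp (-k ω)`. -/
def Decays (ω : NQWeight) {N : ℕ} (u : EuclideanSpace ℝ (Fin N) → ℂ) : Prop :=
  ∀ k : ℕ, ∃ A : ℝ, ∀ x, ‖u x‖ ≤ A * Real.exp (-(k * ω ‖x‖))

theorem NQWeight.continuous_norm (ω : NQWeight) :
    Continuous fun x : EuclideanSpace ℝ (Fin N) => ω ‖x‖ :=
  ω.continuousOn'.comp_continuous _root_.continuous_norm fun x => norm_nonneg x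

theorem nonneg_of_norm_le_mul_exp {ω : NQWeight} {k : ℕ} {A : ℝ}
    {u : EuclideanSpace ℝ (Fin N) → ℂ}
    (h : ∀ x, ‖u x‖ ≤ A * Real.exp (-(k * ω ‖x‖))) : 0 ≤ A :=
  nonneg_of_mul_nonneg_left ((norm_nonneg _).trans (h 0)) (Real.exp_pos _)

theorem exp_neg_mul_anti (ω : NQWeight) {k l : ℕ} (h : k ≤ l) (x : EuclideanSpace ℝ (Fin N)) :
    Real.exp (-(l * ω ‖x‖)) ≤ Real.exp (-(k * ω ‖x‖)) := by
  have := ω.nonneg (norm_nonneg x)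
  gcongr

/-- By (γ), $e^{-k\omega(x)}$ is dominated by $(1+|x|)^{-(N+1)}$ for large $k$. -/
theorem exists_integrable_exp_neg (ω : NQWeight) (N : ℕ) :
    ∃ k : ℕ, ∀ l, k ≤ l →
      Integrable fun x : EuclideanSpace ℝ (Fin N) => Real.exp (-(l * ω ‖x‖)) := by
  obtain ⟨k, C, hC, h⟩ := ω.exists_pow_le (N + 1)
  refine ⟨k, fun l hl => ?_⟩
  have hI : Integrable fun x : EuclideanSpace ℝ (Fin N) => (1 + ‖x‖) ^ (-((N + 1 : ℕ) : ℝ)) :=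
    integrable_one_add_norm (by simp)
  refine (hI.const_mul C).mono' ?_ (Filter.Eventually.of_forall fun x => ?_)
  · exact (Real.continuous_exp.comp
      (continuous_const.mul ω.continuous_norm).neg).aestronglyMeasurable
  · rw [Real.norm_of_nonneg (Real.exp_nonneg _)]
    refine (exp_neg_mul_anti ω hl x).trans ?_
    have h1 := h ‖x‖ (norm_nonneg x)
    have h0 : 0 < 1 + ‖x‖ := by positivity
    rw [Real.rpow_neg h0.le, Real.rpow_natCast, ← div_eq_mul_inv, le_div_iff₀ (by positivity),
      Real.exp_neg, inv_mul_le_iff₀ (Real.exp_pos _)]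
    linarith

theorem Decays.integrable_pow_mul {ω : NQWeight} {u : EuclideanSpace ℝ (Fin N) → ℂ}
    (hu : Decays ω u) (hm : AEStronglyMeasurable u) (n : ℕ) :
    Integrable fun x => ‖x‖ ^ n * ‖u x‖ := by
  obtain ⟨k, hk⟩ := exists_integrable_exp_neg ω N
  obtain ⟨l, C, hC, hl⟩ := ω.exists_pow_le n
  obtain ⟨A, hA⟩ := hu (l + k)
  refine ((hk k le_rfl).const_mul (C * A)).mono' ?_ (Filter.Eventually.of_forall fun x => ?_)
  · exact (_root_.continuous_norm.pow n).aestronglyMeasurable.mul hm.norm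
  · rw [Real.norm_of_nonneg (by positivity)]
    have hA0 := nonneg_of_norm_le_mul_exp hA
    calc ‖x‖ ^ n * ‖u x‖ ≤ (C * Real.exp (l * ω ‖x‖)) *
          (A * Real.exp (-((l + k : ℕ) * ω ‖x‖))) := by
          gcongr
          · refine le_trans ?_ (hl ‖x‖ (norm_nonneg x))
            gcongr
            linarith
          · exact hA x
      _ = C * A * (Real.exp (l * ω ‖x‖) * Real.exp (-((l + k : ℕ) * ω ‖x‖))) := by ring
      _ = _ := by
        rw [← Real.exp_add]
        congr 2
        push_cast
        ring

theorem Decays.integrable {ω : NQWeight} {u : EuclideanSpace ℝ (Fin N) → ℂ}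
    (hu : Decays ω u) (hm : AEStronglyMeasurable u) : Integrable u := by
  have := hu.integrable_pow_mul hm 0
  simp only [pow_zero, one_mul] at this
  exact (integrable_norm_iff hm).1 this

theorem Decays.comp_neg {ω : NQWeight} {u : EuclideanSpace ℝ (Fin N) → ℂ} (hu : Decays ω u) :
    Decays ω fun x => u (-x) := fun k => by
  obtain ⟨A, hA⟩ := hu k
  exact ⟨A, fun x => by simpa using hA (-x)⟩

theorem decays_expSq (ω : NQWeight) : Decays ω (expSq (-Real.pi) : EuclideanSpace ℝ (Fin N) → ℂ) := by
  intro k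
  obtain ⟨C, hC, h⟩ := ω.exists_le_linear one_pos
  refine ⟨Real.exp (k * C + k ^ 2), fun x => ?_⟩
  rw [norm_expSq, ← Real.exp_add]
  apply Real.exp_le_exp.2
  have h1 := mul_le_mul_of_nonneg_left (h ‖x‖ (norm_nonneg x)) (Nat.cast_nonneg (α := ℝ) k)
  nlinarith [Real.pi_gt_three, sq_nonneg ((k : ℝ) - ‖x‖), sq_nonneg ‖x‖]

theorem integrable_exp_mul_gaussian (ω : NQWeight) (N k : ℕ) :
    Integrable fun x : EuclideanSpace ℝ (Fin N) =>
      Real.exp (k * ω ‖x‖) * Real.exp (-Real.pi * ‖x‖ ^ 2) := by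
  obtain ⟨l, hl⟩ := exists_integrable_exp_neg ω N
  obtain ⟨A, hA⟩ := decays_expSq (N := N) ω (k + l)
  refine ((hl l le_rfl).const_mul A).mono' ?_ (Filter.Eventually.of_forall fun x => ?_)
  · exact ((Real.continuous_exp.comp (continuous_const.mul ω.continuous_norm)).mul
      (Real.continuous_exp.comp
        (continuous_const.mul (_root_.continuous_norm.pow 2)))).aestronglyMeasurable
  · rw [Real.norm_of_nonneg (by positivity), ← norm_expSq]
    calc _ ≤ Real.exp (k * ω ‖x‖) * (A * Real.exp (-((k + l : ℕ) * ω ‖x‖))) := by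
          gcongr; exact hA x
      _ = A * (Real.exp (k * ω ‖x‖) * Real.exp (-((k + l : ℕ) * ω ‖x‖))) := by ring
      _ = _ := by
        rw [← Real.exp_add]
        congr 2
        push_cast
        ring

/-- Averages against Gaussians preserve the decay of functions. -/
theorem exists_integral_mul_gaussian_le (ω : NQWeight) (N j : ℕ) :
    ∃ k : ℕ, ∃ C : ℝ, 0 < C ∧ ∀ (u : EuclideanSpace ℝ (Fin N) → ℂ) (A : ℝ),
      (∀ y, ‖u y‖ ≤ A * Real.exp (-(k * ω ‖y‖))) → ∀ x,
        ∫ y, ‖u (y + x)‖ * Real.exp (-Real.pi * ‖y‖ ^ 2) ≤ C * A * Real.exp (-(j * ω ‖x‖)) := by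
  obtain ⟨K, hK, h⟩ := ω.exists_add_le
  -- With $k\ge jK$ one has $e^{-k\omega(y+x)}\le e^ke^{-j\omega(x)}e^{k\omega(y)}$, and the
  -- Gaussian makes the last factor integrable in $y$.
  obtain ⟨k, hk⟩ := exists_nat_ge (j * K)
  have hI := integrable_exp_mul_gaussian ω N k
  set I := ∫ y : EuclideanSpace ℝ (Fin N), Real.exp (k * ω ‖y‖) * Real.exp (-Real.pi * ‖y‖ ^ 2)
  have hI0 : 0 ≤ I := integral_nonneg fun y => by positivity
  refine ⟨k, Real.exp k * (I + 1), by positivity, fun u A hA x => ?_⟩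
  have hA0 := nonneg_of_norm_le_mul_exp hA
  calc _ ≤ ∫ y : EuclideanSpace ℝ (Fin N), (A * Real.exp k * Real.exp (-(j * ω ‖x‖))) *
        (Real.exp (k * ω ‖y‖) * Real.exp (-Real.pi * ‖y‖ ^ 2)) := by
        refine integral_mono_of_nonneg (Filter.Eventually.of_forall fun y => by positivity)
          (hI.const_mul _) (Filter.Eventually.of_forall fun y => ?_)
        have h1 : ω ‖x‖ ≤ K * (1 + ω ‖y + x‖ + ω ‖y‖) := by
          refine (ω.mono (norm_nonneg x) ?_).trans (h _ _ (norm_nonneg _) (norm_nonneg _))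
          calc ‖x‖ = ‖(y + x) - y‖ := by congr 1; abel
            _ ≤ _ := norm_sub_le _ _
        have h2 : 0 ≤ 1 + ω ‖y + x‖ + ω ‖y‖ := by
          have := ω.nonneg (norm_nonneg (y + x))
          have := ω.nonneg (norm_nonneg y)
          positivity
        have h3 : (j : ℝ) * ω ‖x‖ ≤ k * (1 + ω ‖y + x‖ + ω ‖y‖) := by
          calc (j : ℝ) * ω ‖x‖ ≤ j * (K * (1 + ω ‖y + x‖ + ω ‖y‖)) := by gcongr
            _ = (j * K) * (1 + ω ‖y + x‖ + ω ‖y‖) := by ring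
            _ ≤ _ := by gcongr
        have h4 : Real.exp (-(k * ω ‖y + x‖)) ≤
            Real.exp k * Real.exp (-(j * ω ‖x‖)) * Real.exp (k * ω ‖y‖) := by
          rw [← Real.exp_add, ← Real.exp_add]
          apply Real.exp_le_exp.2
          linarith
        calc ‖u (y + x)‖ * Real.exp (-Real.pi * ‖y‖ ^ 2)
            ≤ (A * (Real.exp k * Real.exp (-(j * ω ‖x‖)) * Real.exp (k * ω ‖y‖))) *
              Real.exp (-Real.pi * ‖y‖ ^ 2) := by
              gcongr
              exact (hA _).trans (mul_le_mul_of_nonneg_left h4 hA0)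
          _ = _ := by ring
    _ = (A * Real.exp k * Real.exp (-(j * ω ‖x‖))) * I := integral_const_mul _ _
    _ ≤ (A * Real.exp k * Real.exp (-(j * ω ‖x‖))) * (I + 1) := by gcongr; linarith
    _ = _ := by ring

theorem contDiff_fourier_of_decays {ω : NQWeight} {u : EuclideanSpace ℝ (Fin N) → ℂ}
    (hu : Decays ω u) (hm : AEStronglyMeasurable u) : ContDiff ℝ (⊤ : ℕ∞) (𝓕 u) :=
  Real.contDiff_fourier fun n _ => hu.integrable_pow_mul hm n

theorem norm_iteratedFDeriv_fourier_le {ω : NQWeight} {u : EuclideanSpace ℝ (Fin N) → ℂ}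
    (hu : Decays ω u) (hm : AEStronglyMeasurable u) (n : ℕ) (x : EuclideanSpace ℝ (Fin N)) :
    ‖iteratedFDeriv ℝ n (𝓕 u) x‖ ≤ ∫ ξ, (2 * Real.pi) ^ n * (‖ξ‖ ^ n * ‖u ξ‖) := by
  rw [Real.iteratedFDeriv_fourier (N := ⊤) (fun n _ => hu.integrable_pow_mul hm n) hm le_top]
  refine (VectorFourier.norm_fourierIntegral_le_integral_norm _ _ _ _ _).trans ?_
  refine integral_mono_of_nonneg (Filter.Eventually.of_forall fun _ => norm_nonneg _)
    ((hu.integrable_pow_mul hm n).const_mul _) (Filter.Eventually.of_forall fun ξ => ?_)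
  refine (VectorFourier.norm_fourierPowSMulRight_le _ _ _ _).trans ?_
  have h1 : ‖(innerSL ℝ : EuclideanSpace ℝ (Fin N) →L[ℝ] _)‖ ≤ 1 := norm_innerSL_le _
  have h2 : 2 * Real.pi * ‖(innerSL ℝ : EuclideanSpace ℝ (Fin N) →L[ℝ] _)‖ ≤ 2 * Real.pi := by
    nlinarith [Real.pi_pos]
  have h3 := pow_le_pow_left₀ (by positivity) h2 n
  calc _ ≤ (2 * Real.pi) ^ n * ‖ξ‖ ^ n * ‖u ξ‖ := by gcongr
    _ = _ := by ring

theorem norm_fourier_mul_expSq_le_left {u : EuclideanSpace ℝ (Fin N) → ℂ}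
    (ξ : EuclideanSpace ℝ (Fin N)) :
    ‖𝓕 (fun y => u y * expSq (-Real.pi) y) ξ‖ ≤ ∫ y, ‖u y‖ * Real.exp (-Real.pi * ‖y‖ ^ 2) := by
  refine (VectorFourier.norm_fourierIntegral_le_integral_norm _ _ _ _ _).trans (le_of_eq ?_)
  simp_rw [norm_mul, norm_expSq]

/-- The transform of a product with a Gaussian is a convolution of $\hat u$ with a Gaussian. Here
this comes from $\int\hat\phi\,\psi=\int\phi\,\hat\psi$, where $\hat\phi=u$ by inversion and $\psi$
is a modulated Gaussian, whose transform is a translated one. While `norm_fourier_mul_expSq_le_left`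
exploits the decay of $u$, this bound exploits that of $\hat u$. -/
theorem norm_fourier_mul_expSq_le_right {u : EuclideanSpace ℝ (Fin N) → ℂ} (hc : Continuous u)
    (hu : Integrable u) (hu' : Integrable (𝓕 u)) (ξ : EuclideanSpace ℝ (Fin N)) :
    ‖𝓕 (fun y => u y * expSq (-Real.pi) y) ξ‖ ≤
      ∫ y, ‖𝓕 u (-(y + -ξ))‖ * Real.exp (-Real.pi * ‖y‖ ^ 2) := by
  set ψ : EuclideanSpace ℝ (Fin N) → ℂ := fun v =>
    Complex.exp (-(Real.pi : ℂ) * ‖v‖ ^ 2 + 2 * Real.pi * Complex.I * (inner ℝ (-ξ) v : ℝ)) with hψ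
  have hpi : 0 < (Real.pi : ℂ).re := by simpa using Real.pi_pos
  have hψi : Integrable ψ := by
    have := GaussianFourier.integrable_cexp_neg_mul_sq_norm_add hpi (2 * Real.pi * Complex.I) (-ξ)
    exact this
  have hψf : ∀ w, ‖𝓕 ψ w‖ = Real.exp (-Real.pi * ‖w + ξ‖ ^ 2) := by
    intro w
    rw [hψ, fourier_gaussian_innerProductSpace' hpi]
    have : (-ξ - w) = -(w + ξ) := by abel
    have h0 : (Real.pi : ℂ) ≠ 0 := by exact_mod_cast Real.pi_ne_zero
    rw [div_self h0, Complex.one_cpow, one_mul, this, norm_neg,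
      show -(Real.pi : ℂ) ^ 2 * (‖w + ξ‖ : ℂ) ^ 2 / Real.pi =
        ((-Real.pi * ‖w + ξ‖ ^ 2 : ℝ) : ℂ) by push_cast; field_simp, Complex.norm_exp,
      Complex.ofReal_re]
  have hF : 𝓕 (fun w => 𝓕 u (-w)) = u := by
    rw [← Real.fourierInv_eq_fourier_comp_neg]
    exact hc.fourierInv_fourier_eq hu hu'
  have h1 : 𝓕 (fun y => u y * expSq (-Real.pi) y) ξ = ∫ y, 𝓕 (fun w => 𝓕 u (-w)) y • ψ y := by
    rw [hF, Real.fourier_eq']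
    congr 1
    funext y
    rw [smul_eq_mul, smul_eq_mul, hψ, expSq]
    simp only
    rw [mul_left_comm, ← Complex.exp_add, inner_neg_left, real_inner_comm]
    congr 2
    push_cast
    ring
  have h2 : ∫ y, 𝓕 (fun w => 𝓕 u (-w)) y • ψ y = ∫ w, 𝓕 u (-w) • 𝓕 ψ w := by
    simpa using! (VectorFourier.integral_fourierIntegral_smul_eq_flip
      (L := innerₗ (EuclideanSpace ℝ (Fin N))) Real.continuous_fourierChar continuous_inner
      hu'.comp_neg hψi)
  rw [h1, h2]
  refine (norm_integral_le_integral_norm _).trans (le_of_eq ?_)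
  simp_rw [norm_smul, hψf]
  rw [← integral_sub_right_eq_self _ ξ]
  congr 1
  funext y
  rw [sub_add_cancel, sub_eq_add_neg]

end Decay

/-! ### Decay of a function and its transform versus weighted derivative bounds -/

section Characterization

open scoped FourierTransform

variable {N : ℕ} {ω : NQWeight} {f : EuclideanSpace ℝ (Fin N) → ℂ}

theorem continuous_fourier (hf : Integrable f) : Continuous (𝓕 f) :=
  VectorFourier.fourierIntegral_continuous Real.continuous_fourierChar
    (by exact continuous_inner) hf

/-- Continuous functions which decay rapidly together with their Fourier transforms. -/
structure FourierDecays (ω : NQWeight) {N : ℕ} (f : EuclideanSpace ℝ (Fin N) → ℂ) : Prop where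
  continuous : Continuous f
  decays : Decays ω f
  decays_fourier : Decays ω (𝓕 f)

namespace FourierDecays

theorem integrable (hf : FourierDecays ω f) : Integrable f :=
  hf.decays.integrable hf.continuous.aestronglyMeasurable

theorem continuous_fourier (hf : FourierDecays ω f) : Continuous (𝓕 f) :=
  _root_.continuous_fourier hf.integrable

theorem integrable_fourier (hf : FourierDecays ω f) : Integrable (𝓕 f) :=
  hf.decays_fourier.integrable hf.continuous_fourier.aestronglyMeasurable

theorem fourier_fourier_neg (hf : FourierDecays ω f) : 𝓕 (fun ξ => 𝓕 f (-ξ)) = f := by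
  rw [← Real.fourierInv_eq_fourier_comp_neg]
  exact hf.continuous.fourierInv_fourier_eq hf.integrable hf.integrable_fourier

theorem contDiff (hf : FourierDecays ω f) : ContDiff ℝ (⊤ : ℕ∞) f := by
  rw [← hf.fourier_fourier_neg]
  exact contDiff_fourier_of_decays hf.decays_fourier.comp_neg
    (hf.continuous_fourier.comp continuous_neg).aestronglyMeasurable

end FourierDecays

theorem norm_fourier_comp_add (f : EuclideanSpace ℝ (Fin N) → ℂ) (x ξ : EuclideanSpace ℝ (Fin N)) :
    ‖𝓕 (fun y => f (y + x)) ξ‖ = ‖𝓕 f ξ‖ := by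
  have h := congrFun (VectorFourier.fourierIntegral_comp_add_right Real.fourierChar volume
    (innerₗ (EuclideanSpace ℝ (Fin N))) f x) ξ
  change ‖VectorFourier.fourierIntegral Real.fourierChar volume
    (innerₗ (EuclideanSpace ℝ (Fin N))) (f ∘ fun v => v + x) ξ‖ = _
  rw [h, Circle.norm_smul]
  rfl

/-- The short-time Fourier transform decays in both variables. -/
theorem exists_norm_fourier_translate_mul_expSq_le (ω : NQWeight) (N j : ℕ) :
    ∃ k : ℕ, ∃ C : ℝ, 0 < C ∧ ∀ (f : EuclideanSpace ℝ (Fin N) → ℂ) (A : ℝ), FourierDecays ω f →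
      (∀ x, ‖f x‖ ≤ A * Real.exp (-(k * ω ‖x‖))) →
      (∀ ξ, ‖𝓕 f ξ‖ ≤ A * Real.exp (-(k * ω ‖ξ‖))) → ∀ x ξ,
        ‖𝓕 (fun y => f (y + x) * expSq (-Real.pi) y) ξ‖ ≤
          C * A * Real.exp (-(j * ω ‖x‖)) * Real.exp (-(j * ω ‖ξ‖)) := by
  -- One bound of the transform decays in $x$ only, the other in $\xi$ only. Their geometric mean
  -- decays in both at half the rate, hence $2j$.
  obtain ⟨k, C, hC, h⟩ := exists_integral_mul_gaussian_le ω N (2 * j)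
  refine ⟨k, C, hC, fun f A hf hA hA' x ξ => ?_⟩
  have hA0 := nonneg_of_norm_le_mul_exp hA
  have h1 := (norm_fourier_mul_expSq_le_left (u := fun y => f (y + x)) ξ).trans (h f A hA x)
  have hfx : ∀ ξ, ‖𝓕 (fun y => f (y + x)) ξ‖ = ‖𝓕 f ξ‖ := norm_fourier_comp_add f x
  have hix : Integrable (𝓕 (fun y => f (y + x))) :=
    hf.integrable_fourier.mono
      (continuous_fourier (hf.integrable.comp_add_right x)).aestronglyMeasurable
      (Filter.Eventually.of_forall fun ξ => (hfx ξ).le)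
  have h2 := (norm_fourier_mul_expSq_le_right (hf.continuous.comp (continuous_add_const x))
    (hf.integrable.comp_add_right x) hix ξ).trans
    (h (fun w => 𝓕 (fun y => f (y + x)) (-w)) A (fun y => by rw [hfx, ← norm_neg y]; exact hA' _)
      (-ξ))
  rw [norm_neg] at h2
  set v := ‖𝓕 (fun y => f (y + x) * expSq (-Real.pi) y) ξ‖ with hv
  have hv0 : 0 ≤ v := norm_nonneg _
  have he : ∀ z : EuclideanSpace ℝ (Fin N), Real.exp (-((2 * j : ℕ) * ω ‖z‖)) =
      Real.exp (-(j * ω ‖z‖)) ^ 2 := by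
    intro z
    rw [← Real.exp_nat_mul]
    congr 1
    push_cast
    ring
  rw [he] at h1 h2
  refine le_of_sq_le_sq ?_ (by positivity)
  calc v ^ 2 = v * v := sq v
    _ ≤ (C * A * Real.exp (-(j * ω ‖x‖)) ^ 2) * (C * A * Real.exp (-(j * ω ‖ξ‖)) ^ 2) :=
      mul_le_mul h1 h2 hv0 (hv0.trans h1)
    _ = _ := by ring

/-- Decay of `f` and of its Fourier transform controls all derivatives of `f`. -/
theorem exists_youngWeight_mul_iteratedFDeriv_le (ω : NQWeight) (N : ℕ) (m : ℕ+) (l : ℕ) :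
    ∃ k : ℕ, ∃ C : ℝ, 0 < C ∧ ∀ (f : EuclideanSpace ℝ (Fin N) → ℂ) (A : ℝ), FourierDecays ω f →
      (∀ x, ‖f x‖ ≤ A * Real.exp (-(k * ω ‖x‖))) →
      (∀ ξ, ‖𝓕 f ξ‖ ≤ A * Real.exp (-(k * ω ‖ξ‖))) → ∀ n x,
        youngWeight ω m n * ‖iteratedFDeriv ℝ n f x‖ ≤ C * A * Real.exp (-(l * ω ‖x‖)) := by
  obtain ⟨m₁, D₁, hD₁, h₁⟩ := exists_iteratedFDeriv_le_of_mul_expSq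
    (V := EuclideanSpace ℝ (Fin N)) ω (-Real.pi) m
  obtain ⟨m₂, D₂, hD₂, h₂⟩ := exists_pow_mul_youngWeight_le ω (2 * Real.pi) m₁
  rw [abs_of_nonneg (by positivity)] at h₂
  obtain ⟨k₀, hk₀⟩ := exists_integrable_exp_neg ω N
  have hI := hk₀ k₀ le_rfl
  set I := ∫ x : EuclideanSpace ℝ (Fin N), Real.exp (-(k₀ * ω ‖x‖))
  have hI0 : 0 ≤ I := integral_nonneg fun _ => Real.exp_nonneg _
  -- The rate $l$ remains as decay in $x$, $m_2$ pays for $|\xi|^n$ times the weight of order $n$,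
  -- and $k_0$ makes the integral over $\xi$ converge.
  obtain ⟨k, C, hC, h⟩ := exists_norm_fourier_translate_mul_expSq_le ω N (l + m₂ + k₀)
  set M := D₂ * Real.exp (m₂ * ω 1) * C with hM
  refine ⟨k, D₁ * (M * (I + 1)), by positivity, fun f A hf hA hA' n x => ?_⟩
  have hA0 := nonneg_of_norm_le_mul_exp hA
  -- The piece of $f$ near $x$, moved to the origin. Only its derivatives at $0$ are needed, and
  -- inversion expresses them as moments of its transform.
  set g : EuclideanSpace ℝ (Fin N) → ℂ := fun y => f (y + x) * expSq (-Real.pi) y with hg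
  have hgc : Continuous g := (hf.continuous.comp (continuous_add_const x)).mul
    (contDiff_expSq (n := 0) _).continuous
  have hgi : Integrable g := by
    refine (hf.integrable.comp_add_right x).mono hgc.aestronglyMeasurable
      (Filter.Eventually.of_forall fun y => ?_)
    rw [hg, norm_mul, norm_expSq]
    refine mul_le_of_le_one_right (norm_nonneg _) (Real.exp_le_one_iff.2 ?_)
    nlinarith [Real.pi_pos, sq_nonneg ‖y‖]
  have hgd : Decays ω (𝓕 g) := by
    intro j
    obtain ⟨k', C', hC', h'⟩ := exists_norm_fourier_translate_mul_expSq_le ω N j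
    obtain ⟨A₁, hA₁⟩ := hf.decays k'
    obtain ⟨A₂, hA₂⟩ := hf.decays_fourier k'
    refine ⟨C' * max A₁ A₂ * Real.exp (-(j * ω ‖x‖)), h' f _ hf (fun x => (hA₁ x).trans ?_)
      (fun x => (hA₂ x).trans ?_) x⟩ <;> gcongr
    · exact le_max_left _ _
    · exact le_max_right _ _
  have hgFc : Continuous (𝓕 g) := continuous_fourier hgi
  have hginv : 𝓕 (fun ξ => 𝓕 g (-ξ)) = g := by
    rw [← Real.fourierInv_eq_fourier_comp_neg]
    exact hgc.fourierInv_fourier_eq hgi (hgd.integrable hgFc.aestronglyMeasurable)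
  have hbound : ∀ n, youngWeight ω m₁ n * ‖iteratedFDeriv ℝ n g 0‖ ≤
      M * A * Real.exp (-(l * ω ‖x‖)) * I := by
    intro n
    have hd := norm_iteratedFDeriv_fourier_le hgd.comp_neg
      (hgFc.comp continuous_neg).aestronglyMeasurable n 0
    rw [hginv] at hd
    have hW := youngWeight_nonneg ω m₁ n
    refine (mul_le_mul_of_nonneg_left hd hW).trans ?_
    rw [← integral_const_mul, ← integral_const_mul]
    refine integral_mono_of_nonneg (Filter.Eventually.of_forall fun _ => by positivity)
      (hI.const_mul _) (Filter.Eventually.of_forall fun ξ => ?_)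
    have e1 := pow_mul_youngWeight_le ω m₂ n (norm_nonneg ξ)
    have e2 := h f A hf hA hA' x (-ξ)
    rw [norm_neg] at e2
    have e3 : Real.exp (m₂ * ω ‖ξ‖) * Real.exp (-((l + m₂ + k₀ : ℕ) * ω ‖ξ‖)) ≤
        Real.exp (-(k₀ * ω ‖ξ‖)) := by
      rw [← Real.exp_add]
      apply Real.exp_le_exp.2
      have := mul_nonneg (Nat.cast_nonneg (α := ℝ) l) (ω.nonneg (norm_nonneg ξ))
      push_cast
      linarith
    have e4 : Real.exp (-((l + m₂ + k₀ : ℕ) * ω ‖x‖)) ≤ Real.exp (-(l * ω ‖x‖)) :=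
      exp_neg_mul_anti ω (by omega) x
    calc youngWeight ω m₁ n * ((2 * Real.pi) ^ n * (‖ξ‖ ^ n * ‖𝓕 g (-ξ)‖))
        = ((2 * Real.pi) ^ n * youngWeight ω m₁ n) * (‖ξ‖ ^ n * ‖𝓕 g (-ξ)‖) := by ring
      _ ≤ (D₂ * youngWeight ω m₂ n) * (‖ξ‖ ^ n * ‖𝓕 g (-ξ)‖) :=
        mul_le_mul_of_nonneg_right (h₂ n) (by positivity)
      _ = D₂ * (‖ξ‖ ^ n * youngWeight ω m₂ n) * ‖𝓕 g (-ξ)‖ := by ring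
      _ ≤ D₂ * (Real.exp (m₂ * ω 1) * Real.exp (m₂ * ω ‖ξ‖)) *
          (C * A * Real.exp (-((l + m₂ + k₀ : ℕ) * ω ‖x‖)) *
            Real.exp (-((l + m₂ + k₀ : ℕ) * ω ‖ξ‖))) := by gcongr
      _ = M * A * Real.exp (-((l + m₂ + k₀ : ℕ) * ω ‖x‖)) * (Real.exp (m₂ * ω ‖ξ‖) *
            Real.exp (-((l + m₂ + k₀ : ℕ) * ω ‖ξ‖))) := by rw [hM]; ring
      _ ≤ M * A * Real.exp (-(l * ω ‖x‖)) * Real.exp (-(k₀ * ω ‖ξ‖)) := by gcongr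
  have hgx : (fun y => f y * expSq (-Real.pi) (y - x)) = fun y => g (y - x) := by
    funext y
    rw [hg]
    simp
  have := h₁ f x _ hf.contDiff
    (fun n => by rw [hgx, iteratedFDeriv_comp_sub, sub_self]; exact hbound n) n
  calc _ ≤ D₁ * (M * A * Real.exp (-(l * ω ‖x‖)) * I) := this
    _ ≤ D₁ * (M * A * Real.exp (-(l * ω ‖x‖)) * (I + 1)) := by gcongr; linarith
    _ = _ := by ring

/-- Smooth functions whose derivatives satisfy all weighted estimates. -/
structure WeightedSmooth (ω : NQWeight) {N : ℕ} (f : EuclideanSpace ℝ (Fin N) → ℂ) : Prop where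
  contDiff : ContDiff ℝ (⊤ : ℕ∞) f
  bound : ∀ (m : ℕ+) (l : ℕ), ∃ A : ℝ, ∀ n x,
    youngWeight ω m n * ‖iteratedFDeriv ℝ n f x‖ ≤ A * Real.exp (-(l * ω ‖x‖))

theorem FourierDecays.weightedSmooth (hf : FourierDecays ω f) : WeightedSmooth ω f := by
  refine ⟨hf.contDiff, fun m l => ?_⟩
  obtain ⟨k, C, hC, h⟩ := exists_youngWeight_mul_iteratedFDeriv_le ω N m l
  obtain ⟨A₁, hA₁⟩ := hf.decays k
  obtain ⟨A₂, hA₂⟩ := hf.decays_fourier k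
  refine ⟨C * max A₁ A₂, h f _ hf (fun x => (hA₁ x).trans ?_) (fun x => (hA₂ x).trans ?_)⟩ <;>
    gcongr
  · exact le_max_left _ _
  · exact le_max_right _ _

theorem WeightedSmooth.iteratedFDeriv_bound (hf : WeightedSmooth ω f) (n l : ℕ) :
    ∃ A : ℝ, ∀ x, ‖iteratedFDeriv ℝ n f x‖ ≤ A * Real.exp (-(l * ω ‖x‖)) := by
  obtain ⟨m, hm⟩ := exists_youngWeight_pos ω n
  obtain ⟨A, hA⟩ := hf.bound m l
  refine ⟨A / youngWeight ω m n, fun x => ?_⟩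
  rw [div_mul_eq_mul_div, le_div_iff₀ hm, mul_comm]
  exact hA n x

theorem WeightedSmooth.decays (hf : WeightedSmooth ω f) : Decays ω f := fun k => by
  simpa using hf.iteratedFDeriv_bound 0 k

theorem WeightedSmooth.integrable_iteratedFDeriv (hf : WeightedSmooth ω f) (n : ℕ) :
    Integrable (iteratedFDeriv ℝ n f) := by
  obtain ⟨k, hk⟩ := exists_integrable_exp_neg ω N
  obtain ⟨A, hA⟩ := hf.iteratedFDeriv_bound n k
  exact ((hk k le_rfl).const_mul A).mono'
    (hf.contDiff.continuous_iteratedFDeriv (by exact_mod_cast le_top)).aestronglyMeasurable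
    (Filter.Eventually.of_forall hA)

/-- The transform of the $n$-th derivative, evaluated on $(\xi,\dots,\xi)$, has modulus
$(2\pi)^n|\xi|^{2n}|\hat f(\xi)|$, while its operator norm contributes only $|\xi|^n$. Cancelling
$|\xi|^n$ requires $\xi\ne0$; the factor $(2\pi)^n\ge1$ is dropped. -/
theorem pow_mul_norm_fourier_le (hf : ContDiff ℝ (⊤ : ℕ∞) f)
    (hi : ∀ n, Integrable (iteratedFDeriv ℝ n f)) (n : ℕ) (ξ : EuclideanSpace ℝ (Fin N)) :
    ‖ξ‖ ^ n * ‖𝓕 f ξ‖ ≤ ∫ x, ‖iteratedFDeriv ℝ n f x‖ := by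
  have h1 := Real.fourier_iteratedFDeriv (N := ⊤) hf (fun n _ => hi n) (n := n) le_top
  have h2 : ‖𝓕 (iteratedFDeriv ℝ n f) ξ‖ ≤ ∫ x, ‖iteratedFDeriv ℝ n f x‖ :=
    VectorFourier.norm_fourierIntegral_le_integral_norm _ _ _ _ _
  rcases eq_or_ne ξ 0 with rfl | h0
  · rcases n with _ | n
    · simp only [pow_zero, one_mul, norm_iteratedFDeriv_zero]
      exact VectorFourier.norm_fourierIntegral_le_integral_norm _ _ _ _ _
    · simp only [norm_zero, ne_eq, Nat.succ_ne_zero, not_false_eq_true, zero_pow, zero_mul]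
      exact integral_nonneg fun _ => norm_nonneg _
  refine le_trans ?_ h2
  have h3 := (𝓕 (iteratedFDeriv ℝ n f) ξ).le_opNorm (fun _ => ξ)
  rw [h1] at h3 ⊢
  rw [VectorFourier.fourierPowSMulRight_apply] at h3
  simp only [norm_smul, norm_pow, Finset.prod_const, Finset.card_univ, Fintype.card_fin] at h3
  have hξ : 0 < ‖ξ‖ ^ n := by positivity
  refine le_of_mul_le_mul_right (le_trans ?_ h3) hξ
  have h4 : ‖((-innerSL ℝ : EuclideanSpace ℝ (Fin N) →L[ℝ] EuclideanSpace ℝ (Fin N) →L[ℝ] ℝ) ξ) ξ‖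
      = ‖ξ‖ * ‖ξ‖ := by
    simp [sq]
  have h5 : (1 : ℝ) ≤ ‖-(2 * (Real.pi : ℂ) * Complex.I)‖ := by
    simp [abs_of_pos Real.pi_pos]
    nlinarith [Real.pi_gt_three]
  rw [h4, mul_pow]
  calc ‖ξ‖ ^ n * ‖𝓕 f ξ‖ * ‖ξ‖ ^ n = 1 * (‖ξ‖ ^ n * ‖ξ‖ ^ n * ‖𝓕 f ξ‖) := by ring
    _ ≤ _ := by gcongr; exact one_le_pow₀ h5

/-- Weighted estimates of the derivatives control the decay of the Fourier transform. -/
theorem exists_norm_fourier_le (ω : NQWeight) (N k : ℕ) :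
    ∃ m : ℕ+, ∃ l : ℕ, ∃ C : ℝ, 0 < C ∧ ∀ (f : EuclideanSpace ℝ (Fin N) → ℂ) (A : ℝ),
      WeightedSmooth ω f →
      (∀ n x, youngWeight ω m n * ‖iteratedFDeriv ℝ n f x‖ ≤ A * Real.exp (-(l * ω ‖x‖))) →
      (∀ x, ‖f x‖ ≤ C * A * Real.exp (-(k * ω ‖x‖))) ∧
        ∀ ξ, ‖𝓕 f ξ‖ ≤ C * A * Real.exp (-(k * ω ‖ξ‖)) := by
  obtain ⟨k₀, hk₀⟩ := exists_integrable_exp_neg ω N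
  obtain ⟨p, D, hD, hp⟩ := ω.exists_pow_le 1
  -- The summand $p$ compensates the factor $1+|\xi|$ of the biconjugate estimate, and the $1$ makes
  -- $m$ positive.
  set m : ℕ+ := ⟨k + p + 1, by omega⟩ with hm
  obtain ⟨C, hC, h⟩ := exists_le_of_pow_mul_youngWeight_le ω m
  have hI := hk₀ (k₀ + k) (by omega)
  set I := ∫ x : EuclideanSpace ℝ (Fin N), Real.exp (-((k₀ + k : ℕ) * ω ‖x‖))
  have hI0 : 0 ≤ I := integral_nonneg fun _ => Real.exp_nonneg _
  have hW0 := youngWeight_zero_pos ω m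
  refine ⟨m, k₀ + k, 1 / youngWeight ω m 0 + C * I * D, by positivity, fun f A hf hA => ?_⟩
  have hA0 : 0 ≤ A := nonneg_of_mul_nonneg_left
    ((mul_nonneg (youngWeight_nonneg ω m 0) (norm_nonneg _)).trans (hA 0 0)) (Real.exp_pos _)
  constructor
  · intro x
    have h1 := hA 0 x
    rw [norm_iteratedFDeriv_zero, mul_comm, ← le_div_iff₀ hW0] at h1
    calc ‖f x‖ ≤ A * Real.exp (-((k₀ + k : ℕ) * ω ‖x‖)) / youngWeight ω m 0 := h1
      _ ≤ A * Real.exp (-(k * ω ‖x‖)) / youngWeight ω m 0 := by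
        gcongr ?_ / _
        exact mul_le_mul_of_nonneg_left (exp_neg_mul_anti ω (by omega) x) hA0
      _ = (1 / youngWeight ω m 0 + 0) * A * Real.exp (-(k * ω ‖x‖)) := by ring
      _ ≤ _ := by gcongr; positivity
  · intro ξ
    -- The products $|\xi|^n|\hat f(\xi)|$, times the weight of order $n$, are bounded by $AI$
    -- uniformly in $n$. This is the input of the biconjugate estimate.
    have h1 := h (A * I) ‖𝓕 f ξ‖ ‖ξ‖ (norm_nonneg _) (norm_nonneg _) fun n => by
      rw [mul_assoc]
      calc _ ≤ youngWeight ω m n * ∫ x, ‖iteratedFDeriv ℝ n f x‖ :=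
            mul_le_mul_of_nonneg_left
              (pow_mul_norm_fourier_le hf.contDiff hf.integrable_iteratedFDeriv n ξ)
              (youngWeight_nonneg ω m n)
        _ = ∫ x, youngWeight ω m n * ‖iteratedFDeriv ℝ n f x‖ := (integral_const_mul _ _).symm
        _ ≤ ∫ x : EuclideanSpace ℝ (Fin N), A * Real.exp (-((k₀ + k : ℕ) * ω ‖x‖)) :=
          integral_mono_of_nonneg (Filter.Eventually.of_forall fun x =>
            mul_nonneg (youngWeight_nonneg ω m n) (norm_nonneg _)) (hI.const_mul _)
            (Filter.Eventually.of_forall fun x => hA n x)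
        _ = A * I := integral_const_mul _ _
    have h2 := hp ‖ξ‖ (norm_nonneg ξ)
    rw [pow_one] at h2
    have h3 : Real.exp (p * ω ‖ξ‖) * Real.exp (-((m : ℕ) * ω ‖ξ‖)) ≤ Real.exp (-(k * ω ‖ξ‖)) := by
      rw [← Real.exp_add]
      apply Real.exp_le_exp.2
      have := ω.nonneg (norm_nonneg ξ)
      simp only [hm, PNat.mk_coe]
      push_cast
      linarith
    calc ‖𝓕 f ξ‖ ≤ C * (A * I) * (1 + ‖ξ‖) * Real.exp (-((m : ℕ) * ω ‖ξ‖)) := h1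
      _ ≤ C * (A * I) * (D * Real.exp (p * ω ‖ξ‖)) * Real.exp (-((m : ℕ) * ω ‖ξ‖)) := by gcongr
      _ = C * (A * I) * D * (Real.exp (p * ω ‖ξ‖) * Real.exp (-((m : ℕ) * ω ‖ξ‖))) := by ring
      _ ≤ C * (A * I) * D * Real.exp (-(k * ω ‖ξ‖)) := by gcongr
      _ = (0 + C * I * D) * A * Real.exp (-(k * ω ‖ξ‖)) := by ring
      _ ≤ _ := by gcongr; positivity

theorem WeightedSmooth.fourierDecays (hf : WeightedSmooth ω f) : FourierDecays ω f := by
  refine ⟨hf.contDiff.continuous, hf.decays, fun k => ?_⟩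
  obtain ⟨m, l, C, hC, h⟩ := exists_norm_fourier_le ω N k
  obtain ⟨A, hA⟩ := hf.bound m l
  exact ⟨C * A, (h f A hf hA).2⟩

end Characterization

/-! ### The space $\mathcal S_\omega$ and its seminorms -/

section SpaceSOmega

open scoped FourierTransform

variable {N : ℕ} {ω : NQWeight} {f : EuclideanSpace ℝ (Fin N) → ℂ}

theorem hatF_eq_fourier (f : EuclideanSpace ℝ (Fin N) → ℂ) (ξ : EuclideanSpace ℝ (Fin N)) :
    hatF f ξ = 𝓕 f ((2 * Real.pi)⁻¹ • ξ) := by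
  rw [hatF, Real.fourier_eq']
  congr 1
  funext x
  rw [smul_eq_mul, mul_comm, inner_smul_right]
  congr 2
  have : (Real.pi : ℂ) ≠ 0 := by exact_mod_cast Real.pi_ne_zero
  push_cast
  field_simp

theorem fourier_eq_hatF (f : EuclideanSpace ℝ (Fin N) → ℂ) (ξ : EuclideanSpace ℝ (Fin N)) :
    𝓕 f ξ = hatF f ((2 * Real.pi) • ξ) := by
  rw [hatF_eq_fourier, smul_smul, inv_mul_cancel₀ (by positivity), one_smul]

theorem norm_le_norm_two_pi_smul (x : EuclideanSpace ℝ (Fin N)) : ‖x‖ ≤ ‖(2 * Real.pi) • x‖ := by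
  rw [norm_smul, Real.norm_of_nonneg (by positivity)]
  nlinarith [norm_nonneg x, Real.pi_gt_three]

theorem norm_fourier_le_of_hatF {k : ℕ} {A : ℝ}
    (h : ∀ ξ, ‖hatF f ξ‖ ≤ A * Real.exp (-(k * ω ‖ξ‖))) (ξ : EuclideanSpace ℝ (Fin N)) :
    ‖𝓕 f ξ‖ ≤ A * Real.exp (-(k * ω ‖ξ‖)) := by
  have hA0 := nonneg_of_norm_le_mul_exp h
  rw [fourier_eq_hatF]
  refine (h _).trans ?_
  gcongr
  exact ω.mono (norm_nonneg _) (norm_le_norm_two_pi_smul ξ)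

/-- In this direction the argument shrinks by $2\pi$, so (α) is needed and the rate drops from
$k'\ge kK$ to $k$. -/
theorem exists_norm_hatF_le (ω : NQWeight) (N k : ℕ) :
    ∃ k' : ℕ, ∃ C : ℝ, 0 < C ∧ ∀ (f : EuclideanSpace ℝ (Fin N) → ℂ) (A : ℝ),
      (∀ ξ, ‖𝓕 f ξ‖ ≤ A * Real.exp (-(k' * ω ‖ξ‖))) →
      ∀ ξ, ‖hatF f ξ‖ ≤ C * A * Real.exp (-(k * ω ‖ξ‖)) := by
  obtain ⟨K, hK, h⟩ := ω.exists_dilation_le (2 * Real.pi)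
  rw [abs_of_nonneg (by positivity)] at h
  obtain ⟨k', hk'⟩ := exists_nat_ge (k * K)
  refine ⟨k', Real.exp (k * K), by positivity, fun f A hA ξ => ?_⟩
  have hA0 := nonneg_of_norm_le_mul_exp hA
  rw [hatF_eq_fourier]
  set η := (2 * Real.pi)⁻¹ • ξ with hη
  have h1 : ‖ξ‖ = 2 * Real.pi * ‖η‖ := by
    rw [hη, norm_smul, Real.norm_of_nonneg (by positivity)]
    field_simp
  have h2 := h ‖η‖ (norm_nonneg η)
  have h3 := ω.nonneg (norm_nonneg η)
  calc ‖𝓕 f η‖ ≤ A * Real.exp (-(k' * ω ‖η‖)) := hA η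
    _ ≤ A * (Real.exp (k * K) * Real.exp (-(k * ω ‖ξ‖))) := by
      rw [← Real.exp_add, h1]
      gcongr
      have h4 := mul_le_mul_of_nonneg_left h2 (Nat.cast_nonneg (α := ℝ) k)
      have h5 := mul_le_mul_of_nonneg_right hk' h3
      linarith
    _ = _ := by ring

namespace FourierDecays

/-- Fourier inversion after the substitution $\xi\mapsto\xi/(2\pi)$, whose Jacobian is the factor
$(2\pi)^N$. It shows that $\hat f$ satisfies the same decay conditions as $f$, so estimates for
derivatives of $f$ apply to $\hat f$ as well. -/
theorem fourier_hatF (hf : FourierDecays ω f) (x : EuclideanSpace ℝ (Fin N)) :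
    𝓕 (hatF f) x = ((2 * Real.pi) ^ N : ℝ) • f (-((2 * Real.pi) • x)) := by
  have h1 : f (-((2 * Real.pi) • x)) = 𝓕 (𝓕 f) ((2 * Real.pi) • x) := by
    conv_lhs => rw [← hf.continuous.fourierInv_fourier_eq hf.integrable hf.integrable_fourier]
    rw [Real.fourierInv_eq_fourier_neg, neg_neg]
  rw [h1, Real.fourier_eq', Real.fourier_eq']
  have h2 := Measure.integral_comp_smul (volume : Measure (EuclideanSpace ℝ (Fin N)))
    (fun v => Complex.exp ((-2 * Real.pi * inner ℝ v ((2 * Real.pi) • x) : ℝ) * Complex.I) • 𝓕 f v)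
    (2 * Real.pi)⁻¹
  rw [finrank_euclideanSpace_fin] at h2
  have h3 : |(((2 * Real.pi)⁻¹ ^ N : ℝ))⁻¹| = (2 * Real.pi) ^ N := by
    rw [abs_of_nonneg (by positivity), inv_pow, inv_inv]
  rw [h3] at h2
  rw [← h2]
  congr 1
  funext v
  rw [hatF_eq_fourier, inner_smul_left, inner_smul_right]
  congr 3
  simp
  field_simp

theorem norm_fourier_hatF_le (hf : FourierDecays ω f) {k : ℕ} {A : ℝ}
    (h : ∀ x, ‖f x‖ ≤ A * Real.exp (-(k * ω ‖x‖))) (x : EuclideanSpace ℝ (Fin N)) :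
    ‖𝓕 (hatF f) x‖ ≤ (2 * Real.pi) ^ N * A * Real.exp (-(k * ω ‖x‖)) := by
  have hA0 := nonneg_of_norm_le_mul_exp h
  rw [hf.fourier_hatF, norm_smul, Real.norm_of_nonneg (by positivity), mul_assoc]
  refine mul_le_mul_of_nonneg_left ((h _).trans ?_) (by positivity)
  rw [norm_neg]
  gcongr
  exact ω.mono (norm_nonneg _) (norm_le_norm_two_pi_smul x)

theorem hatF (hf : FourierDecays ω f) : FourierDecays ω (hatF f) := by
  refine ⟨?_, fun k => ?_, fun k => ?_⟩
  · have : _root_.hatF f = fun ξ => 𝓕 f ((2 * Real.pi)⁻¹ • ξ) := funext (hatF_eq_fourier f)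
    rw [this]
    exact hf.continuous_fourier.comp (continuous_const_smul _)
  · obtain ⟨k', C, hC, h⟩ := exists_norm_hatF_le ω N k
    obtain ⟨A, hA⟩ := hf.decays_fourier k'
    exact ⟨C * A, h f A hA⟩
  · obtain ⟨A, hA⟩ := hf.decays k
    exact ⟨(2 * Real.pi) ^ N * A, hf.norm_fourier_hatF_le hA⟩

end FourierDecays

theorem WeightedSmooth.exists_exp_mul_norm_multiD_le (hf : WeightedSmooth ω f) (lam : ℝ)
    (α : Fin N → ℕ) :
    ∃ C : ℝ, ∀ x, Real.exp (lam * ω ‖x‖) * ‖multiD α f x‖ ≤ C := by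
  obtain ⟨l, hl'⟩ := exists_nat_ge lam
  obtain ⟨A, hA⟩ := hf.iteratedFDeriv_bound (∑ i, α i) l
  have hA0 : 0 ≤ A := nonneg_of_mul_nonneg_left ((norm_nonneg _).trans (hA 0)) (Real.exp_pos _)
  refine ⟨A, fun x => ?_⟩
  have h0 := ω.nonneg (norm_nonneg x)
  calc _ ≤ Real.exp (l * ω ‖x‖) * (A * Real.exp (-(l * ω ‖x‖))) := by
        gcongr
        exact (norm_multiD_le α hf.contDiff x).trans (hA x)
    _ = A * (Real.exp (l * ω ‖x‖) * Real.exp (-(l * ω ‖x‖))) := by ring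
    _ = A := by rw [← Real.exp_add]; simp

/-- Membership in `S_ω` only depends on the decay of `f` and of `f̂`. -/
theorem mem_sOmega_iff : f ∈ SOmegaSubmodule ω N ↔ FourierDecays ω f := by
  constructor
  · rintro ⟨h1, h2, h3, h4⟩
    have hdec : ∀ (k : ℕ) (u : EuclideanSpace ℝ (Fin N) → ℂ),
        (∃ C : ℝ, ∀ x, Real.exp (((k : ℝ) + 1) * ω ‖x‖) * ‖multiD 0 u x‖ ≤ C) →
        ∃ A : ℝ, ∀ x, ‖u x‖ ≤ A * Real.exp (-(k * ω ‖x‖)) := by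
      rintro k u ⟨C, hC⟩
      refine ⟨C, fun x => ?_⟩
      have h := (mul_le_mul_of_nonneg_right (exp_nat_mul_le ω k x) (norm_nonneg _)).trans (hC x)
      rw [multiD_zero_index] at h
      rw [Real.exp_neg, ← div_eq_mul_inv, le_div_iff₀ (Real.exp_pos _), mul_comm]
      exact h
    refine ⟨h2.continuous, fun k => hdec k f (h4 _ (by positivity) 0).1, fun k => ?_⟩
    obtain ⟨A, hA⟩ := hdec k _ (h4 _ (by positivity) 0).2
    exact ⟨A, norm_fourier_le_of_hatF hA⟩
  · intro hf
    exact ⟨hf.integrable, hf.contDiff, hf.hatF.contDiff, fun lam _ α =>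
      ⟨hf.weightedSmooth.exists_exp_mul_norm_multiD_le lam α,
        hf.hatF.weightedSmooth.exists_exp_mul_norm_multiD_le lam α⟩⟩

theorem SOmega.fourierDecays (g : SOmega ω N) : FourierDecays ω (g : EuclideanSpace ℝ (Fin N) → ℂ) :=
  mem_sOmega_iff.1 g.2

theorem sOmegaSeminorm_apply (k : ℕ) (α : Fin N → ℕ) (g : SOmega ω N) :
    sOmegaSeminorm ω N (k, α) g =
      (⨆ x, Real.exp (k * ω ‖x‖) * ‖multiD α (g : EuclideanSpace ℝ (Fin N) → ℂ) x‖) +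
        ⨆ ξ, Real.exp (k * ω ‖ξ‖) * ‖multiD α (hatF g) ξ‖ := rfl

theorem sOmegaSeminorm_le {k : ℕ} {α : Fin N → ℕ} {g : SOmega ω N} {A : ℝ}
    (h1 : ∀ x, ‖multiD α (g : EuclideanSpace ℝ (Fin N) → ℂ) x‖ ≤ A * Real.exp (-(k * ω ‖x‖)))
    (h2 : ∀ x, ‖multiD α (hatF g) x‖ ≤ A * Real.exp (-(k * ω ‖x‖))) :
    sOmegaSeminorm ω N (k, α) g ≤ A + A := by
  have hA0 := nonneg_of_norm_le_mul_exp h1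
  rw [sOmegaSeminorm_apply]
  refine add_le_add (Real.iSup_le (fun x => ?_) hA0) (Real.iSup_le (fun x => ?_) hA0)
  · have := h1 x
    rwa [Real.exp_neg, ← div_eq_mul_inv, le_div_iff₀ (Real.exp_pos _), mul_comm] at this
  · have := h2 x
    rwa [Real.exp_neg, ← div_eq_mul_inv, le_div_iff₀ (Real.exp_pos _), mul_comm] at this

theorem SOmega.norm_apply_le (g : SOmega ω N) (k : ℕ) (x : EuclideanSpace ℝ (Fin N)) :
    ‖g x‖ ≤ sOmegaSeminorm ω N (k, 0) g * Real.exp (-(k * ω ‖x‖)) := by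
  rw [Real.exp_neg, ← div_eq_mul_inv, le_div_iff₀ (Real.exp_pos _), mul_comm, sOmegaSeminorm_apply]
  have h1 := le_ciSup (bddAbove_range_of_exists (g.exists_bound k 0)) x
  have h2 : 0 ≤ ⨆ ξ, Real.exp (k * ω ‖ξ‖) * ‖multiD 0 (_root_.hatF g) ξ‖ :=
    Real.iSup_nonneg fun _ => by positivity
  simp only [multiD_zero_index] at h1 h2 ⊢
  linarith

theorem SOmega.norm_hatF_le (g : SOmega ω N) (k : ℕ) (x : EuclideanSpace ℝ (Fin N)) :
    ‖_root_.hatF g x‖ ≤ sOmegaSeminorm ω N (k, 0) g * Real.exp (-(k * ω ‖x‖)) := by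
  rw [Real.exp_neg, ← div_eq_mul_inv, le_div_iff₀ (Real.exp_pos _), mul_comm, sOmegaSeminorm_apply]
  have h1 := le_ciSup (bddAbove_range_of_exists (g.exists_bound_hat k 0)) x
  have h2 : 0 ≤ ⨆ ξ, Real.exp (k * ω ‖ξ‖) *
      ‖multiD 0 (g : EuclideanSpace ℝ (Fin N) → ℂ) ξ‖ :=
    Real.iSup_nonneg fun _ => by positivity
  simp only [multiD_zero_index] at h1 h2 ⊢
  linarith

theorem SOmega.norm_fourier_le (g : SOmega ω N) (k : ℕ) (x : EuclideanSpace ℝ (Fin N)) :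
    ‖𝓕 (g : EuclideanSpace ℝ (Fin N) → ℂ) x‖ ≤
      sOmegaSeminorm ω N (k, 0) g * Real.exp (-(k * ω ‖x‖)) :=
  norm_fourier_le_of_hatF (g.norm_hatF_le k) x

/-- Weighted derivatives are controlled by the seminorms of order zero. -/
theorem exists_youngWeight_mul_le_sOmegaSeminorm (ω : NQWeight) (N : ℕ) (m : ℕ+) (l : ℕ) :
    ∃ k : ℕ, ∃ C : ℝ, 0 < C ∧ ∀ (g : SOmega ω N) n x,
      youngWeight ω m n * ‖iteratedFDeriv ℝ n (g : EuclideanSpace ℝ (Fin N) → ℂ) x‖ ≤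
        C * sOmegaSeminorm ω N (k, 0) g * Real.exp (-(l * ω ‖x‖)) := by
  obtain ⟨k, C, hC, h⟩ := exists_youngWeight_mul_iteratedFDeriv_le ω N m l
  exact ⟨k, C, hC, fun g => h g _ g.fourierDecays (g.norm_apply_le k) (g.norm_fourier_le k)⟩

/-- The seminorms of order zero generate the topology of `S_ω`. -/
theorem exists_sOmegaSeminorm_le_zero (ω : NQWeight) (N k : ℕ) (α : Fin N → ℕ) :
    ∃ k' : ℕ, ∃ C : ℝ, 0 < C ∧ ∀ g : SOmega ω N,
      sOmegaSeminorm ω N (k, α) g ≤ C * sOmegaSeminorm ω N (k', 0) g := by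
  obtain ⟨m, hm⟩ := exists_youngWeight_pos ω (∑ i, α i)
  obtain ⟨k', C, hC, h⟩ := exists_youngWeight_mul_iteratedFDeriv_le ω N m k
  set w := youngWeight ω m (∑ i, α i)
  -- The Jacobian from `fourier_hatF`. As $P\ge1$, the constant $Pq$ bounds $g$, $\hat g$ and both
  -- of their transforms.
  set P : ℝ := (2 * Real.pi) ^ N
  have hP : 1 ≤ P := one_le_pow₀ (by nlinarith [Real.pi_gt_three])
  refine ⟨k', C * P / w + C * P / w, by positivity, fun g => ?_⟩
  set q := sOmegaSeminorm ω N (k', 0) g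
  have hq : 0 ≤ q := apply_nonneg _ _
  have hg := g.fourierDecays
  have h1 := h g (P * q) hg
    (fun x => (g.norm_apply_le k' x).trans (by gcongr; exact le_mul_of_one_le_left hq hP))
    (fun x => (g.norm_fourier_le k' x).trans (by gcongr; exact le_mul_of_one_le_left hq hP))
  have h2 := h (hatF g) (P * q) hg.hatF
    (fun x => (g.norm_hatF_le k' x).trans (by gcongr; exact le_mul_of_one_le_left hq hP))
    (fun x => hg.norm_fourier_hatF_le (g.norm_apply_le k') x)
  rw [add_mul]
  refine sOmegaSeminorm_le (fun x => (norm_multiD_le α hg.contDiff x).trans ?_)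
    (fun x => (norm_multiD_le α hg.hatF.contDiff x).trans ?_)
  · have := h1 (∑ i, α i) x
    rw [mul_comm, ← le_div_iff₀ hm] at this
    exact this.trans (le_of_eq (by ring))
  · have := h2 (∑ i, α i) x
    rw [mul_comm, ← le_div_iff₀ hm] at this
    exact this.trans (le_of_eq (by ring))

/-- The seminorms of `S_ω` are controlled by weighted derivatives. -/
theorem exists_sOmegaSeminorm_le (ω : NQWeight) (N k : ℕ) (α : Fin N → ℕ) :
    ∃ m : ℕ+, ∃ l : ℕ, ∃ C : ℝ, 0 < C ∧ ∀ (g : SOmega ω N) (A : ℝ),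
      (∀ n x, youngWeight ω m n * ‖iteratedFDeriv ℝ n (g : EuclideanSpace ℝ (Fin N) → ℂ) x‖ ≤
        A * Real.exp (-(l * ω ‖x‖))) →
      sOmegaSeminorm ω N (k, α) g ≤ C * A := by
  obtain ⟨k₁, C₁, hC₁, h₁⟩ := exists_sOmegaSeminorm_le_zero ω N k α
  obtain ⟨k₂, C₂, hC₂, h₂⟩ := exists_norm_hatF_le ω N k₁
  -- Rate $k_1$ is needed for $g$ itself, and rate $k_2$ for the transform before it is rescaled to
  -- $\hat g$.
  obtain ⟨m, l, C, hC, h⟩ := exists_norm_fourier_le ω N (max k₁ k₂)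
  refine ⟨m, l, C₁ * ((1 + C₂) * C + (1 + C₂) * C), by positivity, fun g A hA => ?_⟩
  obtain ⟨h3, h4⟩ := h g A g.fourierDecays.weightedSmooth hA
  have hCA := nonneg_of_norm_le_mul_exp h3
  have h5 := h₂ g (C * A) fun ξ => (h4 ξ).trans
    (mul_le_mul_of_nonneg_left (exp_neg_mul_anti ω (le_max_right _ _) ξ) hCA)
  have h6 := sOmegaSeminorm_le (k := k₁) (α := 0) (g := g) (A := (1 + C₂) * (C * A))
    (fun x => by
      rw [multiD_zero_index]
      refine (h3 x).trans ((mul_le_mul_of_nonneg_left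
        (exp_neg_mul_anti ω (le_max_left _ _) x) hCA).trans ?_)
      refine mul_le_mul_of_nonneg_right ?_ (Real.exp_nonneg _)
      nlinarith)
    (fun x => by
      rw [multiD_zero_index]
      refine (h5 x).trans ?_
      gcongr
      linarith)
  calc _ ≤ C₁ * sOmegaSeminorm ω N (k₁, 0) g := h₁ g
    _ ≤ C₁ * ((1 + C₂) * (C * A) + (1 + C₂) * (C * A)) := by gcongr
    _ = _ := by ring

end SpaceSOmega

/-! ### Multiplication by functions in $\mathcal O_{M,\omega}$ -/

section Multipliers

variable {N : ℕ} {ω : NQWeight} {f : EuclideanSpace ℝ (Fin N) → ℂ}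

/-- Passing from partial to total derivatives of order $j$ costs $N^j$. It is absorbed by a change
of $m$, which is harmless as the condition is imposed for every $m$. -/
theorem mem_omOmega_iff : f ∈ OMOmegaSubmodule ω N ↔ ContDiff ℝ (⊤ : ℕ∞) f ∧
    ∀ m : ℕ+, ∃ n : ℕ, ∃ C : ℝ, ∀ j x,
      youngWeight ω m j * ‖iteratedFDeriv ℝ j f x‖ ≤ C * Real.exp (n * ω ‖x‖) := by
  refine and_congr_right fun hf => ⟨fun h m => ?_, fun h m => ?_⟩
  · obtain ⟨m', D, hD, h'⟩ := exists_youngWeight_mul_iteratedFDeriv_le_of_multiD ω N m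
    obtain ⟨n, C, hC⟩ := h m'
    refine ⟨n, D * C, fun j x => ?_⟩
    rw [mul_assoc]
    refine h' f x _ hf (fun α => ?_) j
    have := hC α x
    rwa [Real.exp_neg, mul_right_comm, ← div_eq_mul_inv, div_le_iff₀ (Real.exp_pos _),
      mul_comm ‖_‖] at this
  · obtain ⟨n, C, hC⟩ := h m
    refine ⟨n, C, fun α x => ?_⟩
    rw [Real.exp_neg, mul_right_comm, ← div_eq_mul_inv, div_le_iff₀ (Real.exp_pos _), mul_comm ‖_‖]
    exact (mul_le_mul_of_nonneg_left (norm_multiD_le α hf x) (youngWeight_nonneg _ _ _)).trans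
      (hC _ x)

/-- Weighted estimates of products. -/
theorem exists_youngWeight_mul_iteratedFDeriv_mul_le_of_growth
    (hf : ContDiff ℝ (⊤ : ℕ∞) f)
    (h : ∀ m : ℕ+, ∃ n : ℕ, ∃ C : ℝ, ∀ j x,
      youngWeight ω m j * ‖iteratedFDeriv ℝ j f x‖ ≤ C * Real.exp (n * ω ‖x‖)) (m : ℕ+) (l : ℕ) :
    ∃ m' : ℕ+, ∃ l' : ℕ, ∃ C : ℝ, 0 < C ∧ ∀ (g : EuclideanSpace ℝ (Fin N) → ℂ) (A : ℝ),
      ContDiff ℝ (⊤ : ℕ∞) g →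
      (∀ j x, youngWeight ω m' j * ‖iteratedFDeriv ℝ j g x‖ ≤ A * Real.exp (-(l' * ω ‖x‖))) →
      ∀ j x, youngWeight ω m j * ‖iteratedFDeriv ℝ j (f * g) x‖ ≤
        C * A * Real.exp (-(l * ω ‖x‖)) := by
  obtain ⟨m', D, hD, h'⟩ := exists_youngWeight_mul_iteratedFDeriv_mul_le
    (V := EuclideanSpace ℝ (Fin N)) ω m
  obtain ⟨n, C, hC⟩ := h m'
  refine ⟨m', n + l, D * (|C| + 1), by positivity, fun g A hg hA j x => ?_⟩
  have hA0 : 0 ≤ A := nonneg_of_mul_nonneg_left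
    ((mul_nonneg (youngWeight_nonneg ω m' 0) (norm_nonneg _)).trans (hA 0 0)) (Real.exp_pos _)
  calc _ ≤ D * ((C * Real.exp (n * ω ‖x‖)) * (A * Real.exp (-((n + l : ℕ) * ω ‖x‖)))) :=
        h' f g x _ _ hf hg (fun j => hC j x) (fun j => hA j x) j
    _ = D * C * A * (Real.exp (n * ω ‖x‖) * Real.exp (-((n + l : ℕ) * ω ‖x‖))) := by ring
    _ = D * C * A * Real.exp (-(l * ω ‖x‖)) := by
        rw [← Real.exp_add]
        congr 2
        push_cast
        ring
    _ ≤ _ := by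
        gcongr
        linarith [le_abs_self C]

theorem WeightedSmooth.mul_of_mem_omOmega (hf : f ∈ OMOmegaSubmodule ω N)
    {g : EuclideanSpace ℝ (Fin N) → ℂ} (hg : WeightedSmooth ω g) : WeightedSmooth ω (f * g) := by
  obtain ⟨hf1, hf2⟩ := mem_omOmega_iff.1 hf
  refine ⟨hf1.mul hg.contDiff, fun m l => ?_⟩
  obtain ⟨m', l', C, hC, h⟩ := exists_youngWeight_mul_iteratedFDeriv_mul_le_of_growth hf1 hf2 m l
  obtain ⟨A, hA⟩ := hg.bound m' l'
  exact ⟨C * A, h g A hg.contDiff hA⟩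

theorem mul_mem_sOmega (hf : f ∈ OMOmegaSubmodule ω N) {g : EuclideanSpace ℝ (Fin N) → ℂ}
    (hg : g ∈ SOmegaSubmodule ω N) : f * g ∈ SOmegaSubmodule ω N :=
  mem_sOmega_iff.2
    ((mem_sOmega_iff.1 hg).weightedSmooth.mul_of_mem_omOmega hf).fourierDecays

/-- The operator of multiplication by `f`, as a linear map. -/
def mulLinear (f : OMOmega ω N) : SOmega ω N →ₗ[ℂ] SOmega ω N where
  toFun g := ⟨(f : EuclideanSpace ℝ (Fin N) → ℂ) * g, mul_mem_sOmega f.2 g.2⟩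
  map_add' g h := Subtype.ext (mul_add (f : EuclideanSpace ℝ (Fin N) → ℂ) g h)
  map_smul' c g := Subtype.ext
    (mul_smul_comm c (f : EuclideanSpace ℝ (Fin N) → ℂ) (g : EuclideanSpace ℝ (Fin N) → ℂ))

/-- A seminorm of $fg$ is controlled by weighted derivatives of $fg$, these by weighted derivatives
of $g$, and these by a seminorm of $g$ of order zero. -/
theorem continuous_mulLinear (f : OMOmega ω N) : Continuous (mulLinear f) := by
  refine WithSeminorms.continuous_of_isBounded (sOmega_withSeminorms ω N) (sOmega_withSeminorms ω N) _ ?_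
  rintro ⟨k, α⟩
  obtain ⟨hf1, hf2⟩ := mem_omOmega_iff.1 f.2
  obtain ⟨m, l, C₁, hC₁, h₁⟩ := exists_sOmegaSeminorm_le ω N k α
  obtain ⟨m', l', C₂, hC₂, h₂⟩ := exists_youngWeight_mul_iteratedFDeriv_mul_le_of_growth hf1 hf2 m l
  obtain ⟨k', C₃, hC₃, h₃⟩ := exists_youngWeight_mul_le_sOmegaSeminorm ω N m' l'
  refine ⟨{(k', 0)}, ⟨C₁ * (C₂ * C₃), by positivity⟩, fun g => ?_⟩
  rw [Finset.sup_singleton]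
  have := h₁ (mulLinear f g) (C₂ * (C₃ * sOmegaSeminorm ω N (k', 0) g))
    (h₂ g _ g.2.2.1 (h₃ g))
  calc _ ≤ C₁ * (C₂ * (C₃ * sOmegaSeminorm ω N (k', 0) g)) := this
    _ = (C₁ * (C₂ * C₃)) * sOmegaSeminorm ω N (k', 0) g := by ring

/-- The operator of multiplication by `f`, as a continuous linear map depending linearly on `f`. -/
def mulOperator (ω : NQWeight) (N : ℕ) : OMOmega ω N →ₗ[ℂ] (SOmega ω N →L[ℂ] SOmega ω N) where
  toFun f := ⟨mulLinear f, continuous_mulLinear f⟩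
  map_add' f₁ f₂ := ContinuousLinearMap.ext fun g => Subtype.ext
    (add_mul (f₁ : EuclideanSpace ℝ (Fin N) → ℂ) f₂ g)
  map_smul' c f := ContinuousLinearMap.ext fun g => Subtype.ext
    (smul_mul_assoc c (f : EuclideanSpace ℝ (Fin N) → ℂ) (g : EuclideanSpace ℝ (Fin N) → ℂ))

open scoped FourierTransform in
theorem norm_fourier_expSq (ξ : EuclideanSpace ℝ (Fin N)) :
    ‖𝓕 (expSq (-Real.pi) : EuclideanSpace ℝ (Fin N) → ℂ) ξ‖ = ‖expSq (-Real.pi) ξ‖ := by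
  have hpi : 0 < (Real.pi : ℂ).re := by simpa using Real.pi_pos
  have h0 : (Real.pi : ℂ) ≠ 0 := by exact_mod_cast Real.pi_ne_zero
  have he : (expSq (-Real.pi) : EuclideanSpace ℝ (Fin N) → ℂ) =
      fun v => Complex.exp (-(Real.pi : ℂ) * ‖v‖ ^ 2) := by
    funext v
    simp [expSq]
  conv_lhs => rw [he, fourier_gaussian_innerProductSpace hpi, div_self h0, Complex.one_cpow, one_mul]
  rw [expSq]
  congr 2
  push_cast
  field_simp

theorem fourierDecays_expSq (ω : NQWeight) (N : ℕ) :
    FourierDecays ω (expSq (-Real.pi) : EuclideanSpace ℝ (Fin N) → ℂ) :=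
  ⟨(contDiff_expSq (n := 0) _).continuous, decays_expSq ω, fun k => by
    simp_rw [norm_fourier_expSq]; exact decays_expSq ω k⟩

/-- A Gaussian belongs to $\mathcal S_\omega$ and has no zeros. -/
theorem mulOperator_injective (ω : NQWeight) (N : ℕ) : Function.Injective (mulOperator ω N) := by
  rw [injective_iff_map_eq_zero]
  intro f hf
  let g : SOmega ω N := ⟨expSq (-Real.pi), mem_sOmega_iff.2 (fourierDecays_expSq ω N)⟩
  refine Subtype.ext (funext fun x => ?_)
  have h1 : (f : EuclideanSpace ℝ (Fin N) → ℂ) x * expSq (-Real.pi) x = 0 := by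
    have h2 := congrArg (fun T : SOmega ω N →L[ℂ] SOmega ω N =>
      (T g : EuclideanSpace ℝ (Fin N) → ℂ) x) hf
    exact h2
  exact (mul_eq_zero.1 h1).resolve_right (Complex.exp_ne_zero _)

end Multipliers

/-! ### Dominating envelopes and uniform estimates on bounded sets -/

section Envelope

open scoped FourierTransform Convolution

variable {N : ℕ} {ω : NQWeight}

/-- The infimum of the functions `C k * exp (-k ω)`. -/
noncomputable def decayInf (ω : NQWeight) (C : ℕ → ℝ) (r : ℝ) : ℝ :=
  ⨅ k : ℕ, C k * Real.exp (-(k * ω r))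

theorem decayInf_bddBelow (ω : NQWeight) {C : ℕ → ℝ} (hC : ∀ k, 0 ≤ C k) (r : ℝ) :
    BddBelow (range fun k : ℕ => C k * Real.exp (-(k * ω r))) :=
  ⟨0, by rintro _ ⟨k, rfl⟩; exact mul_nonneg (hC k) (Real.exp_nonneg _)⟩

theorem decayInf_nonneg (ω : NQWeight) {C : ℕ → ℝ} (hC : ∀ k, 0 ≤ C k) (r : ℝ) :
    0 ≤ decayInf ω C r :=
  Real.iInf_nonneg fun k => mul_nonneg (hC k) (Real.exp_nonneg _)

theorem decayInf_le (ω : NQWeight) {C : ℕ → ℝ} (hC : ∀ k, 0 ≤ C k) (r : ℝ) (k : ℕ) :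
    decayInf ω C r ≤ C k * Real.exp (-(k * ω r)) :=
  ciInf_le (decayInf_bddBelow ω hC r) k

theorem decayInf_anti (ω : NQWeight) {C : ℕ → ℝ} (hC : ∀ k, 0 ≤ C k) {r s : ℝ} (hr : 0 ≤ r)
    (h : r ≤ s) : decayInf ω C s ≤ decayInf ω C r := by
  refine ciInf_mono (decayInf_bddBelow ω hC s) fun k => ?_
  have := ω.mono hr h
  have := hC k
  gcongr

/-- Every function which decays faster than all `exp (-k ω)` is dominated by an element of
`S_ω`. -/
theorem exists_sOmega_dominating (ω : NQWeight) (N : ℕ) {C : ℕ → ℝ} (hC : ∀ k, 0 ≤ C k) :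
    ∃ (g : SOmega ω N) (c : ℝ), 0 < c ∧ ∀ (a : ℝ) (x : EuclideanSpace ℝ (Fin N)),
      (∀ k : ℕ, a ≤ C k * Real.exp (-(k * ω ‖x‖))) → a ≤ c * ‖g x‖ := by
  -- The shift by one ensures that on the unit ball about $x$ the envelope $V$ is at least `decayInf
  -- ω C ‖x‖`, so that averaging near $x$ does not lose the lower bound.
  set V : ℝ → ℝ := fun r => decayInf ω C (max (r - 1) 0) with hV
  have hV0 : ∀ r, 0 ≤ V r := fun r => decayInf_nonneg ω hC _
  have hVanti : Antitone V := fun r s h =>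
    decayInf_anti ω hC (le_max_right _ _) (max_le_max_right 0 (by linarith))
  set v : EuclideanSpace ℝ (Fin N) → ℂ := fun y => (V ‖y‖ : ℂ) with hv
  have hvn : ∀ y, ‖v y‖ = V ‖y‖ := fun y => by
    rw [hv, Complex.norm_real, Real.norm_of_nonneg (hV0 _)]
  have hvm : AEStronglyMeasurable v :=
    (Complex.measurable_ofReal.comp (hVanti.measurable.comp measurable_norm)).aestronglyMeasurable
  have hvd : Decays ω v := by
    intro j
    obtain ⟨K, hK, h⟩ := ω.exists_add_le
    obtain ⟨k, hk⟩ := exists_nat_ge (j * K)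
    refine ⟨C k * Real.exp (k * (1 + ω 1)), fun y => ?_⟩
    rw [hvn]
    refine (decayInf_le ω hC _ k).trans ?_
    rw [mul_assoc, ← Real.exp_add]
    refine mul_le_mul_of_nonneg_left (Real.exp_le_exp.2 ?_) (hC k)
    set s := max (‖y‖ - 1) 0
    have hs : 0 ≤ s := le_max_right _ _
    have h1 : ω ‖y‖ ≤ K * (1 + ω s + ω 1) := by
      refine (ω.mono (norm_nonneg y) ?_).trans (h s 1 hs zero_le_one)
      have := le_max_left (‖y‖ - 1) 0
      linarith
    have h2 := ω.nonneg hs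
    have h3 := ω.nonneg zero_le_one
    have h4 : (j : ℝ) * ω ‖y‖ ≤ k * (1 + ω s + ω 1) := by
      calc (j : ℝ) * ω ‖y‖ ≤ j * (K * (1 + ω s + ω 1)) := by gcongr
        _ = (j * K) * (1 + ω s + ω 1) := by ring
        _ ≤ _ := by gcongr
    linarith
  have hvi : Integrable v := hvd.integrable hvm
  set γ : EuclideanSpace ℝ (Fin N) → ℂ := expSq (-Real.pi) with hγ
  have hγd := fourierDecays_expSq ω N
  have hγ1 : ∀ y, ‖γ y‖ ≤ 1 := fun y => by
    rw [hγ, norm_expSq, Real.exp_le_one_iff]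
    nlinarith [Real.pi_pos, sq_nonneg ‖y‖]
  -- The envelope $v$ decays but need not be continuous. Convolution with a Gaussian keeps the
  -- decay, and $\hat u=\hat v\hat\gamma$ decays because $\hat v$ is bounded.
  set u : EuclideanSpace ℝ (Fin N) → ℂ := v ⋆[ContinuousLinearMap.mul ℂ ℂ, volume] γ with hu
  have hueq : ∀ x, u x = ∫ y, v (y + x) * γ y := by
    intro x
    rw [hu, convolution_mul, ← integral_add_right_eq_self _ x]
    congr 1
    funext y
    rw [show x - (y + x) = -y by abel, hγ, expSq, expSq, norm_neg]
  have hud : FourierDecays ω u := by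
    refine ⟨?_, fun j => ?_, fun j => ?_⟩
    · refine BddAbove.continuous_convolution_right_of_integrable _ ⟨1, ?_⟩ hvi hγd.continuous
      rintro _ ⟨y, rfl⟩
      exact hγ1 y
    · obtain ⟨k, D, hD, h⟩ := exists_integral_mul_gaussian_le ω N j
      obtain ⟨A, hA⟩ := hvd k
      refine ⟨D * A, fun x => ?_⟩
      rw [hueq]
      refine (norm_integral_le_integral_norm _).trans ?_
      simp_rw [norm_mul, hγ, norm_expSq]
      exact h v A hA x
    · obtain ⟨A, hA⟩ := hγd.decays_fourier j
      refine ⟨(∫ y, ‖v y‖) * A, fun ξ => ?_⟩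
      rw [hu, Real.fourier_mul_convolution_eq hvi hγd.integrable, norm_mul, mul_assoc]
      exact mul_le_mul (VectorFourier.norm_fourierIntegral_le_integral_norm _ _ _ _ _) (hA ξ)
        (norm_nonneg _) (integral_nonneg fun _ => norm_nonneg _)
  -- On the unit ball the Gaussian is at least $e^{-\pi}$, so it has mass at least $e^{-\pi}\beta$
  -- there; the reciprocal is the constant $c$.
  set β : ℝ := volume.real (Metric.ball (0 : EuclideanSpace ℝ (Fin N)) 1) with hβ
  have hβ0 : 0 < β := ENNReal.toReal_pos (Metric.measure_ball_pos volume 0 one_pos).ne'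
    measure_ball_lt_top.ne
  refine ⟨⟨u, mem_sOmega_iff.2 hud⟩, (Real.exp (-Real.pi) * β)⁻¹, by positivity, fun a x ha => ?_⟩
  change a ≤ (Real.exp (-Real.pi) * β)⁻¹ * ‖u x‖
  rw [← div_eq_inv_mul, le_div_iff₀ (by positivity)]
  have hux : u x = ((∫ y, V ‖y + x‖ * Real.exp (-Real.pi * ‖y‖ ^ 2) : ℝ) : ℂ) := by
    rw [hueq, ← integral_complex_ofReal]
    congr 1
    funext y
    rw [hv, hγ, expSq]
    push_cast
    rfl
  have hint : Integrable fun y : EuclideanSpace ℝ (Fin N) =>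
      V ‖y + x‖ * Real.exp (-Real.pi * ‖y‖ ^ 2) := by
    have h1 : Integrable fun y => v (y + x) * γ y :=
      (hvi.comp_add_right x).mul_bdd hγd.continuous.aestronglyMeasurable
        (Filter.Eventually.of_forall hγ1)
    refine h1.norm.congr (Filter.Eventually.of_forall fun y => ?_)
    simp only [norm_mul, hvn, hγ, norm_expSq]
  have hau : a ≤ decayInf ω C ‖x‖ := le_ciInf ha
  calc a * (Real.exp (-Real.pi) * β) ≤ decayInf ω C ‖x‖ * (Real.exp (-Real.pi) * β) := by gcongr
    _ = ∫ _y in Metric.ball (0 : EuclideanSpace ℝ (Fin N)) 1,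
        decayInf ω C ‖x‖ * Real.exp (-Real.pi) := by
      rw [setIntegral_const, smul_eq_mul]
      ring
    _ ≤ ∫ y in Metric.ball (0 : EuclideanSpace ℝ (Fin N)) 1,
        V ‖y + x‖ * Real.exp (-Real.pi * ‖y‖ ^ 2) := by
      refine setIntegral_mono_on (integrableOn_const measure_ball_lt_top.ne) hint.integrableOn
        measurableSet_ball fun y hy => ?_
      rw [mem_ball_zero_iff] at hy
      refine mul_le_mul ?_ ?_ (Real.exp_nonneg _) (hV0 _)
      · refine decayInf_anti ω hC (le_max_right _ _) (max_le ?_ (norm_nonneg _))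
        linarith [norm_add_le y x]
      · apply Real.exp_le_exp.2
        have : ‖y‖ ^ 2 ≤ 1 := pow_le_one₀ (norm_nonneg y) hy.le
        nlinarith [Real.pi_pos]
    _ ≤ ∫ y, V ‖y + x‖ * Real.exp (-Real.pi * ‖y‖ ^ 2) :=
      setIntegral_le_integral hint
        (Filter.Eventually.of_forall fun y => mul_nonneg (hV0 _) (Real.exp_nonneg _))
    _ = ‖u x‖ := by
      rw [hux, Complex.norm_real, Real.norm_of_nonneg
        (integral_nonneg fun y => mul_nonneg (hV0 _) (Real.exp_nonneg _))]

theorem omSeminorm_apply (m : ℕ+) (g : SOmega ω N) (f : OMOmega ω N) :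
    omSeminorm ω N (m, g) f = ⨆ p : (Fin N → ℕ) × EuclideanSpace ℝ (Fin N),
      ‖g p.2‖ * youngWeight ω m (∑ i, p.1 i) *
        ‖multiD p.1 (f : EuclideanSpace ℝ (Fin N) → ℂ) p.2‖ := rfl

/-- Uniform estimates of `f * g` for `g` in a bounded set by one seminorm of `τ`. -/
theorem exists_sOmegaSeminorm_mul_le_omSeminorm (ω : NQWeight) (N k : ℕ) (α : Fin N → ℕ)
    {S : Set (SOmega ω N)} (hS : Bornology.IsVonNBounded ℂ S) :
    ∃ (q : ℕ+ × SOmega ω N) (C : ℝ), 0 < C ∧ ∀ (f : OMOmega ω N), ∀ g ∈ S,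
      sOmegaSeminorm ω N (k, α) (mulOperator ω N f g) ≤ C * omSeminorm ω N q f := by
  obtain ⟨m, l, C₁, hC₁, h₁⟩ := exists_sOmegaSeminorm_le ω N k α
  obtain ⟨m', D, hD, h₂⟩ := exists_youngWeight_mul_iteratedFDeriv_mul_le
    (V := EuclideanSpace ℝ (Fin N)) ω m
  obtain ⟨m'', D', hD', h₃⟩ := exists_youngWeight_mul_iteratedFDeriv_le_of_multiD ω N m'
  have h₄ : ∀ j : ℕ, ∃ C : ℝ, 0 ≤ C ∧ ∀ g ∈ S, ∀ n x,
      youngWeight ω m' n * ‖iteratedFDeriv ℝ n (g : EuclideanSpace ℝ (Fin N) → ℂ) x‖ ≤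
        C * Real.exp (-((l + j : ℕ) * ω ‖x‖)) := by
    intro j
    obtain ⟨k', C, hC, h⟩ := exists_youngWeight_mul_le_sOmegaSeminorm ω N m' (l + j)
    obtain ⟨r, hr, hr'⟩ :=
      (sOmega_withSeminorms ω N).isVonNBounded_iff_seminorm_bounded.1 hS (k', 0)
    refine ⟨C * r, by positivity, fun g hg n x => (h g n x).trans ?_⟩
    have := (hr' g hg).le
    gcongr
  choose A hA0 hA using h₄
  -- The bounds for all rates $j$ hold uniformly on $S$, hence one $g_0$ dominates the weighted
  -- derivatives of every $g\in S$. It depends on $S$ and on the seminorm to be estimated, but not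
  -- on $f$.
  obtain ⟨g₀, c, hc, hg₀⟩ := exists_sOmega_dominating ω N hA0
  refine ⟨(m'', g₀), C₁ * (D * D' * c), by positivity, fun f g hg => ?_⟩
  set q := omSeminorm ω N (m'', g₀) f with hq
  have hq0 : 0 ≤ q := apply_nonneg _ _
  have hgb : ∀ n x, youngWeight ω m' n *
      ‖iteratedFDeriv ℝ n (g : EuclideanSpace ℝ (Fin N) → ℂ) x‖ ≤
        c * ‖g₀ x‖ * Real.exp (-(l * ω ‖x‖)) := by
    intro n x
    rw [Real.exp_neg, ← div_eq_mul_inv, le_div_iff₀ (Real.exp_pos _)]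
    refine hg₀ _ x fun j => ?_
    calc _ ≤ A j * Real.exp (-((l + j : ℕ) * ω ‖x‖)) * Real.exp (l * ω ‖x‖) := by
          exact mul_le_mul_of_nonneg_right (hA j g hg n x) (Real.exp_nonneg _)
      _ = A j * (Real.exp (-((l + j : ℕ) * ω ‖x‖)) * Real.exp (l * ω ‖x‖)) := by ring
      _ = _ := by
        rw [← Real.exp_add]
        congr 2
        push_cast
        ring
  obtain ⟨hf1, hf2⟩ := mem_omOmega_iff.1 f.2
  have key : ∀ n x, youngWeight ω m n * ‖iteratedFDeriv ℝ n
      ((f : EuclideanSpace ℝ (Fin N) → ℂ) * (g : EuclideanSpace ℝ (Fin N) → ℂ)) x‖ ≤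
        D * D' * c * q * Real.exp (-(l * ω ‖x‖)) := by
    intro n x
    -- Where $g_0(x)=0$, the seminorm of $f$ gives no information at $x$. But there the weighted
    -- derivatives of $g$ vanish, and the growth bound of $f$, with whatever constants, makes those
    -- of $fg$ vanish. Elsewhere $|g_0(x)|$ cancels.
    rcases (norm_nonneg (g₀ x)).eq_or_lt with h0 | h0
    · obtain ⟨p, B, hB⟩ := hf2 m'
      have := h₂ _ _ x _ _ hf1 g.2.2.1 (fun j => hB j x) (fun j => hgb j x) n
      rw [← h0, mul_zero, zero_mul, mul_zero, mul_zero] at this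
      exact this.trans (by positivity)
    · have hfb := h₃ f x (q / ‖g₀ x‖) hf1 fun α => by
        rw [le_div_iff₀ h0, mul_comm, ← mul_assoc, hq, omSeminorm_apply]
        exact le_ciSup (bddAbove_range_of_exists (f.bound m'' g₀)) (α, x)
      refine (h₂ _ _ x _ _ hf1 g.2.2.1 hfb (fun j => hgb j x) n).trans (le_of_eq ?_)
      field_simp
  refine (h₁ (mulOperator ω N f g) _ key).trans (le_of_eq ?_)
  ring

end Envelope

/-! ### Uniform boundedness by means of series of Gaussians -/

section UniformBoundedness

open scoped FourierTransform BoundedContinuousFunction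

variable {N : ℕ} {ω : NQWeight}

/-- The coefficients `2^{-n} exp (-n ω(xₙ))`. -/
noncomputable def bumpCoeff (ω : NQWeight) (X : ℕ → EuclideanSpace ℝ (Fin N)) (n : ℕ) : ℝ :=
  (1 / 2) ^ n * Real.exp (-(n * ω ‖X n‖))

/-- The series `∑ bₙ 2^{-n} exp (-n ω(xₙ)) exp (-π |y - xₙ|²)`. -/
noncomputable def bumpSeries (ω : NQWeight) (X : ℕ → EuclideanSpace ℝ (Fin N)) (b : ℕ →ᵇ ℂ)
    (y : EuclideanSpace ℝ (Fin N)) : ℂ :=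
  ∑' n, b n * (bumpCoeff ω X n * expSq (-Real.pi) (y - X n))

theorem bumpCoeff_nonneg (ω : NQWeight) (X : ℕ → EuclideanSpace ℝ (Fin N)) (n : ℕ) :
    0 ≤ bumpCoeff ω X n := by
  unfold bumpCoeff
  positivity

theorem bumpCoeff_le (ω : NQWeight) (X : ℕ → EuclideanSpace ℝ (Fin N)) (n : ℕ) :
    bumpCoeff ω X n ≤ (1 / 2) ^ n := by
  have := ω.nonneg (norm_nonneg (X n))
  refine mul_le_of_le_one_right (by positivity) (Real.exp_le_one_iff.2 ?_)
  simp only [Left.neg_nonpos_iff]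
  positivity

/-- Decay at rate $k$ of a Gaussian centred at $x_n$ costs $e^{l\omega(x_n)}$ with $l\ge kK$. The
coefficient $e^{-n\omega(x_n)}$ pays for it as soon as $n\ge l$; the finitely many earlier terms
enter the constant $M$. No condition on the points is needed. -/
theorem exists_norm_bumpTerm_le (ω : NQWeight) (X : ℕ → EuclideanSpace ℝ (Fin N)) (k : ℕ) :
    ∃ C : ℝ, 0 ≤ C ∧ ∀ (b : ℕ →ᵇ ℂ) n y, ‖b n * (bumpCoeff ω X n * expSq (-Real.pi) (y - X n))‖ ≤
      (1 / 2) ^ n * (C * ‖b‖ * Real.exp (-(k * ω ‖y‖))) := by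
  obtain ⟨K, hK, h⟩ := ω.exists_add_le
  obtain ⟨l, hl⟩ := exists_nat_ge (k * K)
  obtain ⟨A, hA⟩ := decays_expSq (N := N) ω l
  have hA0 := nonneg_of_norm_le_mul_exp hA
  set M := 1 + ∑ n ∈ Finset.range l, Real.exp (l * ω ‖X n‖) with hM
  have hMs : 0 ≤ ∑ n ∈ Finset.range l, Real.exp (l * ω ‖X n‖) :=
    Finset.sum_nonneg fun _ _ => Real.exp_nonneg _
  have hXM : ∀ n : ℕ, Real.exp (l * ω ‖X n‖) * Real.exp (-(n * ω ‖X n‖)) ≤ M := by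
    intro n
    have h0 := ω.nonneg (norm_nonneg (X n))
    rcases lt_or_ge n l with hn | hn
    · have h1 := Finset.single_le_sum (f := fun n => Real.exp (l * ω ‖X n‖))
        (fun _ _ => Real.exp_nonneg _) (Finset.mem_range.2 hn)
      have h2 : Real.exp (-(n * ω ‖X n‖)) ≤ 1 := by
        rw [Real.exp_le_one_iff]
        simp only [Left.neg_nonpos_iff]
        positivity
      calc _ ≤ Real.exp (l * ω ‖X n‖) * 1 := by gcongr
        _ ≤ M := by rw [mul_one]; linarith
    · rw [← Real.exp_add]
      have h1 : (l : ℝ) * ω ‖X n‖ ≤ n * ω ‖X n‖ := by gcongr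
      have : Real.exp (l * ω ‖X n‖ + -(n * ω ‖X n‖)) ≤ 1 := by
        rw [Real.exp_le_one_iff]; linarith
      linarith
  refine ⟨A * Real.exp l * M, by positivity, fun b n y => ?_⟩
  have h1 : ω ‖y‖ ≤ K * (1 + ω ‖y - X n‖ + ω ‖X n‖) := by
    refine (ω.mono (norm_nonneg y) ?_).trans (h _ _ (norm_nonneg _) (norm_nonneg _))
    calc ‖y‖ = ‖(y - X n) + X n‖ := by congr 1; abel
      _ ≤ _ := norm_add_le _ _
  have h2 : 0 ≤ 1 + ω ‖y - X n‖ + ω ‖X n‖ := by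
    have := ω.nonneg (norm_nonneg (y - X n))
    have := ω.nonneg (norm_nonneg (X n))
    positivity
  have h3 : (k : ℝ) * ω ‖y‖ ≤ l * (1 + ω ‖y - X n‖ + ω ‖X n‖) := by
    calc (k : ℝ) * ω ‖y‖ ≤ k * (K * (1 + ω ‖y - X n‖ + ω ‖X n‖)) := by gcongr
      _ = (k * K) * (1 + ω ‖y - X n‖ + ω ‖X n‖) := by ring
      _ ≤ _ := by gcongr
  have h4 : Real.exp (-(l * ω ‖y - X n‖)) ≤
      Real.exp l * Real.exp (-(k * ω ‖y‖)) * Real.exp (l * ω ‖X n‖) := by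
    rw [← Real.exp_add, ← Real.exp_add]
    apply Real.exp_le_exp.2
    linarith
  rw [norm_mul, norm_mul, Complex.norm_real, Real.norm_of_nonneg (bumpCoeff_nonneg ω X n), bumpCoeff]
  calc ‖b n‖ * ((1 / 2) ^ n * Real.exp (-(n * ω ‖X n‖)) * ‖expSq (-Real.pi) (y - X n)‖)
      ≤ ‖b‖ * ((1 / 2) ^ n * Real.exp (-(n * ω ‖X n‖)) *
        (A * (Real.exp l * Real.exp (-(k * ω ‖y‖)) * Real.exp (l * ω ‖X n‖)))) := by
        gcongr
        · exact b.norm_coe_le_norm n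
        · exact (hA _).trans (mul_le_mul_of_nonneg_left h4 hA0)
    _ = (1 / 2) ^ n * (A * Real.exp l * (Real.exp (l * ω ‖X n‖) * Real.exp (-(n * ω ‖X n‖))) *
        ‖b‖ * Real.exp (-(k * ω ‖y‖))) := by ring
    _ ≤ _ := by gcongr; exact hXM n

theorem summable_bumpTerm (ω : NQWeight) (X : ℕ → EuclideanSpace ℝ (Fin N)) (b : ℕ →ᵇ ℂ)
    (y : EuclideanSpace ℝ (Fin N)) :
    Summable fun n => b n * (bumpCoeff ω X n * expSq (-Real.pi) (y - X n)) := by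
  obtain ⟨C, hC, h⟩ := exists_norm_bumpTerm_le ω X 0
  exact Summable.of_norm_bounded (summable_geometric_two.mul_right _) fun n => h b n y

theorem exists_norm_bumpSeries_le (ω : NQWeight) (X : ℕ → EuclideanSpace ℝ (Fin N)) (k : ℕ) :
    ∃ C : ℝ, 0 ≤ C ∧ ∀ (b : ℕ →ᵇ ℂ) y,
      ‖bumpSeries ω X b y‖ ≤ C * ‖b‖ * Real.exp (-(k * ω ‖y‖)) := by
  obtain ⟨C, hC, h⟩ := exists_norm_bumpTerm_le ω X k
  refine ⟨2 * C, by positivity, fun b y => ?_⟩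
  have := tsum_of_norm_bounded (hasSum_geometric_two.mul_right (C * ‖b‖ * Real.exp (-(k * ω ‖y‖))))
    fun n => h b n y
  exact this.trans (le_of_eq (by ring))

theorem continuous_bumpSeries (ω : NQWeight) (X : ℕ → EuclideanSpace ℝ (Fin N)) (b : ℕ →ᵇ ℂ) :
    Continuous (bumpSeries ω X b) := by
  obtain ⟨C, hC, h⟩ := exists_norm_bumpTerm_le ω X 0
  refine continuous_tsum (u := fun n => (1 / 2) ^ n * (C * ‖b‖)) (fun n => ?_)
    (summable_geometric_two.mul_right _) fun n y => (h b n y).trans (by simp)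
  exact continuous_const.mul (continuous_const.mul
    ((contDiff_expSq (n := 0) _).continuous.comp (continuous_sub_right _)))

/-- Translation only multiplies the transform by a phase, so all terms have the same Gaussian
modulus on the Fourier side, up to coefficients summable like $2^{-n}$. -/
theorem norm_fourier_bumpSeries_le (ω : NQWeight) (X : ℕ → EuclideanSpace ℝ (Fin N))
    (b : ℕ →ᵇ ℂ) (ξ : EuclideanSpace ℝ (Fin N)) :
    ‖𝓕 (bumpSeries ω X b) ξ‖ ≤ 2 * ‖b‖ * ‖expSq (-Real.pi) ξ‖ := by
  set F : ℕ → EuclideanSpace ℝ (Fin N) → ℂ := fun n y =>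
    b n * (bumpCoeff ω X n * expSq (-Real.pi) (y - X n)) with hF
  have hγ := (fourierDecays_expSq ω N).integrable
  have hcoef : ∀ n, ‖b n‖ * bumpCoeff ω X n ≤ (1 / 2) ^ n * ‖b‖ := fun n => by
    rw [mul_comm]
    exact mul_le_mul (bumpCoeff_le ω X n) (b.norm_coe_le_norm n) (norm_nonneg _) (by positivity)
  have hFi : ∀ n, Integrable (F n) := fun n =>
    ((hγ.comp_sub_right (X n)).const_mul _).const_mul _
  have hFn : ∀ n y, ‖F n y‖ = ‖b n‖ * bumpCoeff ω X n * ‖expSq (-Real.pi) (y - X n)‖ :=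
    fun n y => by
      rw [hF, norm_mul, norm_mul, Complex.norm_real, Real.norm_of_nonneg (bumpCoeff_nonneg ω X n),
        mul_assoc]
  have hFs : Summable fun n => ∫ y, ‖F n y‖ := by
    refine Summable.of_nonneg_of_le (fun n => integral_nonneg fun _ => norm_nonneg _) (fun n => ?_)
      (summable_geometric_two.mul_right
        (‖b‖ * ∫ y : EuclideanSpace ℝ (Fin N), ‖expSq (-Real.pi) y‖))
    simp_rw [hFn]
    rw [integral_const_mul, integral_sub_right_eq_self (fun y => ‖expSq (-Real.pi) y‖) (X n),
      ← mul_assoc]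
    exact mul_le_mul_of_nonneg_right (hcoef n) (integral_nonneg fun _ => norm_nonneg _)
  have h1 : 𝓕 (bumpSeries ω X b) ξ = ∑' n, 𝓕 (F n) ξ := by
    simp_rw [Real.fourier_eq]
    rw [integral_tsum_of_summable_integral_norm
      (F := fun n v => Real.fourierChar (-inner ℝ v ξ) • F n v) (fun n =>
      (Real.fourierIntegral_convergent_iff ξ).2 (hFi n)) (by simpa only [Circle.norm_smul] using hFs)]
    congr 1
    funext y
    simp only [Circle.smul_def, smul_eq_mul]
    rw [tsum_mul_left]
    rfl
  have h2 : ∀ n, ‖𝓕 (F n) ξ‖ ≤ (1 / 2) ^ n * (‖b‖ * ‖expSq (-Real.pi) ξ‖) := by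
    intro n
    have h3 : 𝓕 (F n) ξ = (b n * bumpCoeff ω X n) •
        𝓕 (fun y => expSq (-Real.pi) (y + -X n)) ξ := by
      rw [Real.fourier_eq, Real.fourier_eq, ← integral_smul]
      congr 1
      funext y
      rw [hF]
      simp only [Circle.smul_def, smul_eq_mul, sub_eq_add_neg]
      ring
    rw [h3, norm_smul, norm_fourier_comp_add, norm_fourier_expSq, norm_mul, Complex.norm_real,
      Real.norm_of_nonneg (bumpCoeff_nonneg ω X n), ← mul_assoc]
    exact mul_le_mul_of_nonneg_right (hcoef n) (norm_nonneg _)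
  rw [h1]
  exact (tsum_of_norm_bounded (hasSum_geometric_two.mul_right _) h2).trans (le_of_eq (by ring))

theorem fourierDecays_bumpSeries (ω : NQWeight) (X : ℕ → EuclideanSpace ℝ (Fin N)) (b : ℕ →ᵇ ℂ) :
    FourierDecays ω (bumpSeries ω X b) := by
  refine ⟨continuous_bumpSeries ω X b, fun k => ?_, fun k => ?_⟩
  · obtain ⟨C, hC, h⟩ := exists_norm_bumpSeries_le ω X k
    exact ⟨C * ‖b‖, h b⟩
  · obtain ⟨A, hA⟩ := decays_expSq (N := N) ω k
    refine ⟨2 * ‖b‖ * A, fun ξ => (norm_fourier_bumpSeries_le ω X b ξ).trans ?_⟩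
    rw [mul_assoc _ A]
    exact mul_le_mul_of_nonneg_left (hA ξ) (by positivity)

/-- Linearity of the bound in $\|b\|$ is what makes derivatives at a point continuous functionals on
$\ell^\infty$. -/
theorem exists_norm_iteratedFDeriv_bumpSeries_le (ω : NQWeight)
    (X : ℕ → EuclideanSpace ℝ (Fin N)) (n : ℕ) :
    ∃ C : ℝ, ∀ (b : ℕ →ᵇ ℂ) y, ‖iteratedFDeriv ℝ n (bumpSeries ω X b) y‖ ≤ C * ‖b‖ := by
  obtain ⟨m, hm⟩ := exists_youngWeight_pos ω n
  obtain ⟨k, C, hC, h⟩ := exists_youngWeight_mul_iteratedFDeriv_le ω N m 0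
  obtain ⟨A₁, hA₁, h₁⟩ := exists_norm_bumpSeries_le ω X k
  obtain ⟨A₂, hA₂⟩ := decays_expSq (N := N) ω k
  have hA₂0 := nonneg_of_norm_le_mul_exp hA₂
  refine ⟨C * (A₁ + 2 * A₂) / youngWeight ω m n, fun b y => ?_⟩
  rw [div_mul_eq_mul_div, le_div_iff₀ hm, mul_comm]
  refine (h (bumpSeries ω X b) ((A₁ + 2 * A₂) * ‖b‖) (fourierDecays_bumpSeries ω X b)
    (fun x => (h₁ b x).trans ?_)
    (fun ξ => (norm_fourier_bumpSeries_le ω X b ξ).trans ?_) n y).trans (le_of_eq ?_)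
  · gcongr
    linarith
  · calc 2 * ‖b‖ * ‖expSq (-Real.pi) ξ‖ ≤ 2 * ‖b‖ * (A₂ * Real.exp (-(k * ω ‖ξ‖))) := by
          gcongr; exact hA₂ ξ
      _ = (0 + 2 * A₂) * ‖b‖ * Real.exp (-(k * ω ‖ξ‖)) := by ring
      _ ≤ _ := by gcongr
  · simp
    ring

theorem bumpSeries_add (ω : NQWeight) (X : ℕ → EuclideanSpace ℝ (Fin N)) (b c : ℕ →ᵇ ℂ) :
    bumpSeries ω X (b + c) = bumpSeries ω X b + bumpSeries ω X c := by
  funext y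
  simp only [bumpSeries, BoundedContinuousFunction.coe_add, Pi.add_apply, add_mul]
  exact (summable_bumpTerm ω X b y).tsum_add (summable_bumpTerm ω X c y)

theorem bumpSeries_smul (ω : NQWeight) (X : ℕ → EuclideanSpace ℝ (Fin N)) (a : ℂ) (b : ℕ →ᵇ ℂ) :
    bumpSeries ω X (a • b) = a • bumpSeries ω X b := by
  funext y
  simp only [bumpSeries, BoundedContinuousFunction.coe_smul, Pi.smul_apply, smul_eq_mul, mul_assoc]
  exact tsum_mul_left

/-- Derivatives of `f * g` at a point, as functionals of the coefficients of the series `g`. -/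
noncomputable def bumpFunctional (ω : NQWeight) (X : ℕ → EuclideanSpace ℝ (Fin N))
    {f : EuclideanSpace ℝ (Fin N) → ℂ} (hf : ContDiff ℝ (⊤ : ℕ∞) f) (w : ℝ) (n : ℕ)
    (x : EuclideanSpace ℝ (Fin N)) (v : Fin n → EuclideanSpace ℝ (Fin N)) : (ℕ →ᵇ ℂ) →L[ℂ] ℂ :=
  LinearMap.mkContinuousOfExistsBound
    { toFun := fun b => (w : ℂ) * iteratedFDeriv ℝ n (f * bumpSeries ω X b) x v
      map_add' := fun b c => by
        have hs : ∀ b, ContDiffAt ℝ n (f * bumpSeries ω X b) x := fun b =>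
          ((hf.mul (fourierDecays_bumpSeries ω X b).contDiff).of_le
            (by exact_mod_cast le_top)).contDiffAt
        rw [bumpSeries_add, mul_add, iteratedFDeriv_add_apply (hs b) (hs c),
          add_apply, mul_add]
      map_smul' := fun a b => by
        have hs : ContDiffAt ℝ n (f * bumpSeries ω X b) x :=
          ((hf.mul (fourierDecays_bumpSeries ω X b).contDiff).of_le
            (by exact_mod_cast le_top)).contDiffAt
        rw [bumpSeries_smul, mul_smul_comm, iteratedFDeriv_const_smul_apply hs,
          smul_apply, smul_eq_mul, RingHom.id_apply, smul_eq_mul]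
        ring }
    (by
      choose C hC using exists_norm_iteratedFDeriv_bumpSeries_le ω X
      refine ⟨|w| * ((∑ i ∈ Finset.range (n + 1), (n.choose i : ℝ) * ‖iteratedFDeriv ℝ i f x‖ *
        C (n - i)) * ∏ i, ‖v i‖), fun b => ?_⟩
      have hb := (fourierDecays_bumpSeries ω X b).contDiff
      have h1 := norm_iteratedFDeriv_mul_le hf hb x (n := n) (by exact_mod_cast le_top)
      have h2 : ‖iteratedFDeriv ℝ n (f * bumpSeries ω X b) x‖ ≤
          (∑ i ∈ Finset.range (n + 1), (n.choose i : ℝ) * ‖iteratedFDeriv ℝ i f x‖ *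
            C (n - i)) * ‖b‖ := by
        refine h1.trans ?_
        rw [Finset.sum_mul]
        refine Finset.sum_le_sum fun i _ => ?_
        rw [mul_assoc _ (C _)]
        gcongr
        exact hC _ b x
      have h3 := (iteratedFDeriv ℝ n (f * bumpSeries ω X b) x).le_opNorm v
      change ‖(w : ℂ) * iteratedFDeriv ℝ n (f * bumpSeries ω X b) x v‖ ≤ _
      rw [norm_mul, Complex.norm_real, Real.norm_eq_abs]
      calc _ ≤ |w| * (((∑ i ∈ Finset.range (n + 1), (n.choose i : ℝ) *
            ‖iteratedFDeriv ℝ i f x‖ * C (n - i)) * ‖b‖) * ∏ i, ‖v i‖) := by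
            gcongr
            exact h3.trans (by gcongr)
        _ = _ := by ring)

theorem bumpFunctional_apply (ω : NQWeight) (X : ℕ → EuclideanSpace ℝ (Fin N))
    {f : EuclideanSpace ℝ (Fin N) → ℂ} (hf : ContDiff ℝ (⊤ : ℕ∞) f) (w : ℝ) (n : ℕ)
    (x : EuclideanSpace ℝ (Fin N)) (v : Fin n → EuclideanSpace ℝ (Fin N)) (b : ℕ →ᵇ ℂ) :
    bumpFunctional ω X hf w n x v b = w * iteratedFDeriv ℝ n (f * bumpSeries ω X b) x v := rfl

/-- The uniform boundedness principle for families of multipliers. -/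
theorem exists_growth_of_pointwise_bounded (ω : NQWeight)
    {B : Set (EuclideanSpace ℝ (Fin N) → ℂ)} (hB : ∀ f ∈ B, ContDiff ℝ (⊤ : ℕ∞) f)
    (h : ∀ (m : ℕ+), ∀ g ∈ SOmegaSubmodule ω N, ∃ R : ℝ, ∀ f ∈ B, ∀ n x,
      youngWeight ω m n * ‖iteratedFDeriv ℝ n (f * g) x‖ ≤ R) (m : ℕ+) :
    ∃ n : ℕ, ∃ C : ℝ, 0 ≤ C ∧ ∀ f ∈ B, ∀ j x,
      youngWeight ω m j * ‖iteratedFDeriv ℝ j f x‖ ≤ C * Real.exp (n * ω ‖x‖) := by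
  obtain ⟨m', D, hD, hloc⟩ := exists_iteratedFDeriv_le_of_mul_expSq
    (V := EuclideanSpace ℝ (Fin N)) ω (-Real.pi) m
  by_contra! hcon
  -- The constants $4^n$ must still diverge after the loss of $2^n$ from the coefficients of the
  -- series; the growth $e^{n\omega(x_n)}$ cancels the other coefficient.
  have hcon' := fun n : ℕ => hcon n (4 ^ n) (by positivity)
  choose F hF J X hX using hcon'
  -- One scalar functional on $\ell^\infty$ for each order, function of $B$, point and tuple of
  -- directions, so that a single application covers all orders at once. The factor
  -- $(\prod_k\|v_k\|)^{-1}$ normalises the directions; it is zero if some $v_k$ vanishes, which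
  -- does no harm.
  obtain ⟨C, hC⟩ := banach_steinhaus (𝕜 := ℂ) (𝕜₂ := ℂ) (E := ℕ →ᵇ ℂ) (F := ℂ)
    (ι := Σ n : ℕ, B × EuclideanSpace ℝ (Fin N) × (Fin n → EuclideanSpace ℝ (Fin N)))
    (g := fun i => bumpFunctional ω X (hB i.2.1 i.2.1.2)
      (youngWeight ω m' i.1 * (∏ k, ‖i.2.2.2 k‖)⁻¹) i.1 i.2.2.1 i.2.2.2) fun b => by
    obtain ⟨R, hR⟩ := h m' (bumpSeries ω X b) (mem_sOmega_iff.2 (fourierDecays_bumpSeries ω X b))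
    have hR0 : ∀ f ∈ B, 0 ≤ R := fun f hf =>
      (mul_nonneg (youngWeight_nonneg ω m' 0) (norm_nonneg _)).trans (hR f hf 0 0)
    refine ⟨R, fun ⟨n, f, x, v⟩ => ?_⟩
    have h1 := (iteratedFDeriv ℝ n ((f : EuclideanSpace ℝ (Fin N) → ℂ) *
      bumpSeries ω X b) x).le_opNorm v
    have h2 := hR f f.2 n x
    have hP : 0 ≤ ∏ k, ‖v k‖ := Finset.prod_nonneg fun _ _ => norm_nonneg _
    have hW := youngWeight_nonneg ω m' n
    rw [bumpFunctional_apply, norm_mul, Complex.norm_real, Real.norm_of_nonneg (by positivity)]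
    calc _ ≤ youngWeight ω m' n * (∏ k, ‖v k‖)⁻¹ * (‖iteratedFDeriv ℝ n
          ((f : EuclideanSpace ℝ (Fin N) → ℂ) * bumpSeries ω X b) x‖ * ∏ k, ‖v k‖) := by gcongr
      _ = (youngWeight ω m' n * ‖iteratedFDeriv ℝ n
          ((f : EuclideanSpace ℝ (Fin N) → ℂ) * bumpSeries ω X b) x‖) *
            ((∏ k, ‖v k‖)⁻¹ * ∏ k, ‖v k‖) := by ring
      _ ≤ R * 1 := mul_le_mul h2 inv_mul_le_one (by positivity) (hR0 f f.2)
      _ = R := mul_one R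
  have hbound : ∀ (f : B) n x (b : ℕ →ᵇ ℂ), ‖b‖ ≤ 1 → youngWeight ω m' n *
      ‖iteratedFDeriv ℝ n ((f : EuclideanSpace ℝ (Fin N) → ℂ) * bumpSeries ω X b) x‖ ≤ C := by
    intro f n x b hb
    have hC0 : 0 ≤ C := (norm_nonneg _).trans (hC ⟨n, f, x, fun _ => 0⟩)
    have hW := youngWeight_nonneg ω m' n
    rcases hW.eq_or_lt with h0 | h0
    · rw [← h0, zero_mul]; exact hC0
    rw [mul_comm, ← le_div_iff₀ h0]
    refine ContinuousMultilinearMap.opNorm_le_bound (by positivity) fun v => ?_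
    have hP : 0 ≤ ∏ k, ‖v k‖ := Finset.prod_nonneg fun _ _ => norm_nonneg _
    rcases hP.eq_or_lt with hP0 | hP0
    · refine (ContinuousMultilinearMap.le_opNorm _ v).trans ?_
      rw [← hP0, mul_zero, mul_zero]
    · have h1 := ((bumpFunctional ω X (hB f f.2)
        (youngWeight ω m' n * (∏ k, ‖v k‖)⁻¹) n x v).le_of_opNorm_le (hC ⟨n, f, x, v⟩) b).trans
          (mul_le_of_le_one_right hC0 hb)
      rw [bumpFunctional_apply, norm_mul, Complex.norm_real, Real.norm_of_nonneg (by positivity)] at h1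
      rw [div_mul_eq_mul_div, le_div_iff₀ h0]
      calc _ = (youngWeight ω m' n * (∏ k, ‖v k‖)⁻¹ * ‖iteratedFDeriv ℝ n
            ((f : EuclideanSpace ℝ (Fin N) → ℂ) * bumpSeries ω X b) x v‖) * ∏ k, ‖v k‖ := by
            field_simp
        _ ≤ C * ∏ k, ‖v k‖ := by gcongr
  have hfin : ∀ k : ℕ, (2 : ℝ) ^ k < D * C := by
    intro k
    -- The unit sequence isolates the Gaussian at $x_k$. Dividing by it bounds the derivatives of
    -- the $k$-th function at $x_k$ by $DC$ over the $k$-th coefficient, which against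
    -- $4^ke^{k\omega(x_k)}$ leaves $2^k<DC$ for all $k$.
    set b : ℕ →ᵇ ℂ := BoundedContinuousFunction.ofNormedAddCommGroupDiscrete
      (fun n => if n = k then (1 : ℂ) else 0) 1 (fun n => by split_ifs <;> simp) with hb
    have hb1 : ‖b‖ ≤ 1 := BoundedContinuousFunction.norm_ofNormedAddCommGroup_le _ zero_le_one _
    have hbk : ∀ n, b n = if n = k then (1 : ℂ) else 0 := fun n => rfl
    have hser : bumpSeries ω X b = (bumpCoeff ω X k : ℂ) • fun y => expSq (-Real.pi) (y - X k) := by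
      funext y
      rw [bumpSeries, tsum_eq_single k fun n hn => by rw [hbk, if_neg hn, zero_mul], hbk,
        if_pos rfl, one_mul]
      rfl
    set e := bumpCoeff ω X k with he
    have he0 : 0 < e := by rw [he, bumpCoeff]; positivity
    have hk : ∀ n, youngWeight ω m' n * ‖iteratedFDeriv ℝ n
        (fun y => F k y * expSq (-Real.pi) (y - X k)) (X k)‖ ≤ C / e := by
      intro n
      have h1 := hbound ⟨F k, hF k⟩ n (X k) b hb1
      have hs : ContDiffAt ℝ n (fun y => F k y * expSq (-Real.pi) (y - X k)) (X k) :=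
        (((hB _ (hF k)).mul ((contDiff_expSq _).comp (contDiff_id.sub contDiff_const))).of_le
          (by exact_mod_cast le_top)).contDiffAt
      have h2 : F k * bumpSeries ω X b =
          (e : ℂ) • fun y => F k y * expSq (-Real.pi) (y - X k) := by
        rw [hser, mul_smul_comm]
        rfl
      simp only at h1
      rw [h2, iteratedFDeriv_const_smul_apply hs, norm_smul, Complex.norm_real,
        Real.norm_of_nonneg he0.le] at h1
      rw [le_div_iff₀ he0]
      linarith
    have h3 := (hX k).trans_le (hloc (F k) (X k) _ (hB _ (hF k)) hk (J k))
    have h4 : e = (1 / 2) ^ k * Real.exp (-(k * ω ‖X k‖)) := rfl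
    have h5 : D * (C / e) = D * C * 2 ^ k * Real.exp (k * ω ‖X k‖) := by
      have h7 : (0 : ℝ) < 2 ^ k := by positivity
      rw [h4, Real.exp_neg, one_div, inv_pow]
      field_simp
    rw [h5] at h3
    have h6 := lt_of_mul_lt_mul_right h3 (Real.exp_nonneg _)
    rw [show (4 : ℝ) ^ k = 2 ^ k * 2 ^ k by rw [← mul_pow]; norm_num] at h6
    exact lt_of_mul_lt_mul_right h6 (by positivity)
  obtain ⟨k, hk⟩ := pow_unbounded_of_one_lt (D * C) one_lt_two
  exact (hk.trans (hfin k)).false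

end UniformBoundedness

/-! ### Comparison of the three topologies -/

section MultiplierTopologies

variable (ω : NQWeight) (N : ℕ)

/-- Here `≤` means finer. A basic neighbourhood of zero in $\mathcal L_b$ requires $T(S)\subseteq V$
with $S$ bounded, and $V$ contains a ball of finitely many seminorms. Each of these, uniformly on
$S$, is controlled by one seminorm of $\tau$. -/
theorem tauTop_le_tauBTop : tauTop ω N ≤ tauBTop (mulOperator ω N) := by
  let : TopologicalSpace (OMOmega ω N) := tauTop ω N
  have hτ : WithSeminorms (omSeminorm ω N) := ⟨rfl⟩
  have := hτ.topologicalAddGroup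
  rw [← continuous_iff_le_induced]
  refine continuous_of_continuousAt_zero (mulOperator ω N) ?_
  rw [ContinuousAt, map_zero, ContinuousLinearMap.hasBasis_nhds_zero.tendsto_right_iff]
  rintro ⟨S, V⟩ ⟨hS, hV⟩
  obtain ⟨s, r, hr, hsub⟩ := ((sOmega_withSeminorms ω N).mem_nhds_iff 0 V).1 hV
  have h : ∀ i ∈ s, ∀ᶠ f in 𝓝 (0 : OMOmega ω N), ∀ g ∈ S,
      sOmegaSeminorm ω N i (mulOperator ω N f g) < r := by
    rintro ⟨k, α⟩ -
    obtain ⟨q, C, hC, hq⟩ := exists_sOmegaSeminorm_mul_le_omSeminorm ω N k α hS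
    have hcont : Continuous fun f => C * omSeminorm ω N q f :=
      continuous_const.mul (hτ.continuous_seminorm q)
    have hlt := hcont.tendsto 0
    rw [map_zero, mul_zero] at hlt
    filter_upwards [hlt.eventually (gt_mem_nhds hr)] with f hf g hg
    exact (hq f g hg).trans_lt hf
  filter_upwards [(Filter.eventually_all_finset s).2 h] with f hf g hg
  refine hsub ?_
  rw [Seminorm.mem_ball_zero]
  exact Seminorm.finset_sup_apply_lt hr fun i hi => hf i hi g hg

variable {ω N}

theorem tauBTop_le_tauSTop (M : OMOmega ω N →ₗ[ℂ] (SOmega ω N →L[ℂ] SOmega ω N)) :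
    tauBTop M ≤ tauSTop M := by
  let : TopologicalSpace (OMOmega ω N) := tauBTop M
  rw [← continuous_iff_le_induced]
  exact (ContinuousLinearMap.toPointwiseConvergenceCLM ℂ (RingHom.id ℂ) (SOmega ω N)
    (SOmega ω N)).continuous.comp continuous_induced_dom

/-- A `τ_s`-bounded set is pointwise bounded on `S_ω`. -/
theorem isVonNBounded_image_apply (M : OMOmega ω N →ₗ[ℂ] (SOmega ω N →L[ℂ] SOmega ω N))
    {B : Set (OMOmega ω N)}
    (hB : @Bornology.IsVonNBounded ℂ (OMOmega ω N) _ _ _ (tauSTop M) B) (g : SOmega ω N) :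
    Bornology.IsVonNBounded ℂ ((fun f => M f g) '' B) := by
  let : TopologicalSpace (OMOmega ω N) := tauSTop M
  have hcont : Continuous fun f => M f g :=
    (PointwiseConvergenceCLM.evalCLM (RingHom.id ℂ) (SOmega ω N) g).continuous.comp
      continuous_induced_dom
  exact hB.image (⟨⟨⟨fun f => M f g, fun f h => by simp⟩, fun c f => by simp⟩, hcont⟩ :
    OMOmega ω N →L[ℂ] SOmega ω N)

/-- Boundedness of $\{fg : f\in B\}$ for each $g$ is the hypothesis of the uniform boundedness
principle above. It yields, for each $m$, one rate $n$ and one constant for the whole of $B$, and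
the decay of $g$ at rate $n$ then bounds $q_{m,g}$ on $B$. -/
theorem isVonNBounded_tauTop_of_tauSTop {B : Set (OMOmega ω N)}
    (hB : @Bornology.IsVonNBounded ℂ (OMOmega ω N) _ _ _ (tauSTop (mulOperator ω N)) B) :
    @Bornology.IsVonNBounded ℂ (OMOmega ω N) _ _ _ (tauTop ω N) B := by
  let : TopologicalSpace (OMOmega ω N) := tauTop ω N
  have hτ : WithSeminorms (omSeminorm ω N) := ⟨rfl⟩
  refine hτ.isVonNBounded_iff_seminorm_bounded.2 ?_
  rintro ⟨m, g⟩
  obtain ⟨n, C, hC, h⟩ := exists_growth_of_pointwise_bounded ω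
    (B := Subtype.val '' B) (by rintro _ ⟨f, -, rfl⟩; exact f.2.1)
    (by
      intro m g hg
      obtain ⟨k, D, hD, h⟩ := exists_youngWeight_mul_le_sOmegaSeminorm ω N m 0
      obtain ⟨r, hr, hb⟩ := (sOmega_withSeminorms ω N).isVonNBounded_iff_seminorm_bounded.1
        (isVonNBounded_image_apply (mulOperator ω N) hB ⟨g, hg⟩) (k, 0)
      refine ⟨D * r, ?_⟩
      rintro _ ⟨f, hf, rfl⟩ n x
      refine (h (mulOperator ω N f ⟨g, hg⟩) n x).trans ?_
      have := (hb _ (mem_image_of_mem _ hf)).le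
      simp only [Nat.cast_zero, zero_mul, neg_zero, Real.exp_zero, mul_one]
      gcongr) m
  have hs : 0 ≤ sOmegaSeminorm ω N (n, 0) g := apply_nonneg _ _
  refine ⟨sOmegaSeminorm ω N (n, 0) g * C + 1, by positivity, fun f hf => ?_⟩
  refine lt_of_le_of_lt ?_ (lt_add_one _)
  rw [omSeminorm_apply]
  refine Real.iSup_le (fun p => ?_) (by positivity)
  have h1 := h _ (mem_image_of_mem _ hf) (∑ i, p.1 i) p.2
  have h2 := norm_multiD_le p.1 f.2.1 p.2
  have h3 := g.norm_apply_le n p.2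
  have hw := youngWeight_nonneg ω m (∑ i, p.1 i)
  have he : Real.exp (-(n * ω ‖p.2‖)) * Real.exp (n * ω ‖p.2‖) = 1 := by
    rw [← Real.exp_add, neg_add_cancel, Real.exp_zero]
  calc _ = ‖g p.2‖ * (youngWeight ω m (∑ i, p.1 i) *
        ‖multiD p.1 (f : EuclideanSpace ℝ (Fin N) → ℂ) p.2‖) := mul_assoc _ _ _
    _ ≤ (sOmegaSeminorm ω N (n, 0) g * Real.exp (-(n * ω ‖p.2‖))) *
        (C * Real.exp (n * ω ‖p.2‖)) :=
      mul_le_mul h3 ((mul_le_mul_of_nonneg_left h2 hw).trans h1) (by positivity) (by positivity)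
    _ = sOmegaSeminorm ω N (n, 0) g * C := by
      linear_combination sOmegaSeminorm ω N (n, 0) g * C * he

/-- The uniform boundedness principle for the one-element set $\{f\}$: pointwise boundedness only
says that each $fg$ is in $\mathcal S_\omega$. Continuity of the multiplication operator is not
presupposed. -/
theorem mem_omOmega_of_multiplier {f : EuclideanSpace ℝ (Fin N) → ℂ}
    (hf : ContDiff ℝ (⊤ : ℕ∞) f)
    (hmul : ∀ g ∈ SOmegaSubmodule ω N, f * g ∈ SOmegaSubmodule ω N) :
    f ∈ OMOmegaSubmodule ω N := by
  refine mem_omOmega_iff.2 ⟨hf, fun m => ?_⟩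
  obtain ⟨n, C, -, h⟩ := exists_growth_of_pointwise_bounded ω (B := {f})
    (by rintro _ rfl; exact hf)
    (by
      intro m g hg
      obtain ⟨k, D, hD, h⟩ := exists_youngWeight_mul_le_sOmegaSeminorm ω N m 0
      refine ⟨D * sOmegaSeminorm ω N (k, 0) ⟨f * g, hmul g hg⟩, ?_⟩
      rintro _ rfl n x
      simpa using h ⟨_, hmul g hg⟩ n x) m
  exact ⟨n, C, h f rfl⟩

end MultiplierTopologies

/-! ### The theorem -/

theorem theorem5p9 (ω : NQWeight) (N : ℕ) (hN : 1 ≤ N) :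
    (∀ f : EuclideanSpace ℝ (Fin N) → ℂ, f ∈ OMOmegaSubmodule ω N ↔
      ContDiff ℝ (⊤ : ℕ∞) f ∧ ∀ g ∈ SOmegaSubmodule ω N, f * g ∈ SOmegaSubmodule ω N) ∧
    ∃ M : OMOmega ω N →ₗ[ℂ] (SOmega ω N →L[ℂ] SOmega ω N),
      (∀ (f : OMOmega ω N) (g : SOmega ω N) (x : EuclideanSpace ℝ (Fin N)),
        (M f g : SOmega ω N) x = f x * g x) ∧
      Function.Injective M ∧
      (tauTop ω N ≤ tauBTop M ∧ tauBTop M ≤ tauSTop M) ∧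
      (Continuous[tauTop ω N, tauBTop M] id ∧ Continuous[tauBTop M, tauSTop M] id) ∧
      ∀ B : Set (OMOmega ω N),
        (@Bornology.IsVonNBounded ℂ (OMOmega ω N) _ _ _ (tauTop ω N) B ↔
          @Bornology.IsVonNBounded ℂ (OMOmega ω N) _ _ _ (tauBTop M) B) ∧
        (@Bornology.IsVonNBounded ℂ (OMOmega ω N) _ _ _ (tauBTop M) B ↔
          @Bornology.IsVonNBounded ℂ (OMOmega ω N) _ _ _ (tauSTop M) B) := by
  have hbs := tauBTop_le_tauSTop (mulOperator ω N)
  refine ⟨fun f => ⟨fun hf => ⟨hf.1, fun g hg => mul_mem_sOmega hf hg⟩,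
    fun hf => mem_omOmega_of_multiplier hf.1 hf.2⟩, mulOperator ω N, fun _ _ _ => rfl,
    mulOperator_injective ω N, ⟨tauTop_le_tauBTop ω N, hbs⟩,
    ⟨continuous_id_iff_le.2 (tauTop_le_tauBTop ω N), continuous_id_iff_le.2 hbs⟩, fun B => ?_⟩
  have h₁ := fun h => Bornology.IsVonNBounded.of_topologicalSpace_le (𝕜 := ℂ) (s := B)
    (tauTop_le_tauBTop ω N) h
  have h₂ := fun h => Bornology.IsVonNBounded.of_topologicalSpace_le (𝕜 := ℂ) (s := B) hbs h
  -- Bounded sets pass to coarser topologies, from $\tau$ to $\tau_b$ to $\tau_s$; the step from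
  -- $\tau_s$ back to $\tau$ closes the circle.
  exact ⟨⟨h₁, fun h => isVonNBounded_tauTop_of_tauSTop (h₂ h)⟩,
    ⟨h₂, fun h => h₁ (isVonNBounded_tauTop_of_tauSTop h)⟩⟩
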